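/- Let $H_d, H_1,\dots,H_m$ be traceless Hermitian complex $n\times n$ matrices, let $\mathfrak k$ and $\mathfrak g$ be the real Lie algebras generated by $iH_1,\dots,iH_m$ and by $iH_d,iH_1,\dots,iH_m$ respectively, and let $K\subseteq G\subseteq \mathrm{SU}(n)$ be the groups generated by $\exp\mathfrak k$ and $\exp\mathfrak g$. Assume that $K$ is closed in $\mathrm{SU}(n)$. Put $\langle X,Y\rangle_K=-2n\,\mathrm{Tr}(XY)$, let $\mathfrak p=\mathfrak k^\perp$ be the orthogonal complement of $\mathfrak k$ in $\mathfrak g$, and let $\mathcal O(iH_d)=\{k^{-1}(iH_d)k : k\in K\}$. (1) $\mathcal O(iH_d)$ is a smooth submanifold of the space of $n\times n$ matrices, of dimension $$\dim\mathcal O(iH_d)=\dim\mathfrak k-\dim\{A\in\mathfrak k : [H_d,A]=0\}.$$ (2) If $iH_d\in\mathfrak p$ and $H_d\neq 0$, then $$\dim\{A\in\mathfrak k : [H_d,A]=0\}\ \ge\ 1+\dim\mathfrak k-\dim\mathfrak p. \qquad (*)$$ (3) Suppose $iH_d\in\mathfrak p$, $H_d\ne 0$, and that either the system is controllable ($\mathfrak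 g=\mathfrak{su}(n)$) or $\dim\mathfrak p\ge 2$. Then equality holds in $(*)$ if and only if $\mathcal O(iH_d)$ is the whole sphere $\{X\in\mathfrak p : \langle X,X\rangle_K=\langle iH_d,iH_d\rangle_K\}$. Moreover, if equality holds, then $$T_{\mathrm{QSL}}=\frac{\mathrm{diam}(G/K)}{\sqrt{2n\,\mathrm{Tr}(H_d^2)}},$$ that is, the lower bound $T_{\mathrm{QSL}}\ge \mathrm{diam}(G/K)/\sqrt{2n\,\mathrm{Tr}(H_d^2)}$ is tight. Here $G/K$ is the space of right cosets $Kg$ with the $G$-invariant Riemannian metric induced by $\langle\cdot,\cdot\rangle_K$ on $\mathfrak p\cong T_{[1]}(G/K)$, and $T_{\mathrm{QSL}}$ is the infimum of the times $T$ such that every element of $G$ can be reached to arbitrarily good precision within time at most $T$ by solutions of $i\dot U(t)=\bigl(H_d+\sum_{j}f_j(t)H_j\bigr)U(t)$, $U(0)=\mathbb 1$, with arbitrary integrable real control functions $f_j$. (4) If $\mathfrak k=\mathfrak{so}(n)$ (the real skew-symmetric matrices) and $H_d=\mathrm{diag}(\lambda_1,\dots,\lambda_n)$ with $\lambda_i$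 real, then $\dim\{A\in\mathfrak k : [H_d,A]=0\}$ is the number $M$ of pairs $i<j$ with $\lambda_i=\lambda_j$, and hence $\dim\mathcal O(iH_d)=\dim\mathfrak k-M$. -/

import Mathlib

open scoped ENNReal NNReal ContDiff

attribute [local instance 100] LieRing.ofAssociativeRing

noncomputable section

namespace QuantumControl

/-- Complex `n × n` matrices. -/
abbrev Mat (n : ℕ) := Matrix (Fin n) (Fin n) ℂ

/-- The special unitary group `SU(n)`. -/
abbrev SU (n : ℕ) := Matrix.specialUnitaryGroup (Fin n) ℂ

/-- `S` is a `d`-dimensional (embedded, smooth) submanifold of the real normed space `E`: around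
each of its points, `S` is the homeomorphic image, under a smooth immersion `φ`, of an open subset
of `ℝ^d`. -/
def IsSubmanifoldOfDim {E : Type*} [NormedAddCommGroup E] [NormedSpace ℝ E]
    (S : Set E) (d : ℕ) : Prop :=
  ∀ x ∈ S, ∃ (U : Set E) (V : Set (EuclideanSpace ℝ (Fin d)))
    (φ : EuclideanSpace ℝ (Fin d) → E) (ψ : E → EuclideanSpace ℝ (Fin d)),
    IsOpen U ∧ x ∈ U ∧ IsOpen V ∧
    ContDiffOn ℝ ∞ φ V ∧ (∀ v ∈ V, Function.Injective (fderiv ℝ φ v)) ∧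
    Set.BijOn φ V (U ∩ S) ∧ (∀ v ∈ V, ψ (φ v) = v) ∧ ContinuousOn ψ (U ∩ S)

section MatrixSubmanifold

open scoped Matrix.Norms.Frobenius

/-- A set of complex `n × n` matrices is a smooth submanifold of dimension `d`. (The choice of the
Frobenius norm does not matter, the space of matrices being finite dimensional.) -/
def HasManifoldDim {n : ℕ} (M : Set (Mat n)) (d : ℕ) : Prop := IsSubmanifoldOfDim M d

end MatrixSubmanifold

/-- The pairing `⟨X, Y⟩_K = -2n Tr(XY)`; it is real valued and positive definite on
skew-Hermitian matrices (hence the real part loses nothing there). -/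
def killing {n : ℕ} (X Y : Mat n) : ℝ := (-2 * (n : ℂ) * (X * Y).trace).re

/-- The length `√⟨X, X⟩_K`. -/
def killingNorm {n : ℕ} (X : Mat n) : ℝ := Real.sqrt (killing X X)

/-- The data of the control problem `H = H_d + ∑ j, f_j(t) H_j` in an `n`-dimensional system:
traceless Hermitian drift and control Hamiltonians. -/
structure ControlSystem (n m : ℕ) where
  /-- the drift Hamiltonian `H_d` -/
  drift : Mat n
  /-- the control Hamiltonians `H_j` -/
  control : Fin m → Mat n
  drift_isHermitian : drift.IsHermitian
  drift_trace : drift.trace = 0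
  control_isHermitian : ∀ j, (control j).IsHermitian
  control_trace : ∀ j, (control j).trace = 0

namespace ControlSystem

variable {n m : ℕ} (S : ControlSystem n m)

/-- `i H_d`. -/
def iDrift : Mat n := Complex.I • S.drift

/-- The control algebra `𝔨`: the real Lie algebra generated by the `i H_j`. -/
def kAlg : LieSubalgebra ℝ (Mat n) :=
  LieSubalgebra.lieSpan ℝ (Mat n) (Set.range fun j => Complex.I • S.control j)

/-- The dynamical Lie algebra `𝔤`: the real Lie algebra generated by `i H_d` and the `i H_j`. -/
def gAlg : LieSubalgebra ℝ (Mat n) :=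
  LieSubalgebra.lieSpan ℝ (Mat n)
    (insert S.iDrift (Set.range fun j => Complex.I • S.control j))

/-- The control group `K`, generated by the exponentials of elements of `𝔨`. -/
def K : Subgroup (SU n) :=
  Subgroup.closure {u | ∃ A ∈ S.kAlg, (u : Mat n) = NormedSpace.exp A}

/-- The dynamical group `G`, generated by the exponentials of elements of `𝔤`. -/
def G : Subgroup (SU n) :=
  Subgroup.closure {u | ∃ A ∈ S.gAlg, (u : Mat n) = NormedSpace.exp A}

/-- The system is controllable: `𝔤 = 𝔰𝔲(n)`. -/
def Controllable : Prop :=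
  ∀ X : Mat n, X ∈ S.gAlg ↔ X.conjTranspose = -X ∧ X.trace = 0

/-- `𝔭 = 𝔨^⊥`, the orthogonal complement of `𝔨` in `𝔤` for `⟨·,·⟩_K`. -/
def pSpace : Submodule ℝ (Mat n) where
  carrier := {X | X ∈ S.gAlg ∧ ∀ A ∈ S.kAlg, killing A X = 0}
  zero_mem' := ⟨S.gAlg.zero_mem, fun A _ => by simp [killing]⟩
  add_mem' := by
    rintro X Y ⟨hX, hX'⟩ ⟨hY, hY'⟩
    refine ⟨S.gAlg.add_mem hX hY, fun A hA => ?_⟩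
    have h : killing A (X + Y) = killing A X + killing A Y := by
      simp only [killing, mul_add, Matrix.trace_add, Complex.add_re]
    rw [h, hX' A hA, hY' A hA, add_zero]
  smul_mem' := by
    rintro c X ⟨hX, hX'⟩
    refine ⟨S.gAlg.smul_mem c hX, fun A hA => ?_⟩
    have h : killing A (c • X) = c * killing A X := by
      simp only [killing, Matrix.trace_smul, mul_smul_comm,
        Complex.smul_re, smul_eq_mul]
    rw [h, hX' A hA, mul_zero]

/-- The centralizer `{A ∈ 𝔨 : [H_d, A] = 0}`. -/
def driftCentralizer : Submodule ℝ (Mat n) where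
  carrier := {A | A ∈ S.kAlg ∧ ⁅S.drift, A⁆ = 0}
  zero_mem' := ⟨S.kAlg.zero_mem, lie_zero _⟩
  add_mem' := by
    rintro X Y ⟨hX, hX'⟩ ⟨hY, hY'⟩
    exact ⟨S.kAlg.add_mem hX hY, by rw [lie_add, hX', hY', add_zero]⟩
  smul_mem' := by
    rintro c X ⟨hX, hX'⟩
    exact ⟨S.kAlg.smul_mem c hX, by rw [lie_smul, hX', smul_zero]⟩

/-- The adjoint orbit `𝒪(A) = {k⁻¹ A k : k ∈ K}`. -/
def adjointOrbit (A : Mat n) : Set (Mat n) :=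
  {X | ∃ k ∈ S.K, X = ((k⁻¹ : SU n) : Mat n) * A * (k : Mat n)}

/-- The sphere in `𝔭`, centred at the origin, of radius `r = √⟨iH_d, iH_d⟩_K`. -/
def driftSphere : Set (Mat n) :=
  {X | X ∈ S.pSpace ∧ killingNorm X = killingNorm S.iDrift}

/-! ### The Riemannian geometry of `G/K` -/

/-- `G/K`, the set of right cosets `[g] = K g` with `g ∈ G`. -/
abbrev QuotientSpace : Type :=
  Quotient (QuotientGroup.rightRel (S.K.subgroupOf S.G))

/-- A `C¹` curve `g : [0,1] → G`, with its velocity `g' = (Y + Z) g` split along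
`𝔤 = 𝔭 ⊕ 𝔨` (`Y` in `𝔭`, `Z` in `𝔨`). Each `C¹` curve in `G/K` is the projection `[g]` of one. -/
structure LiftedCurve where
  g : ℝ → S.G
  Y : ℝ → Mat n
  Z : ℝ → Mat n
  Y_continuousOn : ContinuousOn Y (Set.Icc 0 1)
  Z_continuousOn : ContinuousOn Z (Set.Icc 0 1)
  Y_mem : ∀ t ∈ Set.Icc (0 : ℝ) 1, Y t ∈ S.pSpace
  Z_mem : ∀ t ∈ Set.Icc (0 : ℝ) 1, Z t ∈ S.kAlg
  hasDeriv : ∀ t ∈ Set.Icc (0 : ℝ) 1,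
    HasDerivWithinAt (fun s => ((g s : SU n) : Mat n))
      ((Y t + Z t) * ((g t : SU n) : Mat n)) (Set.Icc 0 1) t

/-- The length of the projected curve `[g]` in `G/K`. By `G`-invariance the velocity of `[g]` at
time `t` has the same length as its translate by `g(t)⁻¹` to the origin, which under
`T_o(G/K) ≅ 𝔭` is the `𝔭`-component `Y(t)` of `g'(t) g(t)⁻¹`. -/
def LiftedCurve.length {S : ControlSystem n m} (c : S.LiftedCurve) : ℝ :=
  ∫ t in (0 : ℝ)..1, killingNorm (c.Y t)

/-- The Riemannian distance on `G/K`: the infimum of the lengths of the `C¹` curves joining two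
points. -/
def quotientDist (x y : S.QuotientSpace) : ℝ≥0∞ :=
  ⨅ (c : S.LiftedCurve) (_ : Quotient.mk _ (c.g 0) = x) (_ : Quotient.mk _ (c.g 1) = y),
    ENNReal.ofReal c.length

/-- The diameter of `G/K`. -/
def quotientDiam : ℝ≥0∞ := ⨆ (x : S.QuotientSpace) (y : S.QuotientSpace), S.quotientDist x y

/-! ### The quantum speed limit -/

section Reachable

open scoped Matrix.Norms.Frobenius

/-- The unitaries `U(t)` with `0 ≤ t ≤ T`, where `U` solves
`i U'(s) = (H_d + ∑ j, f_j(s) H_j) U(s)`, `U(0) = 1` (in integrated form) on `[0, t]`, for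
arbitrary integrable real control functions `f_j`. -/
def reachableWithin (T : ℝ) : Set (SU n) :=
  {u | ∃ t ∈ Set.Icc (0 : ℝ) T, ∃ (f : Fin m → ℝ → ℝ) (U : ℝ → Mat n),
    (∀ j, IntervalIntegrable (f j) MeasureTheory.volume 0 t) ∧
    ContinuousOn U (Set.Icc 0 t) ∧
    (∀ s ∈ Set.Icc (0 : ℝ) t,
      U s = 1 - Complex.I •
        ∫ r in (0 : ℝ)..s, (S.drift + ∑ j, f j r • S.control j) * U r) ∧
    U t = (u : Mat n)}

end Reachable

/-- `T_QSL`, the minimum time in which all unitaries of `G` can be reached (to arbitrarily good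
precision, the control amplitudes being arbitrarily large but finite); `∞` if there is no such
time. -/
def speedLimit : ℝ≥0∞ :=
  ⨅ (T : ℝ≥0) (_ : (S.G : Set (SU n)) ⊆ closure (S.reachableWithin (T : ℝ))), (T : ℝ≥0∞)

/-- The speed `√(2n Tr(H_d²))` of the motion in `G/K`. -/
def driftSpeed : ℝ := Real.sqrt (2 * (n : ℝ) * (S.drift * S.drift).trace.re)

/-- The lower bound `T_QSL ≥ diam(G/K) / √(2n Tr(H_d²))` is tight, i.e. it is an equality. -/
def BoundIsTight : Prop :=
  S.speedLimit = S.quotientDiam / ENNReal.ofReal S.driftSpeed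

end ControlSystem

/-- The Lie algebra `𝔰𝔬(n)` of real skew-symmetric matrices, as a set of complex matrices. -/
def soSet (n : ℕ) : Set (Mat n) :=
  (fun A : Matrix (Fin n) (Fin n) ℝ => A.map ((↑) : ℝ → ℂ)) ''
    (LieAlgebra.Orthogonal.so (Fin n) ℝ : Set (Matrix (Fin n) (Fin n) ℝ))

/-- The number of pairs `i < j` with `lam i = lam j`. -/
def degeneratePairs {n : ℕ} (lam : Fin n → ℝ) : ℕ :=
  Nat.card {p : Fin n × Fin n // p.1 < p.2 ∧ lam p.1 = lam p.2}

end QuantumControl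

end

/-! Dimension. Near `iH_d` the orbit of the compact group `K` is parametrized by `V ↦ exp(-V) (iH_d)
exp V`, with `V` small in a complement of the centralizer in `𝔨`. The derivative `V ↦ [iH_d, V]` is
injective there. That small `V` suffice follows from the local form of `K` near `1` and compactness.
If `iH_d ∈ 𝔭`, invariance of the trace form puts the orbit on a sphere of `𝔭`, so its tangent space
`[iH_d, 𝔨]` lies in the hyperplane `driftPerp` of `𝔭` orthogonal to `iH_d`. Rank-nullity gives the
inequality, with equality exactly when `[iH_d, 𝔨] = driftPerp`.

Equality. If the tangent spaces agree, the orbit is open in the sphere by the inverse function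
theorem and closed by compactness; the sphere is connected when `dim 𝔭 ≥ 2`. Conversely, if the
orbit is the sphere, the velocities of great circles are tangent to the orbit. Controllability
forces `dim 𝔭 ≥ 2` because `𝔰𝔲(n)` has trivial centre.

Speed limit, upper bound. Strong controls generate all of `K` in arbitrarily short time (Trotter
products and conjugation). If the orbit is the sphere, every direction of `𝔭` is a positive multiple
of a conjugate of `-iH_d`, so `exp P` costs time `‖P‖/‖iH_d‖`. A curve in `G/K` is then followed by
product integrals in time length/speed (`LiftedCurve.mem_limitReach`).

Speed limit, lower bound. A piecewise constant propagator of duration `t` projects to a curve of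
length `t` times the speed. To pass from approximate to exact endpoints, elements of `G` close to
`1` as matrices must be joined to `1` by short curves inside `G`, which fails for a group with dense
windings. This is excluded by `ClosedPair`: `𝔤 = 𝔨 + [𝔤, 𝔤]` and `K` is closed. Any further
one-parameter group in the closure of `G` would be central, and partial determinants, which brackets
do not affect, compare it with `K` (`ClosedPair.eq_zero_of_exp_smul_mem`). -/

noncomputable section

/-! ### The Lie algebra `𝔰𝔲(n)` and its exponential -/

namespace QuantumControl

open scoped Matrix.Norms.Frobenius
open Matrix Filter Topology
open NormedSpace (exp)

variable {n : ℕ}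

/-- The Lie algebra `𝔰𝔲(n)` of traceless skew-Hermitian matrices. -/
def su (n : ℕ) : LieSubalgebra ℝ (Mat n) where
  carrier := {X | X.conjTranspose = -X ∧ X.trace = 0}
  zero_mem' := by simp
  add_mem' := by
    rintro X Y ⟨hX, hX'⟩ ⟨hY, hY'⟩
    exact ⟨by rw [conjTranspose_add, hX, hY, neg_add], by rw [trace_add, hX', hY', add_zero]⟩
  smul_mem' := by
    rintro c X ⟨hX, hX'⟩
    exact ⟨by rw [conjTranspose_smul, hX, star_trivial, smul_neg],
      by rw [trace_smul, hX', smul_zero]⟩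
  lie_mem' := by
    rintro X Y ⟨hX, -⟩ ⟨hY, -⟩
    refine ⟨?_, ?_⟩
    · rw [LieRing.of_associative_ring_bracket, conjTranspose_sub, conjTranspose_mul,
        conjTranspose_mul, hX, hY]
      noncomm_ring
    · rw [LieRing.of_associative_ring_bracket, trace_sub, trace_mul_comm, sub_self]

theorem exists_unitary_diagonal_of_skew {A : Mat n} (hA : A.conjTranspose = -A) :
    ∃ (U : unitaryGroup (Fin n) ℂ) (lam : Fin n → ℝ),
      A = (U : Mat n) * diagonal (fun i => Complex.I * lam i) * star (U : Mat n) := by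
  have hH : ((-Complex.I) • A).IsHermitian := by
    rw [IsHermitian, conjTranspose_smul, hA]; simp
  refine ⟨hH.eigenvectorUnitary, hH.eigenvalues, ?_⟩
  have h := hH.spectral_theorem
  rw [Unitary.conjStarAlgAut_apply] at h
  have h2 : A = Complex.I • ((-Complex.I) • A) := by
    rw [smul_smul]; simp
  refine h2.trans ?_
  conv_lhs => rw [h]
  rw [← smul_mul_assoc, ← mul_smul_comm, ← diagonal_smul]
  rfl

theorem exp_unitary_conj (U : unitaryGroup (Fin n) ℂ) (A : Mat n) :
    exp ((U : Mat n) * A * star (U : Mat n)) = (U : Mat n) * exp A * star (U : Mat n) := by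
  have := Matrix.exp_units_conj (Unitary.toUnits U) A
  simpa using this

theorem det_unitary_conj (U : unitaryGroup (Fin n) ℂ) (A : Mat n) :
    ((U : Mat n) * A * star (U : Mat n)).det = A.det := by
  rw [det_mul_right_comm, mem_unitaryGroup_iff.1 U.2, one_mul]

/-- Both sides are invariant under unitary conjugation, so diagonalization reduces this to scalars.
-/
theorem det_exp_of_skew {A : Mat n} (hA : A.conjTranspose = -A) :
    (exp A).det = Complex.exp A.trace := by
  obtain ⟨U, lam, rfl⟩ := exists_unitary_diagonal_of_skew hA
  rw [exp_unitary_conj, det_unitary_conj, Matrix.exp_diagonal, det_diagonal, trace_mul_cycle,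
    Unitary.coe_star_mul_self, one_mul, trace_diagonal, Complex.exp_sum]
  simp [Complex.exp_eq_exp_ℂ]

theorem exp_skew_mem_unitaryGroup {A : Mat n} (hA : A.conjTranspose = -A) :
    exp A ∈ unitaryGroup (Fin n) ℂ := by
  rw [mem_unitaryGroup_iff, star_eq_conjTranspose, ← Matrix.exp_conjTranspose, hA,
    ← Matrix.exp_add_of_commute _ _ (Commute.refl A).neg_right]
  simp

theorem exp_mem_specialUnitaryGroup {A : Mat n} (hA : A ∈ su n) : exp A ∈ SU n := by
  refine mem_specialUnitaryGroup_iff.2 ⟨exp_skew_mem_unitaryGroup hA.1, ?_⟩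
  rw [det_exp_of_skew hA.1, hA.2, Complex.exp_zero]

/-- The exponential map `𝔰𝔲(n) → SU(n)`. -/
def suExp (A : Mat n) (hA : A ∈ su n) : SU n := ⟨exp A, exp_mem_specialUnitaryGroup hA⟩

theorem SU.coe_inv (u : SU n) : ((u⁻¹ : SU n) : Mat n) = (u : Mat n).conjTranspose := rfl

theorem SU.inv_mul (u : SU n) : ((u⁻¹ : SU n) : Mat n) * (u : Mat n) = 1 := by
  rw [← Submonoid.coe_mul, inv_mul_cancel, Submonoid.coe_one]

theorem SU.mul_inv (u : SU n) : (u : Mat n) * ((u⁻¹ : SU n) : Mat n) = 1 := by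
  rw [← Submonoid.coe_mul, mul_inv_cancel, Submonoid.coe_one]

instance SU.continuousInv : ContinuousInv (SU n) :=
  ⟨Continuous.subtype_mk (continuous_subtype_val.matrix_conjTranspose) _⟩

instance SU.isTopologicalGroup : IsTopologicalGroup (SU n) where

theorem norm_sq_eq_trace (A : Mat n) : ‖A‖ ^ 2 = (A.conjTranspose * A).trace.re := by
  rw [frobenius_norm_def, ← Real.sqrt_eq_rpow, Real.sq_sqrt (by positivity), trace,
    Finset.sum_comm]
  simp [mul_apply, Complex.re_sum, ← Complex.normSq_eq_norm_sq, Complex.normSq_apply]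

theorem norm_unitary_mul {U : Mat n} (hU : U ∈ unitaryGroup (Fin n) ℂ) (A : Mat n) :
    ‖U * A‖ = ‖A‖ := by
  rw [← sq_eq_sq₀ (norm_nonneg _) (norm_nonneg _), norm_sq_eq_trace, norm_sq_eq_trace,
    conjTranspose_mul, mul_assoc, ← mul_assoc _ U A, ← star_eq_conjTranspose U,
    mem_unitaryGroup_iff'.1 hU, one_mul]

theorem norm_mul_unitary {U : Mat n} (hU : U ∈ unitaryGroup (Fin n) ℂ) (A : Mat n) :
    ‖A * U‖ = ‖A‖ := by
  rw [← frobenius_norm_conjTranspose, conjTranspose_mul, ← star_eq_conjTranspose U,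
    norm_unitary_mul (Unitary.star_mem hU), frobenius_norm_conjTranspose]

theorem SU.norm_mul (u : SU n) (A : Mat n) : ‖(u : Mat n) * A‖ = ‖A‖ :=
  norm_unitary_mul u.2.1 A

theorem SU.norm_mul' (u : SU n) (A : Mat n) : ‖A * (u : Mat n)‖ = ‖A‖ :=
  norm_mul_unitary u.2.1 A

theorem SU.norm_coe (u : SU n) : ‖(u : Mat n)‖ = ‖(1 : Mat n)‖ := by
  rw [← SU.norm_mul u 1, mul_one]

/-- Compactness is what makes images of closed subsets of `SU(n)` closed: orbits, projections and
sets of exponentials below. -/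
instance SU.compactSpace : CompactSpace (SU n) := by
  refine isCompact_iff_compactSpace.1 ?_
  have hcl : IsClosed ((SU n : Submonoid (Mat n)) : Set (Mat n)) := by
    have : ((SU n : Submonoid (Mat n)) : Set (Mat n)) =
        {U | U * U.conjTranspose = 1} ∩ {U | U.det = 1} := by
      ext U
      simp [mem_specialUnitaryGroup_iff, mem_unitaryGroup_iff, star_eq_conjTranspose]
    rw [this]
    exact (isClosed_eq (by fun_prop) continuous_const).inter
      (isClosed_eq (by fun_prop) continuous_const)
  refine (isCompact_closedBall (0 : Mat n) ‖(1 : Mat n)‖).of_isClosed_subset hcl fun U hU => ?_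
  rw [mem_closedBall_zero_iff]
  exact (SU.norm_coe ⟨U, hU⟩).le

end QuantumControl

/-! ### Groups generated by exponentials and the trace form -/

namespace QuantumControl

open scoped Matrix.Norms.Frobenius
open Matrix Filter Topology
open NormedSpace (exp)

variable {n : ℕ}

theorem exp_add_mat {A B : Mat n} (h : Commute A B) : exp (A + B) = exp A * exp B :=
  Matrix.exp_add_of_commute A B h

theorem exp_mul_exp_neg (A : Mat n) : exp A * exp (-A) = 1 := by
  rw [← exp_add_mat (Commute.refl A).neg_right]; simp

theorem exp_neg_mul_exp (A : Mat n) : exp (-A) * exp A = 1 := by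
  rw [← exp_add_mat (Commute.refl A).neg_left]; simp

theorem continuous_exp_mat : Continuous (exp : Mat n → Mat n) :=
  letI : NormedAlgebra ℚ (Mat n) := NormedAlgebra.restrictScalars ℚ ℝ (Mat n)
  NormedSpace.exp_continuous

/-! ### Conjugation by `exp A` as the exponential of `ad A` -/

section BanachAlgebra

variable {E : Type*} [NormedRing E] [NormedAlgebra ℝ E] [CompleteSpace E]

theorem exp_mulLeft_apply (A B : E) :
    exp (ContinuousLinearMap.mul ℝ E A) B = exp A * B := by
  have h1 := (NormedSpace.exp_series_hasSum_exp' (𝕂 := ℝ)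
    (ContinuousLinearMap.mul ℝ E A)).mapL (ContinuousLinearMap.apply ℝ E B)
  have h2 := (NormedSpace.exp_series_hasSum_exp' (𝕂 := ℝ) A).mul_right B
  have : ∀ k : ℕ, ((ContinuousLinearMap.mul ℝ E A) ^ k) B = A ^ k * B := by
    intro k
    induction k with
    | zero => simp
    | succ k ih => rw [pow_succ', mul_apply_eq_comp, ih]; simp [pow_succ', mul_assoc]
  exact h1.unique (h2.congr_fun fun k => by simp [this])

theorem exp_mulRight_apply (A B : E) :
    exp ((ContinuousLinearMap.mul ℝ E).flip A) B = B * exp A := by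
  have h1 := (NormedSpace.exp_series_hasSum_exp' (𝕂 := ℝ)
    ((ContinuousLinearMap.mul ℝ E).flip A)).mapL (ContinuousLinearMap.apply ℝ E B)
  have h2 := (NormedSpace.exp_series_hasSum_exp' (𝕂 := ℝ) A).mul_left B
  have : ∀ k : ℕ, (((ContinuousLinearMap.mul ℝ E).flip A) ^ k) B = B * A ^ k := by
    intro k
    induction k with
    | zero => simp
    | succ k ih => rw [pow_succ', mul_apply_eq_comp, ih]; simp [pow_succ, mul_assoc]
  exact h1.unique (h2.congr_fun fun k => by simp [this])

/-- A closed subspace stable under `[A, ·]` is stable under conjugation by `exp A`. -/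
theorem exp_conj_mem_of_isClosed {V : Submodule ℝ E} (hV : IsClosed (V : Set E)) {A : E}
    (hA : ∀ B ∈ V, A * B - B * A ∈ V) {B : E} (hB : B ∈ V) :
    exp A * B * exp (-A) ∈ V := by
  -- Here `a + b` is `ad A`. Left and right multiplications commute, so `exp (a + b)` splits into
  -- conjugation by `exp A`.
  set a := ContinuousLinearMap.mul ℝ E A
  set b := (ContinuousLinearMap.mul ℝ E).flip (-A)
  have hab : Commute a b := by
    ext1 X
    simp [a, b, mul_assoc]
  have h1 : exp (a + b) B = exp A * B * exp (-A) := by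
    let _ : NormedAlgebra ℚ (E →L[ℝ] E) := NormedAlgebra.restrictScalars ℚ ℝ (E →L[ℝ] E)
    rw [NormedSpace.exp_add_of_commute hab, mul_apply_eq_comp, exp_mulLeft_apply,
      exp_mulRight_apply, mul_assoc]
  rw [← h1]
  have h2 := (NormedSpace.exp_series_hasSum_exp' (𝕂 := ℝ) (a + b)).mapL
      (ContinuousLinearMap.apply ℝ E B)
  -- The partial sums of `exp (ad A) B` lie in `V`, and `V` is closed.
  refine hV.mem_of_tendsto h2 (Eventually.of_forall fun s => ?_)
  refine V.sum_mem fun k hk => ?_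
  clear hk
  simp only [map_smul]
  refine V.smul_mem _ ?_
  induction k with
  | zero => simpa using hB
  | succ k ih =>
    have := hA _ ih
    rw [pow_succ']
    simpa [a, b, sub_eq_add_neg] using this

end BanachAlgebra

/-- A subspace stable under `[A, ·]` is stable under conjugation by `exp A`. -/
theorem exp_conj_mem {V : Submodule ℝ (Mat n)} {A : Mat n}
    (hA : ∀ B ∈ V, A * B - B * A ∈ V) {B : Mat n} (hB : B ∈ V) :
    exp A * B * exp (-A) ∈ V :=
  exp_conj_mem_of_isClosed V.closed_of_finiteDimensional hA hB

/-- The subgroup of `SU(n)` generated by the exponentials of elements of `𝔩`. -/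
def expGroup (l : LieSubalgebra ℝ (Mat n)) : Subgroup (SU n) :=
  Subgroup.closure {u | ∃ A ∈ l, (u : Mat n) = exp A}

theorem exp_mem_expGroup {l : LieSubalgebra ℝ (Mat n)} {u : SU n} {A : Mat n} (hA : A ∈ l)
    (h : (u : Mat n) = exp A) : u ∈ expGroup l :=
  Subgroup.subset_closure ⟨A, hA, h⟩

theorem expGroup_mono {k l : LieSubalgebra ℝ (Mat n)} (h : k ≤ l) : expGroup k ≤ expGroup l :=
  Subgroup.closure_mono fun _ ⟨A, hA, hu⟩ => ⟨A, h hA, hu⟩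

/-- An induction principle: it is enough to multiply exponentials. -/
theorem expGroup_induction {l : LieSubalgebra ℝ (Mat n)} {p : SU n → Prop}
    (one : p 1) (mul : ∀ (u v : SU n) (A : Mat n), A ∈ l → (u : Mat n) = exp A → p v → p (u * v))
    {g : SU n} (hg : g ∈ expGroup l) : p g := by
  -- The set of exponentials is stable under inversion, so products of generators exhaust the group.
  have inv_exp : ∀ {u : SU n} {A : Mat n}, (u : Mat n) = exp A →
      ((u⁻¹ : SU n) : Mat n) = exp (-A) := by
    intro u A h
    have h1 := SU.inv_mul u
    rw [h] at h1
    calc ((u⁻¹ : SU n) : Mat n) = ((u⁻¹ : SU n) : Mat n) * (exp A * exp (-A)) := by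
          rw [exp_mul_exp_neg, mul_one]
      _ = exp (-A) := by rw [← mul_assoc, h1, one_mul]
  induction hg using Subgroup.closure_induction_left with
  | one => exact one
  | mul_left x hx y hy ih =>
    obtain ⟨A, hA, h⟩ := hx
    exact mul x y A hA h ih
  | inv_mul_cancel x hx y hy ih =>
    obtain ⟨A, hA, h⟩ := hx
    exact mul x⁻¹ y (-A) (l.neg_mem hA) (inv_exp h) ih

theorem expGroup_conj_mem {l : LieSubalgebra ℝ (Mat n)} {V : Submodule ℝ (Mat n)}
    (hV : ∀ A ∈ l, ∀ B ∈ V, A * B - B * A ∈ V) {g : SU n} (hg : g ∈ expGroup l) :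
    ∀ {B : Mat n}, B ∈ V → (g : Mat n) * B * ((g⁻¹ : SU n) : Mat n) ∈ V := by
  refine expGroup_induction (p := fun g => ∀ {B : Mat n}, B ∈ V →
    (g : Mat n) * B * ((g⁻¹ : SU n) : Mat n) ∈ V) ?_ ?_ hg
  · intro B hB; simpa using hB
  · intro u v A hA hu ih B hB
    have h1 : ((u⁻¹ : SU n) : Mat n) = exp (-A) := by
      calc ((u⁻¹ : SU n) : Mat n) = ((u⁻¹ : SU n) : Mat n) * ((u : Mat n) * exp (-A)) := by
            rw [hu, exp_mul_exp_neg, mul_one]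
        _ = exp (-A) := by rw [← mul_assoc, SU.inv_mul, one_mul]
    have := exp_conj_mem (hV A hA) (ih hB)
    rw [_root_.mul_inv_rev, Submonoid.coe_mul, Submonoid.coe_mul, h1, hu]
    simpa [mul_assoc] using this

theorem lie_eq_mul_sub (A B : Mat n) : ⁅A, B⁆ = A * B - B * A := rfl

theorem expGroup_conj_mem_self {l : LieSubalgebra ℝ (Mat n)} {g : SU n} (hg : g ∈ expGroup l)
    {B : Mat n} (hB : B ∈ l) : (g : Mat n) * B * ((g⁻¹ : SU n) : Mat n) ∈ l :=
  expGroup_conj_mem (V := l.toSubmodule) (fun _ hA _ hB => l.lie_mem hA hB) hg hB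

/-- The symmetric form `Re Tr(A B)`. -/
def retr (A B : Mat n) : ℝ := (A * B).trace.re

theorem retr_comm (A B : Mat n) : retr A B = retr B A := by rw [retr, trace_mul_comm]; rfl

theorem retr_add_left (A B C : Mat n) : retr (A + B) C = retr A C + retr B C := by
  simp [retr, add_mul]

theorem retr_smul_left (c : ℝ) (A B : Mat n) : retr (c • A) B = c * retr A B := by
  simp [retr]

theorem retr_add_right (A B C : Mat n) : retr A (B + C) = retr A B + retr A C := by
  simp [retr, mul_add]

theorem retr_smul_right (c : ℝ) (A B : Mat n) : retr A (c • B) = c * retr A B := by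
  simp [retr]

theorem retr_sub_right (A B C : Mat n) : retr A (B - C) = retr A B - retr A C := by
  simp [retr, mul_sub]

/-- `Re Tr(A B)` as a bilinear form. -/
def retrForm (n : ℕ) : LinearMap.BilinForm ℝ (Mat n) :=
  LinearMap.mk₂ ℝ retr retr_add_left retr_smul_left retr_add_right retr_smul_right

theorem retrForm_apply (A B : Mat n) : retrForm n A B = retr A B := rfl

/-- The trace form is negative definite on skew-Hermitian matrices; orthogonal complements and all
vanishing arguments rest on this. -/
theorem retr_self_of_skew {A : Mat n} (hA : A.conjTranspose = -A) : retr A A = -‖A‖ ^ 2 := by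
  rw [norm_sq_eq_trace, hA, retr]; simp

theorem retr_lie (A B C : Mat n) : retr ⁅A, B⁆ C = retr A ⁅B, C⁆ := by
  have h : (B * A * C).trace = (A * (C * B)).trace := by
    rw [mul_assoc, trace_mul_comm, mul_assoc]
  rw [retr, retr, lie_eq_mul_sub, lie_eq_mul_sub, sub_mul, mul_sub, trace_sub, trace_sub, h,
    mul_assoc]

theorem killing_eq (A B : Mat n) : killing A B = -2 * n * retr A B := by
  simp [killing, retr]

theorem retr_conj (u : SU n) (A B : Mat n) :
    retr ((u : Mat n) * A * ((u⁻¹ : SU n) : Mat n)) ((u : Mat n) * B * ((u⁻¹ : SU n) : Mat n)) =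
      retr A B := by
  have : (u : Mat n) * A * ((u⁻¹ : SU n) : Mat n) * ((u : Mat n) * B * ((u⁻¹ : SU n) : Mat n)) =
      (u : Mat n) * (A * B) * ((u⁻¹ : SU n) : Mat n) := by
    calc _ = (u : Mat n) * A * (((u⁻¹ : SU n) : Mat n) * (u : Mat n)) * B *
          ((u⁻¹ : SU n) : Mat n) := by simp only [mul_assoc]
      _ = _ := by rw [SU.inv_mul]; simp only [mul_assoc, mul_one]
  rw [retr, this, trace_mul_cycle, SU.inv_mul, one_mul]; rfl

end QuantumControl

/-! ### Groups generated by a closed group and brackets -/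

namespace QuantumControl

open scoped Matrix.Norms.Frobenius
open Matrix Filter Topology
open NormedSpace (exp)

variable {n : ℕ}

/-- A self-adjoint projection commuting with everything that commutes with `B`. -/
structure IsCentralProj (B P : Mat n) : Prop where
  idem : P * P = P
  conj : P.conjTranspose = P
  comm : ∀ X, Commute X B → Commute X P

/-- The determinant of the part of `g` on the range of the projection `P`. -/
def projDet (P g : Mat n) : ℂ := (g * P + (1 - P)).det

/-- In block form along the range of `P`, multiplication by `P` and completion by `1 - P` replaces
the complementary block by the identity; only `h` needs to commute with `P`. -/
theorem projDet_mul {P g h : Mat n} (hP : P * P = P) (hh : Commute h P) :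
    projDet P (g * h) = projDet P g * projDet P h := by
  rw [projDet, projDet, projDet, ← det_mul]
  congr 1
  have h1 : P * (h * P) = h * P := by rw [← mul_assoc, ← hh.eq, mul_assoc, hP]
  rw [add_mul, mul_add, mul_add, mul_assoc g P, h1, sub_mul, sub_mul, one_mul, one_mul, h1,
    mul_assoc g P, mul_sub, mul_sub, hP]
  simp [mul_assoc]

theorem exp_mul_of_mul_eq_zero {Y Q : Mat n} (h : Y * Q = 0) : exp Y * Q = Q := by
  have h1 : SemiconjBy Q 0 Y := by rw [SemiconjBy, h, mul_zero]
  let _ : NormedAlgebra ℚ (Mat n) := NormedAlgebra.restrictScalars ℚ ℝ (Mat n)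
  have h2 := h1.exp_right
  rw [SemiconjBy, NormedSpace.exp_zero, mul_one] at h2
  exact h2.symm

/-- The commuting splitting `X = X P + X (1 - P)` shows that the matrix in `projDet` is `exp (X P)`,
and `X P` is again skew-Hermitian. -/
theorem projDet_exp {P X : Mat n} (hP : P * P = P) (hP' : P.conjTranspose = P)
    (hX : X.conjTranspose = -X) (hXP : Commute X P) :
    projDet P (exp X) = Complex.exp (X * P).trace := by
  have hQ : (1 - P) * P = 0 := by rw [sub_mul, hP, one_mul, sub_self]
  have hQ' : P * (1 - P) = 0 := by rw [mul_sub, hP, mul_one, sub_self]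
  have hc : Commute (X * P) (X * (1 - P)) :=
    (((Commute.refl X).mul_right ((Commute.one_right X).sub_right hXP)).mul_left
      (hXP.symm.mul_right ((Commute.one_right P).sub_right (Commute.refl P))))
  have h1 : exp X = exp (X * P) * exp (X * (1 - P)) := by
    rw [← exp_add_mat hc, ← mul_add]; simp
  have h2 : exp (X * (1 - P)) * P = P := exp_mul_of_mul_eq_zero (by rw [mul_assoc, hQ, mul_zero])
  have h3 : exp (X * P) * (1 - P) = 1 - P :=
    exp_mul_of_mul_eq_zero (by rw [mul_assoc, hQ', mul_zero])
  have h4 : exp X * P + (1 - P) = exp (X * P) := by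
    rw [h1, mul_assoc, h2]
    conv_lhs => rw [← h3]
    rw [← mul_add]; simp
  rw [projDet, h4, det_exp_of_skew]
  rw [conjTranspose_mul, hX, hP', mul_neg, hXP.eq]

/-- The `P μ` are the eigenprojections, indexed by all real `μ` and zero off the spectrum. A matrix
commuting with `B` has, in the eigenbasis, no entries between different eigenvalues. -/
theorem exists_spectral_decomposition {B : Mat n} (hB : B.conjTranspose = -B) :
    ∃ (s : Finset ℝ) (P : ℝ → Mat n), (∀ μ, IsCentralProj B (P μ)) ∧
      B = ∑ μ ∈ s, (Complex.I * μ) • P μ := by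
  obtain ⟨U, lam, hU⟩ := exists_unitary_diagonal_of_skew hB
  have hUU := mem_unitaryGroup_iff.1 U.2
  have hUU' := mem_unitaryGroup_iff'.1 U.2
  set V : Mat n := (U : Mat n)
  let D : ℝ → Fin n → ℂ := fun μ a => if lam a = μ then 1 else 0
  refine ⟨Finset.univ.image lam, fun μ => V * diagonal (D μ) * star V, fun μ => ⟨?_, ?_, ?_⟩, ?_⟩
  · calc _ = V * diagonal (D μ) * (star V * V) * diagonal (D μ) * star V := by
          simp only [mul_assoc]
      _ = V * (diagonal (D μ) * diagonal (D μ)) * star V := by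
          rw [hUU']; simp only [mul_assoc, mul_one]
      _ = _ := by
          rw [diagonal_mul_diagonal]
          congr 3
          ext a
          simp only [D]; split_ifs <;> simp
  · rw [← star_eq_conjTranspose, star_mul, star_mul, star_star, star_eq_conjTranspose (diagonal _),
      diagonal_conjTranspose, ← mul_assoc]
    congr 3
    ext a
    simp only [D, Pi.star_apply]; split_ifs <;> simp
  · intro X hX
    set Y := star V * X * V with hY
    have hXY : X = V * Y * star V := by
      calc X = (V * star V) * X * (V * star V) := by rw [hUU]; simp
        _ = _ := by rw [hY]; simp only [mul_assoc]
    have hdiag : Y * diagonal (fun i => Complex.I * (lam i : ℂ)) =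
        diagonal (fun i => Complex.I * (lam i : ℂ)) * Y := by
      have h1 : star V * (X * B) * V = star V * (B * X) * V := by rw [hX.eq]
      rw [hU, hXY] at h1
      calc Y * diagonal (fun i => Complex.I * (lam i : ℂ))
          = (star V * V) * Y * (star V * V) * diagonal (fun i => Complex.I * (lam i : ℂ)) *
            (star V * V) := by rw [hUU']; simp
        _ = star V * (V * Y * star V * (V * diagonal (fun i => Complex.I * (lam i : ℂ)) *
            star V)) * V := by simp only [mul_assoc]
        _ = _ := h1
        _ = (star V * V) * diagonal (fun i => Complex.I * (lam i : ℂ)) * (star V * V) * Y *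
            (star V * V) := by simp only [mul_assoc]
        _ = _ := by rw [hUU']; simp
    have hD : Y * diagonal (D μ) = diagonal (D μ) * Y := by
      ext a b
      have h2 := congrFun (congrFun hdiag a) b
      rw [mul_diagonal, diagonal_mul] at h2 ⊢
      by_cases h0 : Y a b = 0
      · rw [h0]; simp
      · have h3 : (lam a : ℂ) = lam b := by
          have h4 : Y a b * Complex.I * ((lam b : ℂ) - lam a) = 0 := by linear_combination h2
          simpa [h0, sub_eq_zero, eq_comm] using h4
        simp only [D, Complex.ofReal_injective h3]
        ring
    rw [Commute, SemiconjBy, hXY]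
    calc V * Y * star V * (V * diagonal (D μ) * star V)
        = V * (Y * ((star V * V) * diagonal (D μ))) * star V := by simp only [mul_assoc]
      _ = V * (diagonal (D μ) * ((star V * V) * Y)) * star V := by
          rw [hUU', one_mul, one_mul, hD]
      _ = _ := by simp only [mul_assoc]
  · have : diagonal (fun i => Complex.I * (lam i : ℂ)) =
        ∑ μ ∈ Finset.univ.image lam, (Complex.I * μ) • diagonal (D μ) := by
      ext a b
      rw [Matrix.sum_apply]
      by_cases hab : a = b
      · subst hab
        simp [D]
      · simp [hab]
    rw [hU, this, Finset.mul_sum, Finset.sum_mul]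
    simp

/-- A skew-Hermitian matrix whose one-parameter group has the same partial determinants as
exponentials of matrices orthogonal to it vanishes. -/
theorem eq_zero_of_projDet {B : Mat n} (hB : B.conjTranspose = -B) {V : Set (Mat n)}
    (hV : ∀ A ∈ V, retr A B = 0)
    (h : ∀ t : ℝ, ∃ A ∈ V, ∀ P, IsCentralProj B P →
      Complex.exp (t * (B * P).trace) = Complex.exp (A * P).trace) : B = 0 := by
  obtain ⟨s, P, hP, hBP⟩ := exists_spectral_decomposition hB
  choose A hA hA' using h
  have h1 : ∀ (t : ℝ) (μ : s), ∃ N : ℤ, (t : ℂ) * (B * P μ).trace =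
      (A t * P μ).trace + N * (2 * Real.pi * Complex.I) := fun t μ =>
    Complex.exp_eq_exp_iff_exists_int.1 (hA' t (P μ) (hP μ))
  choose N hN using h1
  -- The integer vectors `N t` range over a countable set while `t` ranges over `ℝ`, so two
  -- different times share the same vector and the `2πi` ambiguities cancel in the difference.
  have hni : ¬ Function.Injective N := fun hi =>
    not_countable (α := ℝ) hi.countable
  obtain ⟨t, t', htt, hne⟩ := Function.not_injective_iff.1 hni
  have h2 : ∀ μ : s, ((t : ℂ) - t') * (B * P μ).trace = ((A t * P μ).trace - (A t' * P μ).trace) := by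
    intro μ
    have e1 := hN t μ
    have e2 := hN t' μ
    rw [htt] at e1
    linear_combination e1 - e2
  have hsum : ∀ X : Mat n, (X * B).trace = ∑ μ ∈ s, (Complex.I * μ) * (X * P μ).trace := by
    intro X
    conv_lhs => rw [hBP]
    simp [Finset.mul_sum, trace_sum]
  -- Weighting the identities by the eigenvalues reassembles `B`; the right side has real part zero
  -- by orthogonality.
  have h3 : ((t : ℂ) - t') * (B * B).trace = (A t * B).trace - (A t' * B).trace := by
    rw [hsum, hsum, hsum, Finset.mul_sum, ← Finset.sum_sub_distrib]
    refine Finset.sum_congr rfl fun μ hμ => ?_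
    have := h2 ⟨μ, hμ⟩
    linear_combination (Complex.I * μ) * this
  have h4 : (t - t') * retr B B = 0 := by
    have := congrArg Complex.re h3
    rw [← Complex.ofReal_sub, Complex.re_ofReal_mul, Complex.sub_re] at this
    have e1 := hV _ (hA t)
    have e2 := hV _ (hA t')
    unfold retr at *
    rw [this, e1, e2, sub_self]
  rcases mul_eq_zero.1 h4 with h5 | h5
  · exact absurd (sub_eq_zero.1 h5) hne
  · rw [retr_self_of_skew hB] at h5
    simpa using h5

section Derivatives

variable {E : Type*}

/-- The velocity at `0` of a curve in a closed subspace lies in the subspace. -/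
theorem mem_of_hasDerivAt_of_isClosed [NormedAddCommGroup E] [NormedSpace ℝ E]
    {V : Submodule ℝ E} (hV : IsClosed (V : Set E)) {γ : ℝ → E} {v : E}
    (h : HasDerivAt γ v 0) (hγ : ∀ t, γ t ∈ V) : v ∈ V := by
  rw [hasDerivAt_iff_tendsto_slope] at h
  refine hV.mem_of_tendsto h (Eventually.of_forall fun t => ?_)
  rw [slope_def_module]
  exact V.smul_mem _ (V.sub_mem (hγ _) (hγ _))

variable [NormedRing E] [NormedAlgebra ℝ E] [CompleteSpace E]

theorem hasDerivAt_exp_smul_zero (B : E) : HasDerivAt (fun t : ℝ => exp (t • B)) B 0 := by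
  simpa using hasDerivAt_exp_smul_const (𝕂 := ℝ) B 0

theorem hasDerivAt_exp_smul_conj (A B : E) :
    HasDerivAt (fun t : ℝ => exp (t • B) * A * exp (t • -B)) (B * A - A * B) 0 := by
  have := ((hasDerivAt_exp_smul_zero B).mul_const A).mul (hasDerivAt_exp_smul_zero (-B))
  exact this.congr_deriv (by simp [sub_eq_add_neg])

end Derivatives

/-- The velocity at `0` of a curve in a subspace lies in the subspace. -/
theorem mem_of_hasDerivAt {V : Submodule ℝ (Mat n)} {γ : ℝ → Mat n} {v : Mat n}
    (h : HasDerivAt γ v 0) (hγ : ∀ t, γ t ∈ V) : v ∈ V :=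
  mem_of_hasDerivAt_of_isClosed V.closed_of_finiteDimensional h hγ

theorem hasDerivAt_exp_smul (B : Mat n) : HasDerivAt (fun t : ℝ => exp (t • B)) B 0 :=
  hasDerivAt_exp_smul_zero B

/-- Subalgebras `𝔨 ≤ 𝔩` of `𝔰𝔲(n)` such that `exp 𝔨` generates a closed group and `𝔩` is spanned by
`𝔨` and brackets; then `exp 𝔩` generates a closed group as well. -/
structure ClosedPair (k l : LieSubalgebra ℝ (Mat n)) : Prop where
  le : k ≤ l
  le_su : l ≤ su n
  closed : IsClosed (expGroup k : Set (SU n))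
  le_sup : l.toSubmodule ≤ k.toSubmodule ⊔ Submodule.span ℝ {Z | ∃ X ∈ l, ∃ Y ∈ l, ⁅X, Y⁆ = Z}

/-- Unitarity gives `exp(t B*) = exp(-t B)`; the derivatives at `0` agree. -/
theorem conjTranspose_of_exp_smul {B : Mat n} (h : ∀ t : ℝ, exp (t • B) ∈ SU n) :
    B.conjTranspose = -B := by
  have h1 : ∀ t : ℝ, exp (t • B.conjTranspose) = exp (t • -B) := by
    intro t
    have h2 := mem_unitaryGroup_iff'.1 (h t).1
    rw [star_eq_conjTranspose, ← Matrix.exp_conjTranspose, conjTranspose_smul, star_trivial] at h2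
    calc exp (t • B.conjTranspose) = exp (t • B.conjTranspose) * (exp (t • B) * exp (-(t • B))) := by
          rw [exp_mul_exp_neg, mul_one]
      _ = _ := by rw [← mul_assoc, h2, one_mul, smul_neg]
  have h3 := hasDerivAt_exp_smul B.conjTranspose
  simp only [h1] at h3
  exact h3.unique (hasDerivAt_exp_smul (-B))

namespace ClosedPair

variable {k l : LieSubalgebra ℝ (Mat n)}

/-- On the range of a projection commuting with `𝔩`, brackets have trace zero. Thus each factor `exp
X` contributes the determinant of its `𝔨`-component only, and the exponents add up. -/
theorem exists_projDet (h : ClosedPair k l) {B : Mat n} (hB : ∀ A ∈ l, Commute A B) {g : SU n}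
    (hg : g ∈ expGroup l) :
    Commute (g : Mat n) B ∧ ∃ A ∈ k, ∀ P, IsCentralProj B P →
      projDet P g = Complex.exp (A * P).trace := by
  refine expGroup_induction (p := fun g => Commute (g : Mat n) B ∧
    ∃ A ∈ k, ∀ P, IsCentralProj B P → projDet P g = Complex.exp (A * P).trace) ?_ ?_ hg
  · refine ⟨Commute.one_left B, 0, k.zero_mem, fun P _ => ?_⟩
    simp [projDet]
  · rintro u v X hX hu ⟨hv, A, hA, hAP⟩
    have huB : Commute (u : Mat n) B := by
      let _ : NormedAlgebra ℚ (Mat n) := NormedAlgebra.restrictScalars ℚ ℝ (Mat n)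
      rw [hu]; exact (hB X hX).exp_left
    obtain ⟨A', hA', C, hC, hX'⟩ := Submodule.mem_sup.1 (h.le_sup hX)
    refine ⟨huB.mul_left hv, A' + A, k.add_mem hA' hA, fun P hP => ?_⟩
    rw [Submonoid.coe_mul, projDet_mul hP.idem (hP.comm _ hv), hAP P hP, hu,
      projDet_exp hP.idem hP.conj (h.le_su hX).1 (hP.comm _ (hB X hX)), ← Complex.exp_add, add_mul,
      trace_add]
    have hCP : (C * P).trace = 0 := by
      clear hX'
      induction hC using Submodule.span_induction with
      | mem Z hZ =>
        obtain ⟨X, hX, Y, hY, rfl⟩ := hZ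
        have e : (Y * X * P).trace = (X * Y * P).trace := by
          rw [mul_assoc, (hP.comm X (hB X hX)).eq, ← mul_assoc, trace_mul_comm, ← mul_assoc]
        rw [lie_eq_mul_sub, sub_mul, trace_sub, e, sub_self]
      | zero => simp
      | add x y _ _ hx hy => rw [add_mul, trace_add, hx, hy, add_zero]
      | smul c x _ hx => rw [smul_mul_assoc, trace_smul, hx, smul_zero]
    rw [← hX', add_mul, trace_add, hCP, add_zero]

/-- Infinitesimally, the closure of the group generated by `exp 𝔩` has no directions orthogonal to
`𝔩`. Such a direction would centralize `𝔩`, and partial determinants then exclude it. -/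
theorem eq_zero_of_exp_smul_mem (h : ClosedPair k l) {B : Mat n} (hlB : ∀ A ∈ l, retr A B = 0)
    (hB : ∀ t : ℝ, ∃ u ∈ (expGroup l).topologicalClosure, (u : Mat n) = exp (t • B)) : B = 0 := by
  have hBs : B.conjTranspose = -B := conjTranspose_of_exp_smul fun t => by
    obtain ⟨u, -, hu⟩ := hB t
    rw [← hu]; exact u.2
  have hconj : ∀ A ∈ l, ∀ u ∈ (expGroup l).topologicalClosure,
      (u : Mat n) * A * ((u⁻¹ : SU n) : Mat n) ∈ l := by
    intro A hA u hu
    have hc : IsClosed {u : SU n | (u : Mat n) * A * ((u⁻¹ : SU n) : Mat n) ∈ l.toSubmodule} :=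
      l.toSubmodule.closed_of_finiteDimensional.preimage (by fun_prop)
    exact closure_minimal (fun v hv => expGroup_conj_mem_self hv hA) hc hu
  have hcomm : ∀ A ∈ l, Commute A B := by
    intro A hA
    -- The closure still normalizes `𝔩`; differentiate the conjugation by `exp (t B)`.
    have hmem : ⁅B, A⁆ ∈ l.toSubmodule := by
      refine mem_of_hasDerivAt (hasDerivAt_exp_smul_conj A B) fun t => ?_
      obtain ⟨u, hu, hu'⟩ := hB t
      have h1 : ((u⁻¹ : SU n) : Mat n) = exp (t • -B) := by
        calc ((u⁻¹ : SU n) : Mat n) = ((u⁻¹ : SU n) : Mat n) * ((u : Mat n) * exp (t • -B)) := by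
              rw [hu', smul_neg, exp_mul_exp_neg, mul_one]
          _ = _ := by rw [← mul_assoc, SU.inv_mul, one_mul]
      have h2 := hconj A hA u hu
      rw [hu', h1] at h2
      exact h2
    -- Invariance rewrites this as the pairing of `B` with `[A, [B, A]] ∈ 𝔩`, which is zero;
    -- definiteness then gives `[B, A] = 0`.
    have h0 : retr ⁅B, A⁆ ⁅B, A⁆ = 0 := by
      rw [retr_lie, retr_comm]
      exact hlB _ (l.lie_mem hA hmem)
    rw [retr_self_of_skew (h.le_su hmem).1] at h0
    have h1 : ⁅B, A⁆ = 0 := by simpa using h0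
    exact (sub_eq_zero.1 h1).symm
  refine eq_zero_of_projDet hBs (V := k) (fun A hA => hlB A (h.le hA)) fun t => ?_
  -- This set is the projection of a closed subset of the compact space `SU(n) × SU(n)`; closedness
  -- of the group generated by `exp 𝔨` enters here.
  have hcl : IsClosed {g : SU n | ∃ u ∈ expGroup k, ∀ P, IsCentralProj B P →
      projDet P g = projDet P u} := by
    have hc : IsClosed {q : SU n × SU n | q.2 ∈ expGroup k ∧ ∀ P, IsCentralProj B P →
        projDet P q.1 = projDet P q.2} := by
      have h2 : {q : SU n × SU n | ∀ P, IsCentralProj B P → projDet P q.1 = projDet P q.2} =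
          ⋂ (P) (_ : IsCentralProj B P), {q : SU n × SU n | projDet P q.1 = projDet P q.2} := by
        ext; simp
      have h3 : IsClosed {q : SU n × SU n | ∀ P, IsCentralProj B P →
          projDet P q.1 = projDet P q.2} := by
        rw [h2]
        refine isClosed_iInter fun P => isClosed_iInter fun _ => isClosed_eq ?_ ?_ <;>
          unfold projDet <;> fun_prop
      exact (h.closed.preimage continuous_snd).inter h3
    convert (hc.isCompact.image continuous_fst).isClosed using 1
    ext g
    simp
  obtain ⟨g, hg, hg'⟩ := hB t
  obtain ⟨u, hu, hu'⟩ := closure_minimal (s := (expGroup l : Set (SU n))) (fun v hv => by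
    obtain ⟨-, A, hA, hAP⟩ := h.exists_projDet hcomm hv
    refine ⟨suExp A (h.le_su (h.le hA)), exp_mem_expGroup hA rfl, fun P hP => ?_⟩
    rw [hAP P hP, suExp, projDet_exp hP.idem hP.conj (h.le_su (h.le hA)).1
      (hP.comm _ (hcomm _ (h.le hA)))]) hcl hg
  obtain ⟨-, A, hA, hAP⟩ := h.exists_projDet hcomm (expGroup_mono h.le hu)
  refine ⟨A, hA, fun P hP => ?_⟩
  rw [← hAP P hP, ← hu' P hP, hg', projDet_exp hP.idem hP.conj
    (by rw [conjTranspose_smul, hBs, star_trivial, smul_neg])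
    (((hP.comm B (Commute.refl B)).smul_left t))]
  simp

end ClosedPair

end QuantumControl

/-! ### Local structure of the generated groups -/

namespace QuantumControl

open scoped Matrix.Norms.Frobenius
open Matrix Filter Topology
open NormedSpace (exp)

variable {n : ℕ}

section Factorization

variable {E : Type*} [NormedRing E] [NormedAlgebra ℝ E] [CompleteSpace E]

theorem eventually_eq_exp_mul_exp_mul_exp' [FiniteDimensional ℝ E] {z c w : Submodule ℝ E}
    (h : z ⊔ c ⊔ w = ⊤) {ε : ℝ} (hε : 0 < ε) :
    ∀ᶠ M in 𝓝 (1 : E), ∃ Z ∈ z, ∃ V ∈ c, ∃ W ∈ w, ‖Z‖ < ε ∧ ‖V‖ < ε ∧ ‖W‖ < ε ∧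
      M = exp Z * exp V * exp W := by
  let p1 : z × c × w →L[ℝ] E := z.subtypeL ∘L ContinuousLinearMap.fst ℝ z (c × w)
  let p2 : z × c × w →L[ℝ] E := c.subtypeL ∘L ContinuousLinearMap.fst ℝ c w ∘L
    ContinuousLinearMap.snd ℝ z (c × w)
  let p3 : z × c × w →L[ℝ] E := w.subtypeL ∘L ContinuousLinearMap.snd ℝ c w ∘L
    ContinuousLinearMap.snd ℝ z (c × w)
  have hexp : ∀ p : z × c × w →L[ℝ] E, HasStrictFDerivAt (fun x => exp (p x)) p 0 := by
    intro p
    have h1 : HasStrictFDerivAt (exp : E → E) (1 : E →L[ℝ] E) (p 0) := by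
      rw [map_zero]; exact hasStrictFDerivAt_exp_zero
    exact (h1.comp (0 : z × c × w) p.hasStrictFDerivAt).congr_fderiv (by ext <;> rfl)
  -- The derivative at the origin is `(Z, V, W) ↦ Z + V + W`, onto by hypothesis, so small triples
  -- cover a neighbourhood of `1`.
  have hF : HasStrictFDerivAt (fun x => exp (p1 x) * exp (p2 x) * exp (p3 x)) (p1 + p2 + p3) 0 := by
    refine (((hexp p1).mul' (hexp p2)).mul' (hexp p3)).congr_fderiv ?_
    ext x
    all_goals simp [add_comm, add_left_comm]
  have hsurj : (p1 + p2 + p3).range = ⊤ := by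
    rw [LinearMap.range_eq_top]
    intro X
    have hX : X ∈ z ⊔ c ⊔ w := h ▸ Submodule.mem_top
    obtain ⟨Y, hY, W, hW, rfl⟩ := Submodule.mem_sup.1 hX
    obtain ⟨Z, hZ, V, hV, rfl⟩ := Submodule.mem_sup.1 hY
    exact ⟨(⟨Z, hZ⟩, ⟨V, hV⟩, ⟨W, hW⟩), rfl⟩
  have hmap := hF.map_nhds_eq_of_surj hsurj
  have h0 : exp (p1 0) * exp (p2 0) * exp (p3 0) = 1 := by simp
  rw [h0] at hmap
  rw [← hmap]
  have hball : ∀ᶠ x : z × c × w in 𝓝 0, ‖x‖ < ε := by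
    filter_upwards [Metric.ball_mem_nhds (0 : z × c × w) hε] with x hx
    simpa using hx
  refine (eventually_map.2 ?_ : ∀ᶠ M in map _ (𝓝 (0 : z × c × w)), _)
  filter_upwards [hball] with x hx
  refine ⟨x.1, x.1.2, x.2.1, x.2.1.2, x.2.2, x.2.2.2, ?_, ?_, ?_, rfl⟩
  · exact (norm_fst_le x).trans_lt hx
  · exact ((norm_fst_le x.2).trans (norm_snd_le x)).trans_lt hx
  · exact ((norm_snd_le x.2).trans (norm_snd_le x)).trans_lt hx

end Factorization

theorem eventually_eq_exp_mul_exp_mul_exp {z c w : Submodule ℝ (Mat n)}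
    (h : z ⊔ c ⊔ w = ⊤) {ε : ℝ} (hε : 0 < ε) :
    ∀ᶠ M in 𝓝 (1 : Mat n), ∃ Z ∈ z, ∃ V ∈ c, ∃ W ∈ w, ‖Z‖ < ε ∧ ‖V‖ < ε ∧ ‖W‖ < ε ∧
      M = exp Z * exp V * exp W :=
  eventually_eq_exp_mul_exp_mul_exp' h hε

/-- The orthogonal complement of `𝔩 ≤ 𝔰𝔲(n)` among all matrices. -/
def orthComplement (l : LieSubalgebra ℝ (Mat n)) : Submodule ℝ (Mat n) :=
  (retrForm n).orthogonal l.toSubmodule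

/-- The form is degenerate in no direction of `𝔩`, being negative definite on `𝔰𝔲(n)`. -/
theorem isCompl_orthComplement {l : LieSubalgebra ℝ (Mat n)} (hl : l ≤ su n) :
    IsCompl l.toSubmodule (orthComplement l) := by
  refine LinearMap.BilinForm.isCompl_orthogonal_of_restrict_nondegenerate ?_ ?_
  · intro A B h
    rw [retrForm_apply] at h ⊢
    rw [retr_comm, h]
  · have hs : ∀ A : l.toSubmodule, retr (A : Mat n) A = 0 → A = 0 := by
      intro A hA
      rw [retr_self_of_skew (hl A.2).1] at hA
      ext1
      simpa using hA
    exact ⟨fun A hA => hs A (hA A), fun A hA => hs A (hA A)⟩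

theorem exp_nsmul_mat (k : ℕ) (A : Mat n) : exp (k • A) = exp A ^ k := Matrix.exp_nsmul k A

namespace ClosedPair

variable {k l : LieSubalgebra ℝ (Mat n)}

/-- Small matrices orthogonal to `𝔩` whose exponential lies in the closure of the group generated
by `exp 𝔩` vanish. -/
theorem exists_pos_forall_eq_zero (h : ClosedPair k l) : ∃ ε > 0, ∀ W ∈ orthComplement l,
    ‖W‖ < ε → ∀ u ∈ (expGroup l).topologicalClosure, (u : Mat n) = exp W → W = 0 := by
  by_contra! hcon
  have hpos : ∀ j : ℕ, (0 : ℝ) < 1 / (j + 1) := fun j => Nat.one_div_pos_of_nat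
  choose W hW hWε u hu huW hW0 using fun j : ℕ => hcon _ (hpos j)
  have hWlim : Tendsto (fun j => ‖W j‖) atTop (𝓝 0) :=
    squeeze_zero (fun _ => norm_nonneg _) (fun j => (hWε j).le) tendsto_one_div_add_atTop_nhds_zero_nat
  have hWpos : ∀ j, 0 < ‖W j‖ := fun j => norm_pos_iff.2 (hW0 j)
  -- Cartan's argument: the directions of a sequence of counterexamples tending to `0` accumulate at
  -- a unit vector `b`, whose one-parameter group lies in the closure.
  obtain ⟨b, hb, φ, hφ, hlim⟩ := (isCompact_sphere (0 : Mat n) 1).tendsto_subseq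
    (x := fun j => ‖W j‖⁻¹ • W j) (fun j => by
      simp [norm_smul, (hWpos j).ne'])
  have hbl : b ∈ orthComplement l := by
    refine (orthComplement l).closed_of_finiteDimensional.mem_of_tendsto hlim
      (Eventually.of_forall fun j => ?_)
    exact (orthComplement l).smul_mem _ (hW _)
  have hmem : ∀ t : ℝ, 0 ≤ t → ∃ v ∈ (expGroup l).topologicalClosure, (v : Mat n) = exp (t • b) := by
    intro t ht
    -- The power `⌊t / ‖W‖⌋` of `exp W` is the exponential of a vector with length within `‖W‖` of
    -- `t`.
    have hfl : Tendsto (fun j => (⌊t / ‖W (φ j)‖⌋₊ : ℝ) * ‖W (φ j)‖) atTop (𝓝 t) := by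
      have hl : Tendsto (fun j => t - ‖W (φ j)‖) atTop (𝓝 t) := by
        simpa using tendsto_const_nhds.sub (hWlim.comp hφ.tendsto_atTop)
      refine tendsto_of_tendsto_of_tendsto_of_le_of_le hl tendsto_const_nhds (fun j => ?_) fun j => ?_
      · have h1 := Nat.sub_one_lt_floor (t / ‖W (φ j)‖)
        have h2 := mul_lt_mul_of_pos_right h1 (hWpos (φ j))
        rw [sub_mul, div_mul_cancel₀ _ (hWpos (φ j)).ne', one_mul] at h2
        exact h2.le
      · have h1 := Nat.floor_le (div_nonneg ht (hWpos (φ j)).le)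
        exact (le_div_iff₀ (hWpos (φ j))).1 h1
    have hexp : Tendsto (fun j => ((u (φ j) ^ ⌊t / ‖W (φ j)‖⌋₊ : SU n) : Mat n)) atTop
        (𝓝 (exp (t • b))) := by
      have h1 := (continuous_exp_mat (n := n)).tendsto (t • b)
      refine (h1.comp (hfl.smul hlim)).congr fun j => ?_
      simp only [Function.comp_apply]
      rw [SubmonoidClass.coe_pow, huW, ← exp_nsmul_mat, smul_smul, mul_assoc,
        mul_inv_cancel₀ (hWpos _).ne', mul_one, Nat.cast_smul_eq_nsmul]
    have hcl : IsClosed (Subtype.val '' ((expGroup l).topologicalClosure : Set (SU n))) :=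
      ((expGroup l).isClosed_topologicalClosure.isCompact.image continuous_subtype_val).isClosed
    exact hcl.mem_of_tendsto hexp (Eventually.of_forall fun j =>
      ⟨_, (expGroup l).topologicalClosure.pow_mem (hu _) _, rfl⟩)
  have hb0 : b = 0 := by
    refine h.eq_zero_of_exp_smul_mem hbl fun t => ?_
    rcases le_total 0 t with ht | ht
    · exact hmem t ht
    · obtain ⟨v, hv, hv'⟩ := hmem (-t) (by linarith)
      refine ⟨v⁻¹, inv_mem hv, ?_⟩
      have h1 := SU.inv_mul v
      rw [hv'] at h1
      calc ((v⁻¹ : SU n) : Mat n)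
          = ((v⁻¹ : SU n) : Mat n) * (exp (-t • b) * exp (-(-t • b))) := by
            rw [exp_mul_exp_neg, mul_one]
        _ = _ := by rw [← mul_assoc, h1, one_mul, neg_smul, neg_neg]
  rw [hb0] at hb
  simp at hb

/-- Local structure of the group generated by `exp 𝔩` near the identity, in product coordinates. -/
theorem eventually_eq_exp_mul_exp (h : ClosedPair k l) {z c : Submodule ℝ (Mat n)}
    (hzc : z ⊔ c = l.toSubmodule) {ε : ℝ} (hε : 0 < ε) :
    ∀ᶠ g in 𝓝 (1 : SU n), g ∈ (expGroup l).topologicalClosure →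
      ∃ Z ∈ z, ∃ V ∈ c, ‖Z‖ < ε ∧ ‖V‖ < ε ∧ (g : Mat n) = exp Z * exp V := by
  obtain ⟨ε', hε', H⟩ := h.exists_pos_forall_eq_zero
  have h1 := eventually_eq_exp_mul_exp_mul_exp (z := z) (c := c) (w := orthComplement l)
    (by rw [hzc]; exact (isCompl_orthComplement h.le_su).sup_eq_top) (lt_min hε hε')
  have h2 : Tendsto (fun g : SU n => (g : Mat n)) (𝓝 1) (𝓝 (1 : Mat n)) :=
    continuous_subtype_val.tendsto (1 : SU n)
  filter_upwards [h2.eventually h1] with g hg hgl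
  obtain ⟨Z, hZ, V, hV, W, hW, hZε, hVε, hWε, hgZ⟩ := hg
  have hZl : Z ∈ l := hzc.le (Submodule.mem_sup_left hZ)
  have hVl : V ∈ l := hzc.le (Submodule.mem_sup_right hV)
  set a := suExp Z (h.le_su hZl)
  set b := suExp V (h.le_su hVl)
  have hab : ((a⁻¹ : SU n) : Mat n) * exp Z = 1 := SU.inv_mul a
  have hbb : ((b⁻¹ : SU n) : Mat n) * exp V = 1 := SU.inv_mul b
  have hle := (expGroup l).le_topologicalClosure
  -- Dividing `g` by the two factors in the group leaves `exp W` in the closure, with `W` small and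
  -- orthogonal to `𝔩`.
  have hW0 : W = 0 := by
    refine H W hW (hWε.trans_le (min_le_right _ _)) (b⁻¹ * (a⁻¹ * g)) ?_ ?_
    · exact mul_mem (inv_mem (hle (exp_mem_expGroup hVl rfl)))
        (mul_mem (inv_mem (hle (exp_mem_expGroup hZl rfl))) hgl)
    · rw [Submonoid.coe_mul, Submonoid.coe_mul, hgZ, mul_assoc (exp Z), ← mul_assoc _ (exp Z), hab,
        one_mul, ← mul_assoc, hbb, one_mul]
  refine ⟨Z, hZ, V, hV, hZε.trans_le (min_le_left _ _), hVε.trans_le (min_le_left _ _), ?_⟩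
  rw [hgZ, hW0, NormedSpace.exp_zero, mul_one]

end ClosedPair

end QuantumControl

/-! ### Conjugation orbits are submanifolds -/

namespace QuantumControl

open scoped Matrix.Norms.Frobenius
open Matrix Filter Topology
open NormedSpace (exp)

variable {n : ℕ}

/-! ### Charts from immersions that are open onto their image -/

section Parametrization

variable {E F : Type*} [NormedAddCommGroup E] [NormedSpace ℝ E] [NormedAddCommGroup F]
  [NormedSpace ℝ F] [FiniteDimensional ℝ F]

/-- A map with injective strict derivative is bounded below near the point. -/
theorem exists_norm_sub_le_of_hasStrictFDerivAt {φ : F → E} {φ' : F →L[ℝ] E} {x : F}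
    (h : HasStrictFDerivAt φ φ' x) (hinj : Function.Injective φ') :
    ∃ C > 0, ∃ r > 0, ∀ v ∈ Metric.ball x r, ∀ w ∈ Metric.ball x r,
      ‖v - w‖ ≤ C * ‖φ v - φ w‖ := by
  obtain ⟨K, hK, hanti⟩ := (φ' : F →ₗ[ℝ] E).exists_antilipschitzWith (LinearMap.ker_eq_bot.2 hinj)
  have hK' : (0 : ℝ) < K := hK
  have hb : ∀ v, ‖v‖ ≤ K * ‖φ' v‖ := fun v => by simpa using hanti.le_mul_dist v 0
  -- An error of at most half the lower bound `‖v‖ / K` of the derivative leaves the constant `2K`.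
  have h1 := h.isLittleO.bound (c := (2 * (K : ℝ))⁻¹) (by positivity)
  rw [nhds_prod_eq] at h1
  obtain ⟨s, hs, hs'⟩ := (mem_prod_same_iff).1 h1
  obtain ⟨r, hr, hrs⟩ := Metric.mem_nhds_iff.1 hs
  refine ⟨2 * K, by positivity, r, hr, fun v hv w hw => ?_⟩
  have h2 : ‖φ v - φ w - φ' (v - w)‖ ≤ (2 * (K : ℝ))⁻¹ * ‖v - w‖ :=
    hs' (Set.mk_mem_prod (hrs hv) (hrs hw))
  have h3 := hb (v - w)
  have h4 : ‖φ' (v - w)‖ ≤ ‖φ v - φ w‖ + (2 * (K : ℝ))⁻¹ * ‖v - w‖ := by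
    have := norm_sub_le (φ v - φ w) (φ v - φ w - φ' (v - w))
    rw [sub_sub_cancel] at this
    linarith
  have h5 := mul_le_mul_of_nonneg_left h4 hK'.le
  have h6 : (K : ℝ) * ((2 * (K : ℝ))⁻¹ * ‖v - w‖) = ‖v - w‖ / 2 := by field_simp
  rw [mul_add, h6] at h5
  linarith

/-- A smooth map into `S` that is immersive at `0` and open at `0` as a map into `S` gives a chart
of `S`. -/
theorem exists_chart_of_contDiff {S : Set E} {φ : F → E} (hφ : ContDiff ℝ ∞ φ)
    (hinj : Function.Injective (fderiv ℝ φ 0)) (hS : ∀ v, φ v ∈ S)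
    (hloc : ∀ ε > 0, ∀ᶠ y in 𝓝 (φ 0), y ∈ S → ∃ v, ‖v‖ < ε ∧ φ v = y) :
    ∃ (U : Set E) (V : Set F) (ψ : E → F), IsOpen U ∧ φ 0 ∈ U ∧ IsOpen V ∧
      (∀ v ∈ V, Function.Injective (fderiv ℝ φ v)) ∧
      Set.BijOn φ V (U ∩ S) ∧ (∀ v ∈ V, ψ (φ v) = v) ∧ ContinuousOn ψ (U ∩ S) := by
  have hst : HasStrictFDerivAt φ (fderiv ℝ φ 0) 0 :=
    hφ.contDiffAt.hasStrictFDerivAt (by simp)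
  obtain ⟨C, hC, r, hr, hCr⟩ := exists_norm_sub_le_of_hasStrictFDerivAt hst hinj
  have hopen : IsOpen {v | Function.Injective (fderiv ℝ φ v)} :=
    ContinuousLinearMap.isOpen_injective.preimage (hφ.continuous_fderiv (by simp))
  obtain ⟨r', hr', hrr'⟩ := Metric.isOpen_iff.1 hopen 0 hinj
  set ρ := min r r'
  have hρ : 0 < ρ := lt_min hr hr'
  obtain ⟨U, hUloc, hU, h0U⟩ := eventually_nhds_iff.1 (hloc ρ hρ)
  have hinjOn : Set.InjOn φ (Metric.ball 0 r) := by
    intro v hv w hw h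
    have := hCr v hv w hw
    rw [h, sub_self, norm_zero, mul_zero] at this
    exact sub_eq_zero.1 (norm_le_zero_iff.1 this)
  have hsub : Metric.ball (0 : F) ρ ⊆ Metric.ball 0 r := Metric.ball_subset_ball (min_le_left _ _)
  have hleft : ∀ v ∈ Metric.ball (0 : F) ρ, Function.invFunOn φ (Metric.ball 0 r) (φ v) = v :=
    fun v hv => hinjOn.leftInvOn_invFunOn (hsub hv)
  have himg : ∀ y ∈ U ∩ S, ∃ v ∈ Metric.ball (0 : F) ρ, φ v = y := by
    rintro y ⟨hyU, hyS⟩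
    obtain ⟨v, hv, hvy⟩ := hUloc y hyU hyS
    exact ⟨v, mem_ball_zero_iff.2 hv, hvy⟩
  refine ⟨U, Metric.ball 0 ρ ∩ φ ⁻¹' U, Function.invFunOn φ (Metric.ball 0 r), hU, h0U,
    Metric.isOpen_ball.inter (hU.preimage hφ.continuous), ?_, ⟨?_, ?_, ?_⟩, ?_, ?_⟩
  · exact fun v hv => hrr' (Metric.ball_subset_ball (min_le_right _ _) hv.1)
  · exact fun v hv => ⟨hv.2, hS v⟩
  · exact hinjOn.mono fun v hv => hsub hv.1
  · rintro y hy
    obtain ⟨v, hv, rfl⟩ := himg y hy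
    exact ⟨v, ⟨hv, hy.1⟩, rfl⟩
  · exact fun v hv => hleft v hv.1
  · refine LipschitzOnWith.continuousOn (K := ⟨C, hC.le⟩) (LipschitzOnWith.of_dist_le_mul ?_)
    intro y hy y' hy'
    obtain ⟨v, hv, rfl⟩ := himg y hy
    obtain ⟨w, hw, rfl⟩ := himg y' hy'
    rw [hleft v hv, hleft w hw, dist_eq_norm, dist_eq_norm]
    exact hCr v (hsub hv) w (hsub hw)

end Parametrization

/-! ### Derivative and smoothness of `V ↦ exp(-V) A exp V` -/

section ConjugationMap

variable {E F : Type*} [NormedRing E] [NormedAlgebra ℝ E] [CompleteSpace E] [NormedAddCommGroup F]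
  [NormedSpace ℝ F]

theorem hasStrictFDerivAt_exp_clm (L : F →L[ℝ] E) :
    HasStrictFDerivAt (fun x => exp (L x)) L 0 := by
  have h1 : HasStrictFDerivAt (exp : E → E) (1 : E →L[ℝ] E) (L 0) := by
    rw [map_zero]; exact hasStrictFDerivAt_exp_zero
  exact (h1.comp (0 : F) L.hasStrictFDerivAt).congr_fderiv (by ext; rfl)

theorem contDiff_exp_clm (L : F →L[ℝ] E) : ContDiff ℝ ∞ fun x => exp (L x) := by
  have h : ContDiff ℝ ∞ (exp : E → E) :=
    (AnalyticOnNhd.contDiff fun x _ => NormedSpace.exp_analytic x)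
  exact h.comp L.contDiff

theorem hasStrictFDerivAt_exp_neg_mul_exp (L : F →L[ℝ] E) (A : E) :
    HasStrictFDerivAt (fun x => exp (-(L x)) * A * exp (L x))
      (ContinuousLinearMap.mul ℝ E A ∘L L - (ContinuousLinearMap.mul ℝ E).flip A ∘L L) 0 := by
  have h1 := ((hasStrictFDerivAt_exp_clm (-L)).mul_const' A).mul' (hasStrictFDerivAt_exp_clm L)
  refine h1.congr_fderiv ?_
  ext x
  simp [sub_eq_add_neg]

theorem contDiff_exp_neg_mul_exp (L : F →L[ℝ] E) (A : E) :
    ContDiff ℝ ∞ fun x => exp (-(L x)) * A * exp (L x) :=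
  ((contDiff_exp_clm (-L)).mul contDiff_const).mul (contDiff_exp_clm L)

/-- The derivative at `0` is `v ↦ T (A (L v) - (L v) A)`. The map `T` has a left inverse and `L`
takes values transverse to the centralizer. -/
theorem injective_fderiv_exp_neg_mul_exp (L : F →L[ℝ] E) (A : E) (T T' : E →L[ℝ] E)
    (hT : ∀ X, T' (T X) = X) (hL : ∀ v, A * L v = L v * A → v = 0) :
    Function.Injective (fderiv ℝ (fun v => T (exp (-(L v)) * A * exp (L v))) 0) := by
  have h := (T.hasStrictFDerivAt.comp 0 (hasStrictFDerivAt_exp_neg_mul_exp L A)).hasFDerivAt.fderiv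
  have h' : fderiv ℝ (fun v => T (exp (-(L v)) * A * exp (L v))) 0 = _ := h
  rw [h', injective_iff_map_eq_zero]
  intro v hv
  refine hL v (sub_eq_zero.1 ?_)
  have := congrArg T' hv
  rw [map_zero] at this
  exact (hT _).symm.trans this

theorem exists_pos_norm_map_lt {E F : Type*} [SeminormedAddCommGroup E] [NormedSpace ℝ E]
    [SeminormedAddCommGroup F] [NormedSpace ℝ F] (f : F →L[ℝ] E) {ε : ℝ} (hε : 0 < ε) :
    ∃ δ > 0, ∀ w, ‖w‖ < δ → ‖f w‖ < ε := by
  obtain ⟨δ, hδ, hb⟩ := Metric.eventually_nhds_iff.1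
    ((f.continuous.tendsto 0).eventually (Metric.ball_mem_nhds (f 0) hε))
  exact ⟨δ, hδ, fun w hw => by simpa using hb (y := w) (by simpa using hw)⟩

end ConjugationMap

theorem exists_complement_of_le {z l : Submodule ℝ (Mat n)} (h : z ≤ l) :
    ∃ c : Submodule ℝ (Mat n), z ⊔ c = l ∧ Disjoint z c := by
  obtain ⟨w, hw⟩ := z.exists_isCompl
  refine ⟨w ⊓ l, ?_, hw.disjoint.mono_right inf_le_left⟩
  rw [← sup_inf_assoc_of_le w h, hw.sup_eq_top, top_inf_eq]

/-- The centralizer of a matrix in a Lie subalgebra. -/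
def centralizerIn (l : LieSubalgebra ℝ (Mat n)) (A : Mat n) : Submodule ℝ (Mat n) where
  carrier := {X | X ∈ l ∧ A * X = X * A}
  zero_mem' := ⟨l.zero_mem, by simp⟩
  add_mem' := by
    rintro X Y ⟨hX, hX'⟩ ⟨hY, hY'⟩
    exact ⟨l.add_mem hX hY, by rw [mul_add, add_mul, hX', hY']⟩
  smul_mem' := by
    rintro c X ⟨hX, hX'⟩
    exact ⟨l.smul_mem c hX, by rw [mul_smul_comm, smul_mul_assoc, hX']⟩

/-- The orbit `{k⁻¹ A k}` of `A` under the group generated by `exp 𝔩`. -/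
def conjOrbit (l : LieSubalgebra ℝ (Mat n)) (A : Mat n) : Set (Mat n) :=
  {X | ∃ k ∈ expGroup l, X = ((k⁻¹ : SU n) : Mat n) * A * (k : Mat n)}

theorem coe_inv_of_coe_eq_exp {u : SU n} {A : Mat n} (h : (u : Mat n) = exp A) :
    ((u⁻¹ : SU n) : Mat n) = exp (-A) := by
  have h1 := SU.inv_mul u
  rw [h] at h1
  calc ((u⁻¹ : SU n) : Mat n) = ((u⁻¹ : SU n) : Mat n) * (exp A * exp (-A)) := by
        rw [exp_mul_exp_neg, mul_one]
    _ = exp (-A) := by rw [← mul_assoc, h1, one_mul]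

theorem exp_conj_mem_conjOrbit {l : LieSubalgebra ℝ (Mat n)} (hl : l ≤ su n) {A V : Mat n}
    (hV : V ∈ l) : exp (-V) * A * exp V ∈ conjOrbit l A :=
  ⟨suExp V (hl hV), exp_mem_expGroup hV rfl, by rw [coe_inv_of_coe_eq_exp (A := V) rfl]; rfl⟩

namespace ClosedPair

variable {l : LieSubalgebra ℝ (Mat n)}

/-- The orbit map is open at the identity, and the stabilizer directions can be dropped. -/
theorem eventually_conjOrbit_eq (h : ClosedPair l l) {A : Mat n} {c : Submodule ℝ (Mat n)}
    (hc : centralizerIn l A ⊔ c = l.toSubmodule) {ε : ℝ} (hε : 0 < ε) :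
    ∀ᶠ y in 𝓝 A, y ∈ conjOrbit l A → ∃ V ∈ c, ‖V‖ < ε ∧ exp (-V) * A * exp V = y := by
  obtain ⟨N, hN, hNo, h1N⟩ := eventually_nhds_iff.1 (h.eventually_eq_exp_mul_exp hc hε)
  let f : SU n → Mat n := fun k => ((k⁻¹ : SU n) : Mat n) * A * (k : Mat n)
  have hf : Continuous f := by fun_prop
  let St : Set (SU n) := {s | s ∈ expGroup l ∧ f s = A}
  -- `W` is an open neighbourhood of the stabilizer. The rest of the group is compact and its image
  -- misses `A`, so orbit points near `A` come from `W` only.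
  let W : Set (SU n) := ⋃ s ∈ St, (fun k => s⁻¹ * k) ⁻¹' N
  have hW : IsOpen W := isOpen_biUnion fun s _ => hNo.preimage (continuous_const_mul _)
  have hcomp : IsClosed (f '' ((expGroup l : Set (SU n)) \ W)) :=
    ((h.closed.sdiff hW).isCompact.image hf).isClosed
  have hA : A ∉ f '' ((expGroup l : Set (SU n)) \ W) := by
    rintro ⟨k, ⟨hk, hkW⟩, hkA⟩
    exact hkW (Set.mem_biUnion (x := k) ⟨hk, hkA⟩ (by simpa using h1N))
  filter_upwards [hcomp.isOpen_compl.mem_nhds hA] with y hy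
  rintro ⟨k, hk, rfl⟩
  have hkW : k ∈ W := by
    by_contra hkW
    exact hy ⟨k, ⟨hk, hkW⟩, rfl⟩
  obtain ⟨s, ⟨hs, hsA⟩, hsk⟩ := Set.mem_iUnion₂.1 hkW
  obtain ⟨Z, hZ, V, hV, -, hVε, hZV⟩ := hN (s⁻¹ * k) hsk
    ((expGroup l).le_topologicalClosure (mul_mem (inv_mem hs) hk))
  refine ⟨V, hV, hVε, ?_⟩
  -- With `k = s · exp Z · exp V`, where `s` fixes `A` and `Z` commutes with `A`, only the last
  -- factor moves `A`.
  have hk' : (k : Mat n) = (s : Mat n) * (exp Z * exp V) := by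
    rw [← hZV, ← Submonoid.coe_mul, mul_inv_cancel_left]
  have hki : ((k⁻¹ : SU n) : Mat n) = exp (-V) * exp (-Z) * ((s⁻¹ : SU n) : Mat n) := by
    have h1 : exp (-V) * exp (-Z) * ((s⁻¹ : SU n) : Mat n) * (k : Mat n) = 1 := by
      rw [hk']
      calc _ = exp (-V) * (exp (-Z) * (((s⁻¹ : SU n) : Mat n) * (s : Mat n)) * exp Z) * exp V := by
            simp only [mul_assoc]
        _ = 1 := by rw [SU.inv_mul, mul_one, exp_neg_mul_exp, mul_one, exp_neg_mul_exp]
    calc ((k⁻¹ : SU n) : Mat n)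
        = exp (-V) * exp (-Z) * ((s⁻¹ : SU n) : Mat n) * (k : Mat n) * ((k⁻¹ : SU n) : Mat n) := by
          rw [h1, one_mul]
      _ = _ := by rw [mul_assoc _ (k : Mat n), SU.mul_inv, mul_one]
  have hZA : exp (-Z) * A * exp Z = A := by
    let _ : NormedAlgebra ℚ (Mat n) := NormedAlgebra.restrictScalars ℚ ℝ (Mat n)
    have hcm : Commute A Z := hZ.2
    have h2 : Commute A (exp Z) := hcm.exp_right
    rw [mul_assoc, h2.eq, ← mul_assoc, exp_neg_mul_exp, one_mul]
  calc exp (-V) * A * exp V = exp (-V) * (exp (-Z) * A * exp Z) * exp V := by rw [hZA]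
    _ = exp (-V) * (exp (-Z) * f s * exp Z) * exp V := by rw [hsA]
    _ = _ := by rw [hk', hki]; simp only [f, mul_assoc]

/-- The orbit of `A` is a submanifold of dimension `dim 𝔩 - dim (centralizer of A in 𝔩)`. -/
theorem hasManifoldDim_conjOrbit (h : ClosedPair l l) (A : Mat n) :
    HasManifoldDim (conjOrbit l A)
      (Module.finrank ℝ l - Module.finrank ℝ (centralizerIn l A)) := by
  have hzl : centralizerIn l A ≤ l.toSubmodule := fun X hX => hX.1
  obtain ⟨c, hc, hdis⟩ := exists_complement_of_le hzl
  -- The truncated subtraction is a true one, as the centralizer lies in `𝔩`.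
  have hdim : Module.finrank ℝ l - Module.finrank ℝ (centralizerIn l A) = Module.finrank ℝ c := by
    have h1 := Submodule.finrank_sup_add_finrank_inf_eq (centralizerIn l A) c
    rw [hdis.eq_bot, finrank_bot, hc] at h1
    change Module.finrank ℝ l.toSubmodule - _ = _
    omega
  rw [hdim]
  let e : EuclideanSpace ℝ (Fin (Module.finrank ℝ c)) ≃L[ℝ] c :=
    ContinuousLinearEquiv.ofFinrankEq (by simp)
  rintro x ⟨g, hg, rfl⟩
  set x := ((g⁻¹ : SU n) : Mat n) * A * (g : Mat n) with hx
  let L : EuclideanSpace ℝ (Fin (Module.finrank ℝ c)) →L[ℝ] Mat n := c.subtypeL ∘L e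
  -- Conjugation by `g` preserves the orbit and carries the chart at `A` to the point `x`.
  let T : Mat n →L[ℝ] Mat n :=
    (ContinuousLinearMap.mul ℝ (Mat n)).flip (g : Mat n) ∘L
      ContinuousLinearMap.mul ℝ (Mat n) ((g⁻¹ : SU n) : Mat n)
  let T' : Mat n →L[ℝ] Mat n :=
    (ContinuousLinearMap.mul ℝ (Mat n)).flip ((g⁻¹ : SU n) : Mat n) ∘L
      ContinuousLinearMap.mul ℝ (Mat n) (g : Mat n)
  have hTapp : ∀ X, T X = ((g⁻¹ : SU n) : Mat n) * X * (g : Mat n) := fun X => rfl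
  have hT'app : ∀ X, T' X = (g : Mat n) * X * ((g⁻¹ : SU n) : Mat n) := fun X => rfl
  have hT'T : ∀ X, T' (T X) = X := fun X => by
    rw [hTapp, hT'app]
    calc _ = ((g : Mat n) * ((g⁻¹ : SU n) : Mat n)) * X * ((g : Mat n) * ((g⁻¹ : SU n) : Mat n)) := by
          simp only [mul_assoc]
      _ = X := by rw [SU.mul_inv, one_mul, mul_one]
  have hTT' : ∀ X, T (T' X) = X := fun X => by
    rw [hTapp, hT'app]
    calc _ = (((g⁻¹ : SU n) : Mat n) * (g : Mat n)) * X * (((g⁻¹ : SU n) : Mat n) * (g : Mat n)) := by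
          simp only [mul_assoc]
      _ = X := by rw [SU.inv_mul, one_mul, mul_one]
  let φ₀ := fun v => exp (-(L v)) * A * exp (L v)
  have hφ₀ : HasStrictFDerivAt φ₀ _ 0 := hasStrictFDerivAt_exp_neg_mul_exp L A
  have hφ : ContDiff ℝ ∞ (fun v => T (φ₀ v)) := T.contDiff.comp (contDiff_exp_neg_mul_exp L A)
  have hφ0 : T (φ₀ 0) = x := by simp [φ₀, hTapp, x]
  have hTmem : ∀ X ∈ conjOrbit l A, T X ∈ conjOrbit l A := by
    rintro _ ⟨k, hk, rfl⟩
    refine ⟨k * g, mul_mem hk hg, ?_⟩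
    rw [_root_.mul_inv_rev, hTapp]
    simp only [Submonoid.coe_mul, mul_assoc]
  have hT'mem : ∀ X ∈ conjOrbit l A, T' X ∈ conjOrbit l A := by
    rintro _ ⟨k, hk, rfl⟩
    refine ⟨k * g⁻¹, mul_mem hk (inv_mem hg), ?_⟩
    rw [_root_.mul_inv_rev, hT'app, inv_inv]
    simp only [Submonoid.coe_mul, mul_assoc]
  have hinj : Function.Injective (fderiv ℝ (fun v => T (φ₀ v)) 0) := by
    refine injective_fderiv_exp_neg_mul_exp L A T T' hT'T fun v hv => ?_
    have h2 : (e v : Mat n) ∈ centralizerIn l A :=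
      ⟨hc.le (Submodule.mem_sup_right (e v).2), hv⟩
    have h3 : (e v : Mat n) = 0 := Submodule.disjoint_def.1 hdis _ h2 (e v).2
    have h4 : e v = 0 := Subtype.ext h3
    exact e.map_eq_zero_iff.1 h4
  have hmem : ∀ v, T (φ₀ v) ∈ conjOrbit l A := by
    intro v
    exact hTmem _ (exp_conj_mem_conjOrbit h.le_su (hc.le (Submodule.mem_sup_right (e v).2)))
  have hloc : ∀ ε > 0, ∀ᶠ y in 𝓝 (T (φ₀ 0)), y ∈ conjOrbit l A → ∃ v, ‖v‖ < ε ∧ T (φ₀ v) = y := by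
    intro ε hε
    obtain ⟨δ, hδ, hδε⟩ := exists_pos_norm_map_lt e.symm.toContinuousLinearMap hε
    have h1 := h.eventually_conjOrbit_eq hc hδ
    have h2 : Tendsto (fun y => T' y) (𝓝 (T (φ₀ 0))) (𝓝 A) := by
      have := T'.continuous.tendsto (T (φ₀ 0))
      rw [hT'T] at this
      simpa [φ₀] using this
    filter_upwards [h2.eventually h1] with y hy hyS
    obtain ⟨w, hw, hwδ, hwy⟩ := hy (hT'mem y hyS)
    refine ⟨e.symm ⟨w, hw⟩, hδε _ hwδ, ?_⟩
    have h3 : φ₀ (e.symm ⟨w, hw⟩) = T' y := by simp [φ₀, L, hwy]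
    rw [h3, hTT']
  obtain ⟨U, V, ψ, hU, h0U, hV, hVinj, hbij, hψ, hψc⟩ :=
    exists_chart_of_contDiff (S := conjOrbit l A) hφ hinj hmem hloc
  rw [hφ0] at h0U
  exact ⟨U, V, fun v => T (φ₀ v), ψ, hU, h0U, hV, hφ.contDiffOn, hVinj, hbij, hψ, hψc⟩

end ClosedPair

end QuantumControl

/-! ### The orbit of the drift: dimension and the inequality -/

namespace QuantumControl

open scoped Matrix.Norms.Frobenius
open Matrix Filter Topology
open NormedSpace (exp)

variable {n m : ℕ}

section Tangent

variable {E F : Type*} [NormedAddCommGroup E] [NormedSpace ℝ E] [NormedAddCommGroup F]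
  [NormedSpace ℝ F] [FiniteDimensional ℝ F]

/-- A curve in the image of an immersion that is open onto a set containing the curve has its
velocity in the tangent space. -/
theorem mem_range_of_hasDerivAt {φ : F → E} {φ' : F →L[ℝ] E} (h : HasStrictFDerivAt φ φ' 0)
    (hinj : Function.Injective φ') {γ : ℝ → E} {X : E} (hγ : HasDerivAt γ X 0) (h0 : γ 0 = φ 0)
    (hloc : ∀ ε > 0, ∀ᶠ t in 𝓝 (0 : ℝ), ∃ v, ‖v‖ < ε ∧ φ v = γ t) :
    X ∈ (φ' : F →ₗ[ℝ] E).range := by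
  obtain ⟨C, hC, r, hr, hCr⟩ := exists_norm_sub_le_of_hasStrictFDerivAt h hinj
  -- The value `0` is a default for parameters without a preimage; it is irrelevant near `0`.
  have hex : ∀ t : ℝ, ∃ v : F, (∃ v, ‖v‖ < r ∧ φ v = γ t) → ‖v‖ < r ∧ φ v = γ t := by
    intro t
    by_cases ht : ∃ v, ‖v‖ < r ∧ φ v = γ t
    · obtain ⟨v, hv⟩ := ht
      exact ⟨v, fun _ => hv⟩
    · exact ⟨0, fun h => absurd h ht⟩
  choose v hv using hex
  have hv' : ∀ᶠ t in 𝓝 (0 : ℝ), ‖v t‖ < r ∧ φ (v t) = γ t := (hloc r hr).mono fun t ht => hv t ht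
  have hbound : ∀ᶠ t in 𝓝 (0 : ℝ), ‖v t‖ ≤ C * ‖γ t - γ 0‖ := by
    filter_upwards [hv'] with t ht
    have := hCr (v t) (by simpa using ht.1) 0 (by simpa using hr)
    rwa [sub_zero, ht.2, ← h0] at this
  -- The lifted curve is `O(t)`, so the derivative of `φ` applied to `v t / t` tends to the velocity
  -- `X`; the range is closed.
  have hO : v =O[𝓝 0] fun t : ℝ => t := by
    have h1 : v =O[𝓝 0] fun t => γ t - γ 0 := Asymptotics.IsBigO.of_bound C hbound
    have h2 : (fun t => γ t - γ 0) =O[𝓝 0] fun t : ℝ => t := by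
      simpa using hγ.differentiableAt.isBigO_sub
    exact h1.trans h2
  have hlim : Tendsto v (𝓝 0) (𝓝 0) := hO.trans_tendsto tendsto_id
  have ho : (fun t => φ (v t) - φ 0 - φ' (v t)) =o[𝓝 0] fun t : ℝ => t := by
    have h1 := (h.hasFDerivAt.isLittleO).comp_tendsto hlim
    simp only [Function.comp_def, sub_zero] at h1
    exact h1.trans_isBigO hO
  have ho2 : (fun t => φ' (v t) - t • X) =o[𝓝 0] fun t : ℝ => t := by
    have h1 := hasDerivAt_iff_isLittleO.1 hγ
    simp only [sub_zero] at h1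
    refine (h1.sub ho).congr' ?_ EventuallyEq.rfl
    filter_upwards [hv'] with t ht
    rw [ht.2, h0]
    abel
  have hten : Tendsto (fun t : ℝ => t⁻¹ • φ' (v t)) (𝓝[≠] 0) (𝓝 X) := by
    have h1 := (ho2.mono (nhdsWithin_le_nhds (s := {0}ᶜ))).tendsto_inv_smul_nhds_zero
    have h2 := h1.add_const X
    rw [zero_add] at h2
    refine h2.congr' ?_
    filter_upwards [self_mem_nhdsWithin] with t ht
    rw [smul_sub, smul_smul, inv_mul_cancel₀ ht, one_smul, sub_add_cancel]
  exact ((φ' : F →ₗ[ℝ] E).range).closed_of_finiteDimensional.mem_of_tendsto hten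
    (Eventually.of_forall fun t => Submodule.smul_mem _ _ ⟨v t, rfl⟩)

end Tangent

namespace ControlSystem

variable (S : ControlSystem n m)

theorem I_smul_mem_su {H : Mat n} (h : H.IsHermitian) (h0 : H.trace = 0) :
    Complex.I • H ∈ su n :=
  ⟨by rw [conjTranspose_smul, h.eq]; simp, by rw [trace_smul, h0, smul_zero]⟩

theorem iDrift_mem_gAlg : S.iDrift ∈ S.gAlg :=
  LieSubalgebra.subset_lieSpan (Set.mem_insert _ _)

theorem kAlg_le_gAlg : S.kAlg ≤ S.gAlg :=
  LieSubalgebra.lieSpan_mono (Set.subset_insert _ _)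

theorem gAlg_le_su : S.gAlg ≤ su n := by
  refine LieSubalgebra.lieSpan_le.2 (Set.insert_subset ?_ ?_)
  · exact I_smul_mem_su S.drift_isHermitian S.drift_trace
  · rintro _ ⟨j, rfl⟩
    exact I_smul_mem_su (S.control_isHermitian j) (S.control_trace j)

theorem kAlg_le_su : S.kAlg ≤ su n := S.kAlg_le_gAlg.trans S.gAlg_le_su

theorem closedPair_kAlg (hK : IsClosed (S.K : Set (SU n))) : ClosedPair S.kAlg S.kAlg :=
  ⟨le_rfl, S.kAlg_le_su, hK, le_sup_left⟩

theorem driftCentralizer_eq : S.driftCentralizer = centralizerIn S.kAlg S.iDrift := by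
  ext A
  change (A ∈ S.kAlg ∧ ⁅S.drift, A⁆ = 0) ↔
    (A ∈ S.kAlg ∧ (Complex.I • S.drift) * A = A * (Complex.I • S.drift))
  refine and_congr_right fun _ => ?_
  rw [lie_eq_mul_sub, sub_eq_zero, smul_mul_assoc, mul_smul_comm]
  exact (smul_right_injective _ Complex.I_ne_zero).eq_iff.symm

theorem mem_pSpace_iff {X : Mat n} :
    X ∈ S.pSpace ↔ X ∈ S.gAlg ∧ ∀ A ∈ S.kAlg, retr A X = 0 := by
  change (X ∈ S.gAlg ∧ ∀ A ∈ S.kAlg, killing A X = 0) ↔ _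
  refine and_congr_right fun _ => forall₂_congr fun A _ => ?_
  rw [killing_eq]
  -- The factor `-2n` can be dropped unless `n = 0`, where all matrices vanish.
  rcases Nat.eq_zero_or_pos n with rfl | hn
  · simp [retr, trace]
  · have : (n : ℝ) ≠ 0 := by positivity
    simp [this]

theorem skew_of_mem_gAlg {X : Mat n} (hX : X ∈ S.gAlg) : X.conjTranspose = -X :=
  (S.gAlg_le_su hX).1

theorem pSpace_le : S.pSpace ≤ S.gAlg.toSubmodule := fun _ hX => hX.1

/-- Subtracting from `X ∈ 𝔤` its `𝔨`-component in the splitting of all matrices leaves an element of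
`𝔤` orthogonal to `𝔨`. -/
theorem kAlg_sup_pSpace : S.kAlg.toSubmodule ⊔ S.pSpace = S.gAlg.toSubmodule := by
  refine le_antisymm (sup_le S.kAlg_le_gAlg S.pSpace_le) fun X hX => ?_
  have h := (isCompl_orthComplement S.kAlg_le_su).sup_eq_top
  obtain ⟨A, hA, B, hB, rfl⟩ := Submodule.mem_sup.1 (h ▸ Submodule.mem_top : X ∈ _)
  refine Submodule.add_mem_sup hA (S.mem_pSpace_iff.2 ⟨?_, fun C hC => hB C hC⟩)
  have := S.gAlg.sub_mem hX (S.kAlg_le_gAlg hA)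
  rwa [add_sub_cancel_left] at this

/-- Invariance of the form moves the bracket with `A` onto the other argument, which stays in `𝔨`.
-/
theorem lie_mem_pSpace {X A : Mat n} (hX : X ∈ S.pSpace) (hA : A ∈ S.kAlg) :
    ⁅X, A⁆ ∈ S.pSpace := by
  rw [mem_pSpace_iff] at hX ⊢
  refine ⟨S.gAlg.lie_mem hX.1 (S.kAlg_le_gAlg hA), fun C hC => ?_⟩
  rw [retr_comm, retr_lie, retr_comm]
  exact hX.2 _ (S.kAlg.lie_mem hA hC)

theorem conj_mem_pSpace {k : SU n} (hk : k ∈ S.K) {X : Mat n} (hX : X ∈ S.pSpace) :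
    (k : Mat n) * X * ((k⁻¹ : SU n) : Mat n) ∈ S.pSpace := by
  refine expGroup_conj_mem (l := S.kAlg) (fun A hA B hB => ?_) hk hX
  have := S.pSpace.neg_mem (S.lie_mem_pSpace hB hA)
  rwa [← lie_skew, neg_neg] at this

theorem conj_mem_pSpace' {k : SU n} (hk : k ∈ S.K) {X : Mat n} (hX : X ∈ S.pSpace) :
    ((k⁻¹ : SU n) : Mat n) * X * (k : Mat n) ∈ S.pSpace := by
  have := S.conj_mem_pSpace (S.K.inv_mem hk) hX
  rwa [inv_inv] at this

theorem killingNorm_eq {X : Mat n} (hX : X.conjTranspose = -X) :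
    killingNorm X = Real.sqrt (2 * n) * ‖X‖ := by
  rw [killingNorm, killing_eq, retr_self_of_skew hX, neg_mul, neg_mul_neg,
    Real.sqrt_mul (by positivity), Real.sqrt_sq (norm_nonneg _)]

theorem mem_driftSphere_iff {X : Mat n} :
    X ∈ S.driftSphere ↔ X ∈ S.pSpace ∧ ‖X‖ = ‖S.iDrift‖ := by
  change (X ∈ S.pSpace ∧ killingNorm X = killingNorm S.iDrift) ↔ _
  refine and_congr_right fun hX => ?_
  rw [killingNorm_eq (S.skew_of_mem_gAlg hX.1), killingNorm_eq (S.skew_of_mem_gAlg S.iDrift_mem_gAlg)]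
  rcases Nat.eq_zero_or_pos n with rfl | hn
  · simp [Subsingleton.elim X S.iDrift]
  · have : Real.sqrt (2 * n) ≠ 0 := by positivity
    exact mul_right_inj' this

theorem hasManifoldDim_adjointOrbit (hK : IsClosed (S.K : Set (SU n))) :
    HasManifoldDim (S.adjointOrbit S.iDrift)
      (Module.finrank ℝ S.kAlg - Module.finrank ℝ S.driftCentralizer) := by
  rw [driftCentralizer_eq]
  exact (S.closedPair_kAlg hK).hasManifoldDim_conjOrbit S.iDrift

/-- The tangent space `[iH_d, 𝔨]` of the orbit at `iH_d`. -/
def orbitTangent : Submodule ℝ (Mat n) :=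
  S.kAlg.toSubmodule.map
    (LinearMap.mulLeft ℝ S.iDrift - LinearMap.mulRight ℝ S.iDrift)

theorem finrank_orbitTangent :
    Module.finrank ℝ S.orbitTangent + Module.finrank ℝ S.driftCentralizer =
      Module.finrank ℝ S.kAlg := by
  set f := (LinearMap.mulLeft ℝ S.iDrift - LinearMap.mulRight ℝ S.iDrift) with hf
  have h := (f.domRestrict S.kAlg.toSubmodule).finrank_range_add_finrank_ker
  have h1 : (f.domRestrict S.kAlg.toSubmodule).range = S.orbitTangent := by
    rw [LinearMap.range_domRestrict]; rfl
  have h2 : (f.domRestrict S.kAlg.toSubmodule).ker.map S.kAlg.toSubmodule.subtype =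
      S.driftCentralizer := by
    rw [driftCentralizer_eq]
    ext A
    simp only [Submodule.mem_map, LinearMap.mem_ker, LinearMap.domRestrict_apply]
    constructor
    · rintro ⟨B, hB, rfl⟩
      exact ⟨B.2, sub_eq_zero.1 hB⟩
    · rintro ⟨hA, hA'⟩
      exact ⟨⟨A, hA⟩, sub_eq_zero.2 hA', rfl⟩
  rw [← h1, ← h2]
  have h3 := Submodule.finrank_map_subtype_eq S.kAlg.toSubmodule
    (f.domRestrict S.kAlg.toSubmodule).ker
  refine (congrArg _ h3).trans ?_
  exact h

/-- The orthogonal complement of `iH_d` in `𝔭`. -/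
def driftPerp : Submodule ℝ (Mat n) := S.pSpace ⊓ (retrForm n S.iDrift).ker

theorem mem_driftPerp {X : Mat n} :
    X ∈ S.driftPerp ↔ X ∈ S.pSpace ∧ retr S.iDrift X = 0 := Iff.rfl

theorem iDrift_ne_zero (h : S.drift ≠ 0) : S.iDrift ≠ 0 :=
  smul_ne_zero Complex.I_ne_zero h

theorem retr_iDrift_self : retr S.iDrift S.iDrift = -‖S.iDrift‖ ^ 2 :=
  retr_self_of_skew (S.skew_of_mem_gAlg S.iDrift_mem_gAlg)

theorem retr_iDrift_ne_zero (h : S.drift ≠ 0) : retr S.iDrift S.iDrift ≠ 0 := by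
  rw [retr_iDrift_self]
  simpa using S.iDrift_ne_zero h

variable {S}

/-- Pairing with `iH_d` is a functional on `𝔭` that is nonzero at `iH_d` itself. -/
theorem finrank_driftPerp (hp : S.iDrift ∈ S.pSpace) (h : S.drift ≠ 0) :
    Module.finrank ℝ S.driftPerp + 1 = Module.finrank ℝ S.pSpace := by
  set f : Module.Dual ℝ S.pSpace := (retrForm n S.iDrift).domRestrict S.pSpace
  have hf : f ≠ 0 := fun h0 =>
    S.retr_iDrift_ne_zero h (congrArg (fun g : Module.Dual ℝ S.pSpace => g ⟨_, hp⟩) h0)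
  rw [← Module.Dual.finrank_ker_add_one_of_ne_zero hf]
  have h2 : f.ker.map S.pSpace.subtype = S.driftPerp := by
    ext X
    simp only [Submodule.mem_map, LinearMap.mem_ker]
    constructor
    · rintro ⟨B, hB, rfl⟩
      exact ⟨B.2, hB⟩
    · rintro ⟨hA, hA'⟩
      exact ⟨⟨X, hA⟩, hA', rfl⟩
  rw [← h2, Submodule.finrank_map_subtype_eq]

/-- Infinitesimal form of the orbit lying on a sphere: `⟨D, [D, A]⟩ = ⟨[D, D], A⟩ = 0`. -/
theorem orbitTangent_le_driftPerp (hp : S.iDrift ∈ S.pSpace) : S.orbitTangent ≤ S.driftPerp := by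
  rintro _ ⟨A, hA, rfl⟩
  refine ⟨S.lie_mem_pSpace hp hA, ?_⟩
  change retr S.iDrift ⁅S.iDrift, A⁆ = 0
  rw [← retr_lie, lie_self]
  simp [retr]

theorem finrank_driftCentralizer_ge (hp : S.iDrift ∈ S.pSpace) (h : S.drift ≠ 0) :
    (Module.finrank ℝ S.driftCentralizer : ℤ) ≥
      1 + (Module.finrank ℝ S.kAlg : ℤ) - (Module.finrank ℝ S.pSpace : ℤ) := by
  have h1 := S.finrank_orbitTangent
  have h2 := finrank_driftPerp hp h
  have h3 := Submodule.finrank_mono (orbitTangent_le_driftPerp hp)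
  omega

/-- Turns the numerical equality into the geometric condition used everywhere afterwards: the orbit
fills the tangent space of the sphere. -/
theorem finrank_eq_iff (hp : S.iDrift ∈ S.pSpace) (h : S.drift ≠ 0) :
    (Module.finrank ℝ S.driftCentralizer : ℤ) =
      1 + (Module.finrank ℝ S.kAlg : ℤ) - (Module.finrank ℝ S.pSpace : ℤ) ↔
      S.orbitTangent = S.driftPerp := by
  have h1 := S.finrank_orbitTangent
  have h2 := finrank_driftPerp hp h
  constructor
  · intro h4
    exact Submodule.eq_of_le_of_finrank_eq (orbitTangent_le_driftPerp hp) (by omega)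
  · intro h4
    rw [h4] at h1
    omega

theorem adjointOrbit_subset_driftSphere (hp : S.iDrift ∈ S.pSpace) :
    S.adjointOrbit S.iDrift ⊆ S.driftSphere := by
  rintro _ ⟨k, hk, rfl⟩
  exact S.mem_driftSphere_iff.2 ⟨S.conj_mem_pSpace' hk hp, by rw [SU.norm_mul', SU.norm_mul]⟩

theorem norm_add_sq_of_retr_eq_zero {X Y : Mat n} (hX : X ∈ su n) (hY : Y ∈ su n)
    (h : retr X Y = 0) : ‖X + Y‖ ^ 2 = ‖X‖ ^ 2 + ‖Y‖ ^ 2 := by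
  have h1 := retr_self_of_skew ((su n).add_mem hX hY).1
  rw [retr_add_left, retr_add_right, retr_add_right, retr_self_of_skew hX.1,
    retr_self_of_skew hY.1, retr_comm Y X, h] at h1
  linarith

/-- Great circles through `iH_d` lie on the sphere. -/
theorem greatCircle_mem_driftSphere (hp : S.iDrift ∈ S.pSpace) {X : Mat n} (hX : X ∈ S.driftPerp)
    (hXn : ‖X‖ = ‖S.iDrift‖) (t : ℝ) :
    Real.cos t • S.iDrift + Real.sin t • X ∈ S.driftSphere := by
  refine S.mem_driftSphere_iff.2
    ⟨S.pSpace.add_mem (S.pSpace.smul_mem _ hp) (S.pSpace.smul_mem _ hX.1), ?_⟩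
  rw [← sq_eq_sq₀ (norm_nonneg _) (norm_nonneg _), norm_add_sq_of_retr_eq_zero
    (S.gAlg_le_su (S.gAlg.smul_mem _ hp.1)) (S.gAlg_le_su (S.gAlg.smul_mem _ hX.1.1)),
    norm_smul, norm_smul, mul_pow, mul_pow, hXn, Real.norm_eq_abs, Real.norm_eq_abs, sq_abs, sq_abs,
    ← add_mul, Real.cos_sq_add_sin_sq, one_mul]
  rw [retr_smul_left, retr_smul_right, (S.mem_driftPerp.1 hX).2, mul_zero, mul_zero]

end ControlSystem

end QuantumControl

/-! ### The case of equality -/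

namespace QuantumControl

open scoped Matrix.Norms.Frobenius
open Matrix Filter Topology
open NormedSpace (exp)

variable {n m : ℕ}

section Abstract

variable {E : Type*} [NormedRing E] [NormedAlgebra ℝ E] [CompleteSpace E] [FiniteDimensional ℝ E]

/-- Velocities of curves covered by the orbit parametrization are commutators. -/
theorem exists_commutator_of_hasDerivAt {c : Submodule ℝ E} {A : E}
    (hc : ∀ V ∈ c, A * V = V * A → V = 0) {γ : ℝ → E} {X : E} (hγ : HasDerivAt γ X 0)
    (h0 : γ 0 = A)
    (hloc : ∀ ε > 0, ∀ᶠ t in 𝓝 (0 : ℝ), ∃ V ∈ c, ‖V‖ < ε ∧ exp (-V) * A * exp V = γ t) :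
    ∃ V ∈ c, A * V - V * A = X := by
  have h := hasStrictFDerivAt_exp_neg_mul_exp c.subtypeL A
  have hinj : Function.Injective (ContinuousLinearMap.mul ℝ E A ∘L c.subtypeL -
      (ContinuousLinearMap.mul ℝ E).flip A ∘L c.subtypeL) := by
    rw [injective_iff_map_eq_zero]
    intro V hV
    exact Subtype.ext (hc V V.2 (sub_eq_zero.1 hV))
  obtain ⟨V, hV⟩ := mem_range_of_hasDerivAt h hinj hγ (by simp [h0]) fun ε hε => by
    filter_upwards [hloc ε hε] with t ht
    obtain ⟨V, hV, hVε, hVt⟩ := ht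
    exact ⟨⟨V, hV⟩, hVε, hVt⟩
  exact ⟨V, V.2, hV⟩

/-- If commutators with `A` in `k`, multiples of `A`, and `q` span everything, then near `A` every
element is a multiple of a conjugate of `A` up to an element of `q`. -/
theorem eventually_eq_smul_conj_add {k q : Submodule ℝ E} {A : E}
    (hspan : ∀ X : E, ∃ V ∈ k, ∃ s : ℝ, ∃ W ∈ q, X = (A * V - V * A) + s • A + W) {ε : ℝ}
    (hε : 0 < ε) :
    ∀ᶠ y in 𝓝 A, ∃ V ∈ k, ∃ s : ℝ, |s| < ε ∧ ∃ W ∈ q,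
      y = (1 + s) • (exp (-V) * A * exp V) + W := by
  let p1 : k × ℝ × q →L[ℝ] E := k.subtypeL ∘L ContinuousLinearMap.fst ℝ k (ℝ × q)
  let p2 : k × ℝ × q →L[ℝ] ℝ := ContinuousLinearMap.fst ℝ ℝ q ∘L
    ContinuousLinearMap.snd ℝ k (ℝ × q)
  let p3 : k × ℝ × q →L[ℝ] E := q.subtypeL ∘L ContinuousLinearMap.snd ℝ ℝ q ∘L
    ContinuousLinearMap.snd ℝ k (ℝ × q)
  have h1 := hasStrictFDerivAt_exp_neg_mul_exp p1 A
  have h2 : HasStrictFDerivAt (fun x => 1 + p2 x) p2 0 := p2.hasStrictFDerivAt.const_add 1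
  have h3 := (h2.smul h1).add p3.hasStrictFDerivAt
  -- The derivative at `0` is `(V, s, W) ↦ [A, V] + s A + W`, onto by `hspan`.
  have hmap := h3.map_nhds_eq_of_surj (LinearMap.range_eq_top.2 fun X => by
    obtain ⟨V, hV, s, W, hW, rfl⟩ := hspan X
    exact ⟨(⟨V, hV⟩, s, ⟨W, hW⟩), by simp [p1, p2, p3]⟩)
  have h0 : (1 + p2 0) • (exp (-(p1 0)) * A * exp (p1 0)) + p3 0 = A := by simp
  simp only [Pi.add_apply, Pi.smul_apply'] at hmap
  rw [h0] at hmap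
  rw [← hmap]
  refine eventually_map.2 ?_
  filter_upwards [Metric.ball_mem_nhds (0 : k × ℝ × q) hε] with x hx
  have hx' : ‖x‖ < ε := by simpa using hx
  exact ⟨x.1, x.1.2, x.2.1, ((norm_fst_le x.2).trans (norm_snd_le x)).trans_lt hx', x.2.2, x.2.2.2,
    rfl⟩

end Abstract

theorem eventually_eq_smul_conj_add_mat {k q : Submodule ℝ (Mat n)} {A : Mat n}
    (hspan : ∀ X : Mat n, ∃ V ∈ k, ∃ s : ℝ, ∃ W ∈ q, X = (A * V - V * A) + s • A + W) {ε : ℝ}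
    (hε : 0 < ε) :
    ∀ᶠ y in 𝓝 A, ∃ V ∈ k, ∃ s : ℝ, |s| < ε ∧ ∃ W ∈ q,
      y = (1 + s) • (exp (-V) * A * exp V) + W :=
  eventually_eq_smul_conj_add hspan hε

theorem hasDerivAt_greatCircle {E : Type*} [NormedAddCommGroup E] [NormedSpace ℝ E] (A X : E) :
    HasDerivAt (fun t => Real.cos t • A + Real.sin t • X) X 0 := by
  have := ((Real.hasDerivAt_cos 0).smul_const A).add ((Real.hasDerivAt_sin 0).smul_const X)
  exact this.congr_deriv (by simp)

theorem exists_commutator_of_hasDerivAt_mat {c : Submodule ℝ (Mat n)} {A : Mat n}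
    (hc : ∀ V ∈ c, A * V = V * A → V = 0) {X : Mat n}
    (hloc : ∀ ε > 0, ∀ᶠ t in 𝓝 (0 : ℝ), ∃ V ∈ c, ‖V‖ < ε ∧
      exp (-V) * A * exp V = Real.cos t • A + Real.sin t • X) :
    ∃ V ∈ c, A * V - V * A = X :=
  exists_commutator_of_hasDerivAt hc (hasDerivAt_greatCircle A X) (by simp) hloc

theorem isPreconnected_sphere_submodule {E : Type*} [NormedAddCommGroup E] [NormedSpace ℝ E]
    (V : Submodule ℝ E) (h : 2 ≤ Module.finrank ℝ V) (r : ℝ) :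
    IsPreconnected {X | X ∈ V ∧ ‖X‖ = r} := by
  have hfin : FiniteDimensional ℝ V := Module.finite_of_finrank_pos (by omega)
  have h1 : IsPreconnected (Metric.sphere (0 : V) r) :=
    isPreconnected_sphere (by rw [← Module.finrank_eq_rank]; exact_mod_cast h) _ _
  convert h1.image _ (continuous_subtype_val (p := fun X => X ∈ V)).continuousOn using 1
  ext X
  constructor
  · rintro ⟨hX, hXn⟩
    exact ⟨⟨X, hX⟩, by simpa using hXn, rfl⟩
  · rintro ⟨Y, hY, rfl⟩
    exact ⟨Y.2, by simpa using hY⟩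

theorem isClosed_conjOrbit {l : LieSubalgebra ℝ (Mat n)} (h : IsClosed (expGroup l : Set (SU n)))
    (A : Mat n) : IsClosed (conjOrbit l A) := by
  have hf : Continuous fun k : SU n => ((k⁻¹ : SU n) : Mat n) * A * (k : Mat n) := by fun_prop
  convert (h.isCompact.image hf).isClosed using 1
  ext X
  exact ⟨fun ⟨k, hk, h⟩ => ⟨k, hk, h.symm⟩, fun ⟨k, hk, h⟩ => ⟨k, hk, h.symm⟩⟩

namespace ControlSystem

variable {S : ControlSystem n m}

/-- A great circle through `iH_d` lies in the orbit, so its velocity is a commutator `[iH_d, V]`.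
Vectors of the radius of the sphere suffice by scaling. -/
theorem driftPerp_le_orbitTangent (hK : IsClosed (S.K : Set (SU n))) (hp : S.iDrift ∈ S.pSpace)
    (h : S.drift ≠ 0) (hO : S.driftSphere ⊆ S.adjointOrbit S.iDrift) :
    S.driftPerp ≤ S.orbitTangent := by
  have hunit : ∀ X ∈ S.driftPerp, ‖X‖ = ‖S.iDrift‖ → X ∈ S.orbitTangent := by
    intro X hX hXn
    -- A complement of the centralizer is needed for the parametrization of the orbit to be an
    -- immersion.
    obtain ⟨c, hc, hdis⟩ := exists_complement_of_le
      (z := centralizerIn S.kAlg S.iDrift) (l := S.kAlg.toSubmodule) fun X hX => hX.1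
    have hck : ∀ V ∈ c, V ∈ S.kAlg := fun V hV => hc.le (Submodule.mem_sup_right hV)
    have hlim : Tendsto (fun t : ℝ => Real.cos t • S.iDrift + Real.sin t • X) (𝓝 0)
        (𝓝 S.iDrift) := by
      have : Continuous (fun t : ℝ => Real.cos t • S.iDrift + Real.sin t • X) := by fun_prop
      simpa using this.tendsto 0
    obtain ⟨V, hV, hVX⟩ := exists_commutator_of_hasDerivAt_mat (c := c) (A := S.iDrift) (X := X)
      (fun V hV hVA => Submodule.disjoint_def.1 hdis V ⟨hck V hV, hVA⟩ hV) fun ε hε => by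
        filter_upwards [hlim.eventually
          ((S.closedPair_kAlg hK).eventually_conjOrbit_eq hc hε)] with t ht
        exact ht (hO (greatCircle_mem_driftSphere hp hX hXn t))
    exact ⟨V, hck V hV, hVX⟩
  intro X hX
  by_cases hX0 : X = 0
  · rw [hX0]; exact S.orbitTangent.zero_mem
  have hA0 := norm_ne_zero_iff.2 (S.iDrift_ne_zero h)
  have hXn := norm_ne_zero_iff.2 hX0
  have h1 := hunit ((‖S.iDrift‖ / ‖X‖) • X) (S.driftPerp.smul_mem _ hX) (by
    rw [norm_smul, norm_div, norm_norm, norm_norm, div_mul_cancel₀ _ hXn])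
  have h2 := S.orbitTangent.smul_mem (‖X‖ / ‖S.iDrift‖) h1
  rwa [smul_smul, div_mul_div_cancel₀ hA0, div_self hXn, one_smul] at h2

/-- The orbit directions, the radial direction and a complement `q` of `𝔭` span all matrices. On the
sphere the radial and `q` coordinates must vanish. -/
theorem eventually_mem_adjointOrbit (hp : S.iDrift ∈ S.pSpace) (h : S.drift ≠ 0)
    (hT : S.orbitTangent = S.driftPerp) :
    ∀ᶠ y in 𝓝 S.iDrift, y ∈ S.driftSphere → y ∈ S.adjointOrbit S.iDrift := by
  obtain ⟨q, hq⟩ := S.pSpace.exists_isCompl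
  have hspan : ∀ X : Mat n, ∃ V ∈ S.kAlg.toSubmodule, ∃ s : ℝ, ∃ W ∈ q,
      X = (S.iDrift * V - V * S.iDrift) + s • S.iDrift + W := by
    intro X
    obtain ⟨P, hP, W, hW, rfl⟩ := Submodule.mem_sup.1
      (hq.sup_eq_top ▸ Submodule.mem_top : X ∈ S.pSpace ⊔ q)
    set s := retr S.iDrift P / retr S.iDrift S.iDrift
    have h1 : P - s • S.iDrift ∈ S.orbitTangent := by
      rw [hT]
      refine S.mem_driftPerp.2 ⟨S.pSpace.sub_mem hP (S.pSpace.smul_mem _ hp), ?_⟩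
      rw [retr_sub_right, retr_smul_right, div_mul_cancel₀ _ (S.retr_iDrift_ne_zero h), sub_self]
    obtain ⟨V, hV, hVX⟩ := h1
    refine ⟨V, hV, s, W, hW, ?_⟩
    have hVX' : S.iDrift * V - V * S.iDrift = P - s • S.iDrift := hVX
    rw [hVX', sub_add_cancel]
  filter_upwards [eventually_eq_smul_conj_add_mat hspan one_pos] with y hy hyS
  obtain ⟨V, hV, s, hs, W, hW, rfl⟩ := hy
  obtain ⟨hyp, hyn⟩ := S.mem_driftSphere_iff.1 hyS
  have hφ : exp (-V) * S.iDrift * exp V ∈ S.adjointOrbit S.iDrift :=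
    exp_conj_mem_conjOrbit S.kAlg_le_su hV
  obtain ⟨hφp, hφn⟩ := S.mem_driftSphere_iff.1 (adjointOrbit_subset_driftSphere hp hφ)
  have hW0 : W = 0 := by
    refine Submodule.disjoint_def.1 hq.disjoint W ?_ hW
    have := S.pSpace.sub_mem hyp (S.pSpace.smul_mem (1 + s) hφp)
    rwa [add_sub_cancel_left] at this
  rw [hW0, add_zero] at hyn ⊢
  -- Equal norms give `|1 + s| = 1`, and `|s| < 1` excludes `s = -2`.
  have hs0 : s = 0 := by
    rw [norm_smul, hφn] at hyn
    have h1 := mul_right_cancel₀ (norm_ne_zero_iff.2 (S.iDrift_ne_zero h))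
      (hyn.trans (one_mul _).symm)
    rw [abs_lt] at hs
    rw [Real.norm_of_nonneg (by linarith)] at h1
    linarith
  rwa [hs0, add_zero, one_smul]

theorem eventually_mem_adjointOrbit_of_mem (hp : S.iDrift ∈ S.pSpace) (h : S.drift ≠ 0)
    (hT : S.orbitTangent = S.driftPerp) {x : Mat n} (hx : x ∈ S.adjointOrbit S.iDrift) :
    ∀ᶠ y in 𝓝 x, y ∈ S.driftSphere → y ∈ S.adjointOrbit S.iDrift := by
  obtain ⟨k, hk, rfl⟩ := hx
  have hlim : Tendsto (fun y : Mat n => (k : Mat n) * y * ((k⁻¹ : SU n) : Mat n))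
      (𝓝 (((k⁻¹ : SU n) : Mat n) * S.iDrift * (k : Mat n))) (𝓝 S.iDrift) := by
    have hc : Continuous (fun y : Mat n => (k : Mat n) * y * ((k⁻¹ : SU n) : Mat n)) := by fun_prop
    have h1 := hc.tendsto (((k⁻¹ : SU n) : Mat n) * S.iDrift * (k : Mat n))
    convert h1 using 2
    calc S.iDrift = ((k : Mat n) * ((k⁻¹ : SU n) : Mat n)) * S.iDrift *
          ((k : Mat n) * ((k⁻¹ : SU n) : Mat n)) := by rw [SU.mul_inv, one_mul, mul_one]
      _ = _ := by simp only [mul_assoc]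
  filter_upwards [hlim.eventually (eventually_mem_adjointOrbit hp h hT)] with y hy hyS
  obtain ⟨hyp, hyn⟩ := S.mem_driftSphere_iff.1 hyS
  obtain ⟨g, hg, hgy⟩ := hy (S.mem_driftSphere_iff.2 ⟨S.conj_mem_pSpace hk hyp, by
    rw [SU.norm_mul', SU.norm_mul, hyn]⟩)
  refine ⟨g * k, S.K.mul_mem hg hk, ?_⟩
  calc y = (((k⁻¹ : SU n) : Mat n) * (k : Mat n)) * y * (((k⁻¹ : SU n) : Mat n) * (k : Mat n)) := by
        rw [SU.inv_mul, one_mul, mul_one]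
    _ = ((k⁻¹ : SU n) : Mat n) * ((k : Mat n) * y * ((k⁻¹ : SU n) : Mat n)) * (k : Mat n) := by
        simp only [mul_assoc]
    _ = _ := by
        rw [hgy, _root_.mul_inv_rev, Submonoid.coe_mul, Submonoid.coe_mul]
        simp only [mul_assoc]

theorem isPreconnected_driftSphere (hp : 2 ≤ Module.finrank ℝ S.pSpace) :
    IsPreconnected S.driftSphere := by
  have h : S.driftSphere = {X | X ∈ S.pSpace ∧ ‖X‖ = ‖S.iDrift‖} :=
    Set.ext fun X => S.mem_driftSphere_iff
  rw [h]
  exact isPreconnected_sphere_submodule S.pSpace hp _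

/-- The orbit is nonempty, closed, and open in a connected sphere. -/
theorem adjointOrbit_eq_driftSphere (hK : IsClosed (S.K : Set (SU n))) (hp : S.iDrift ∈ S.pSpace)
    (h : S.drift ≠ 0) (h2 : 2 ≤ Module.finrank ℝ S.pSpace) (hT : S.orbitTangent = S.driftPerp) :
    S.adjointOrbit S.iDrift = S.driftSphere := by
  refine (adjointOrbit_subset_driftSphere hp).antisymm fun x hx => ?_
  by_contra hxO
  set U := interior {y | y ∈ S.driftSphere → y ∈ S.adjointOrbit S.iDrift}
  have hcl : IsClosed (S.adjointOrbit S.iDrift) := isClosed_conjOrbit hK _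
  have hOU : S.adjointOrbit S.iDrift ⊆ U := fun y hy =>
    mem_interior_iff_mem_nhds.2 (eventually_mem_adjointOrbit_of_mem hp h hT hy)
  have hself : S.iDrift ∈ S.adjointOrbit S.iDrift := ⟨1, S.K.one_mem, by simp⟩
  obtain ⟨y, hyS, hyU, hyO⟩ := isPreconnected_driftSphere h2 U (S.adjointOrbit S.iDrift)ᶜ
    isOpen_interior hcl.isOpen_compl
    (fun y _ => (em (y ∈ S.adjointOrbit S.iDrift)).imp (fun h => hOU h) id)
    ⟨S.iDrift, adjointOrbit_subset_driftSphere hp hself, hOU hself⟩ ⟨x, hx, hxO⟩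
  exact hyO (interior_subset hyU hyS)

/-- Off-diagonal matrix units are complex combinations of `E_ij - E_ji` and `i(E_ij + E_ji)`, so `X`
is scalar; its trace is zero. -/
theorem eq_zero_of_commute_su {X : Mat n} (hX : X ∈ su n) (h : ∀ Y ∈ su n, Commute X Y) :
    X = 0 := by
  have hsingle : Pairwise fun i j => Commute (single i j (1 : ℂ)) X := by
    intro i j hij
    have h1 : single i j (1 : ℂ) - single j i 1 ∈ su n := by
      refine ⟨by simp [conjTranspose_single], ?_⟩
      rw [trace_sub, trace_single_eq_of_ne _ _ _ hij, trace_single_eq_of_ne _ _ _ hij.symm, sub_zero]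
    have h2 : Complex.I • (single i j (1 : ℂ) + single j i 1) ∈ su n := by
      refine ⟨by simp [conjTranspose_single, add_comm, ← single_neg], ?_⟩
      rw [trace_smul, trace_add, trace_single_eq_of_ne _ _ _ hij,
        trace_single_eq_of_ne _ _ _ hij.symm, add_zero, smul_zero]
    have h3 : single i j (1 : ℂ) = (1 / 2 : ℂ) • ((single i j (1 : ℂ) - single j i 1) +
        (-Complex.I) • (Complex.I • (single i j (1 : ℂ) + single j i 1))) := by
      rw [smul_smul, neg_mul, Complex.I_mul_I, neg_neg, one_smul, sub_add_add_cancel, ← two_smul ℂ,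
        smul_smul]
      norm_num
    rw [h3]
    exact (((h _ h1).symm.add_left ((h _ h2).symm.smul_left _))).smul_left _
  obtain ⟨a, rfl⟩ := mem_range_scalar_of_commute_single hsingle
  have htr := hX.2
  rw [scalar_apply, trace_diagonal] at htr
  ext i j
  have hn : (n : ℂ) ≠ 0 := by
    have := i.pos
    exact_mod_cast this.ne'
  have ha : a = 0 := by simpa [hn] using htr
  simp [ha]

/-- Otherwise `𝔭` is the line through `iH_d` and `[iH_d, 𝔨] = 0`, so `iH_d` is central in `𝔰𝔲(n)`.
-/
theorem two_le_finrank_pSpace (hp : S.iDrift ∈ S.pSpace) (h : S.drift ≠ 0)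
    (hc : S.Controllable) : 2 ≤ Module.finrank ℝ S.pSpace := by
  by_contra hlt
  have h1 := finrank_driftPerp hp h
  have h0 : S.driftPerp = ⊥ := Submodule.finrank_eq_zero.1 (by omega)
  have hT : S.orbitTangent = ⊥ := le_bot_iff.1 (h0 ▸ orbitTangent_le_driftPerp hp)
  refine S.iDrift_ne_zero h (eq_zero_of_commute_su (S.gAlg_le_su S.iDrift_mem_gAlg) fun Y hY => ?_)
  have hYg : Y ∈ S.gAlg.toSubmodule := (hc Y).2 hY
  rw [← S.kAlg_sup_pSpace] at hYg
  obtain ⟨A, hA, P, hP, rfl⟩ := Submodule.mem_sup.1 hYg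
  have hcomm : Commute S.iDrift A := by
    have : ⁅S.iDrift, A⁆ ∈ S.orbitTangent := ⟨A, hA, rfl⟩
    rw [hT, Submodule.mem_bot] at this
    exact sub_eq_zero.1 this
  refine hcomm.add_right ?_
  have hPd : P - (retr S.iDrift P / retr S.iDrift S.iDrift) • S.iDrift ∈ S.driftPerp := by
    refine S.mem_driftPerp.2 ⟨S.pSpace.sub_mem hP (S.pSpace.smul_mem _ hp), ?_⟩
    rw [retr_sub_right, retr_smul_right, div_mul_cancel₀ _ (S.retr_iDrift_ne_zero h), sub_self]
  rw [h0, Submodule.mem_bot, sub_eq_zero] at hPd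
  rw [hPd]
  exact (Commute.refl _).smul_right _

theorem orbitTangent_eq_iff (hK : IsClosed (S.K : Set (SU n))) (hp : S.iDrift ∈ S.pSpace)
    (h : S.drift ≠ 0) (h2 : 2 ≤ Module.finrank ℝ S.pSpace) :
    S.orbitTangent = S.driftPerp ↔ S.adjointOrbit S.iDrift = S.driftSphere :=
  ⟨adjointOrbit_eq_driftSphere hK hp h h2, fun hO =>
    (orbitTangent_le_driftPerp hp).antisymm (driftPerp_le_orbitTangent hK hp h hO.ge)⟩

/-- If the orbit is the whole sphere, then `exp 𝔤` generates a closed group. -/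
theorem closedPair_gAlg (hK : IsClosed (S.K : Set (SU n))) (hp : S.iDrift ∈ S.pSpace)
    (h : S.drift ≠ 0) (h2 : 2 ≤ Module.finrank ℝ S.pSpace) (hT : S.orbitTangent = S.driftPerp) :
    ClosedPair S.kAlg S.gAlg := by
  refine ⟨S.kAlg_le_gAlg, S.gAlg_le_su, hK, ?_⟩
  set br := Submodule.span ℝ {Z | ∃ X ∈ S.gAlg, ∃ Y ∈ S.gAlg, ⁅X, Y⁆ = Z} with hbr
  have htan : S.driftPerp ≤ br := by
    rw [← hT]
    rintro _ ⟨A, hA, rfl⟩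
    exact Submodule.subset_span ⟨_, hp.1, A, S.kAlg_le_gAlg hA, rfl⟩
  -- By transitivity some `X = k⁻¹ (iH_d) k` is orthogonal to `iH_d`. Then `k (iH_d) k⁻¹` is
  -- orthogonal to `iH_d` too, hence equals some `[iH_d, A]`. Conjugating back by `k` gives `iH_d =
  -- [X, A']`.
  have hdrift : S.iDrift ∈ br := by
    have h1 := finrank_driftPerp hp h
    have hne : S.driftPerp ≠ ⊥ := by
      intro h0
      rw [h0, finrank_bot] at h1
      omega
    obtain ⟨X₀, hX₀, hX₀0⟩ := Submodule.exists_mem_ne_zero_of_ne_bot hne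
    have hX₀n := norm_ne_zero_iff.2 hX₀0
    set X := (‖S.iDrift‖ / ‖X₀‖) • X₀
    have hX : X ∈ S.driftPerp := S.driftPerp.smul_mem _ hX₀
    have hXn : ‖X‖ = ‖S.iDrift‖ := by
      rw [norm_smul, norm_div, norm_norm, norm_norm, div_mul_cancel₀ _ hX₀n]
    have hXO : X ∈ S.adjointOrbit S.iDrift := by
      rw [adjointOrbit_eq_driftSphere hK hp h h2 hT]
      exact S.mem_driftSphere_iff.2 ⟨hX.1, hXn⟩
    obtain ⟨k, hk, hkX⟩ := hXO
    have hki : S.iDrift = (k : Mat n) * X * ((k⁻¹ : SU n) : Mat n) := by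
      rw [hkX]
      calc S.iDrift = ((k : Mat n) * ((k⁻¹ : SU n) : Mat n)) * S.iDrift *
            ((k : Mat n) * ((k⁻¹ : SU n) : Mat n)) := by rw [SU.mul_inv, one_mul, mul_one]
        _ = _ := by simp only [mul_assoc]
    have hY : (k : Mat n) * S.iDrift * ((k⁻¹ : SU n) : Mat n) ∈ S.orbitTangent := by
      rw [hT]
      refine S.mem_driftPerp.2 ⟨S.conj_mem_pSpace hk hp, ?_⟩
      have e1 := retr_conj k X S.iDrift
      rw [← hki] at e1
      rw [e1, retr_comm]
      exact hX.2
    obtain ⟨A, hA, hAY⟩ := hY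
    have hAY' : S.iDrift * A - A * S.iDrift =
        (k : Mat n) * S.iDrift * ((k⁻¹ : SU n) : Mat n) := hAY
    set A' := ((k⁻¹ : SU n) : Mat n) * A * (k : Mat n)
    have hA' : A' ∈ S.kAlg := by
      have := expGroup_conj_mem_self (S.K.inv_mem hk) hA
      rwa [inv_inv] at this
    refine Submodule.subset_span ⟨X, hX.1.1, A', S.kAlg_le_gAlg hA', ?_⟩
    have e2 : ((k⁻¹ : SU n) : Mat n) * (S.iDrift * A - A * S.iDrift) * (k : Mat n) = S.iDrift := by
      rw [hAY']
      calc _ = (((k⁻¹ : SU n) : Mat n) * (k : Mat n)) * S.iDrift *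
            (((k⁻¹ : SU n) : Mat n) * (k : Mat n)) := by simp only [mul_assoc]
        _ = _ := by rw [SU.inv_mul, one_mul, mul_one]
    rw [← e2, lie_eq_mul_sub, hkX, mul_sub, sub_mul]
    congr 1
    · calc _ = ((k⁻¹ : SU n) : Mat n) * S.iDrift * ((k : Mat n) * ((k⁻¹ : SU n) : Mat n)) * A *
            (k : Mat n) := by simp only [A', mul_assoc]
        _ = _ := by rw [SU.mul_inv]; simp only [mul_assoc, one_mul]
    · calc _ = ((k⁻¹ : SU n) : Mat n) * A * ((k : Mat n) * ((k⁻¹ : SU n) : Mat n)) * S.iDrift *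
            (k : Mat n) := by simp only [A', mul_assoc]
        _ = _ := by rw [SU.mul_inv]; simp only [mul_assoc, one_mul]
  rw [← S.kAlg_sup_pSpace]
  refine sup_le_sup_left (fun P hP => ?_) _
  have hPd : P - (retr S.iDrift P / retr S.iDrift S.iDrift) • S.iDrift ∈ S.driftPerp := by
    refine S.mem_driftPerp.2 ⟨S.pSpace.sub_mem hP (S.pSpace.smul_mem _ hp), ?_⟩
    rw [retr_sub_right, retr_smul_right, div_mul_cancel₀ _ (S.retr_iDrift_ne_zero h), sub_self]
  have := br.add_mem (htan hPd) (br.smul_mem (retr S.iDrift P / retr S.iDrift S.iDrift) hdrift)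
  rwa [sub_add_cancel] at this

end ControlSystem

end QuantumControl

/-! ### The control algebra `𝔰𝔬(n)` -/

namespace QuantumControl

open Matrix

variable {n m : ℕ}

theorem mem_soSet_iff {A : Mat n} :
    A ∈ soSet n ↔ (∀ i j, (A i j).im = 0) ∧ ∀ i j, (A j i).re = -(A i j).re := by
  constructor
  · rintro ⟨B, hB, rfl⟩
    have hB' : Bᵀ = -B := (LieAlgebra.Orthogonal.mem_so _ _ B).1 hB
    refine ⟨fun i j => by simp, fun i j => ?_⟩
    simpa using congrFun (congrFun hB' i) j
  · rintro ⟨him, hre⟩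
    refine ⟨of fun i j => (A i j).re, (LieAlgebra.Orthogonal.mem_so _ _ _).2 ?_, ?_⟩
    · ext i j
      exact hre i j
    · ext i j
      exact Complex.ext rfl (by simp [him])

namespace ControlSystem

variable {S : ControlSystem n m}

/-- The commutator with a diagonal matrix multiplies the entry at `(i, j)` by `lam i - lam j`. -/
theorem mem_driftCentralizer_iff_of_so (hk : (S.kAlg : Set (Mat n)) = soSet n) {lam : Fin n → ℝ}
    (hd : S.drift = diagonal fun i => (lam i : ℂ)) {A : Mat n} :
    A ∈ S.driftCentralizer ↔ A ∈ soSet n ∧ ∀ i j, lam i ≠ lam j → A i j = 0 := by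
  rw [← hk]
  change (A ∈ S.kAlg ∧ S.drift * A - A * S.drift = 0) ↔ (A ∈ S.kAlg ∧ _)
  refine and_congr_right fun _ => ?_
  rw [hd, ← Matrix.ext_iff]
  refine forall₂_congr fun i j => ?_
  rw [Matrix.sub_apply, diagonal_mul, mul_diagonal, Matrix.zero_apply, mul_comm, ← mul_sub, mul_eq_zero,
    sub_eq_zero, Complex.ofReal_inj]
  tauto

theorem finrank_driftCentralizer_of_so (hk : (S.kAlg : Set (Mat n)) = soSet n) {lam : Fin n → ℝ}
    (hd : S.drift = diagonal fun i => (lam i : ℂ)) :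
    Module.finrank ℝ S.driftCentralizer = degeneratePairs lam := by
  classical
  let D := {p : Fin n × Fin n // p.1 < p.2 ∧ lam p.1 = lam p.2}
  -- The coordinates are the entries above the diagonal at degenerate pairs; skew-symmetry and the
  -- vanishing of the other entries determine the rest.
  let f : S.driftCentralizer →ₗ[ℝ] (D → ℝ) :=
    { toFun := fun A p => ((A : Mat n) p.1.1 p.1.2).re
      map_add' := fun A B => by ext p; simp
      map_smul' := fun c A => by ext p; simp }
  have hinj : Function.Injective f := by
    rw [injective_iff_map_eq_zero]
    intro A hA
    obtain ⟨hso, hz⟩ := (mem_driftCentralizer_iff_of_so hk hd).1 A.2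
    obtain ⟨him, hre⟩ := mem_soSet_iff.1 hso
    have hlt : ∀ i j, i < j → ((A : Mat n) i j).re = 0 := by
      intro i j hij
      by_cases h : lam i = lam j
      · exact congrFun hA ⟨(i, j), hij, h⟩
      · rw [hz i j h, Complex.zero_re]
    ext i j
    refine Complex.ext ?_ (him i j)
    rcases lt_trichotomy i j with h | rfl | h
    · exact hlt i j h
    · have := hre i i
      change ((A : Mat n) i i).re = 0
      linarith
    · have := hre j i
      rw [hlt j i h] at this
      simpa using this
  have hsurj : Function.Surjective f := by
    intro x
    let y : Fin n → Fin n → ℝ := fun i j => if h : i < j ∧ lam i = lam j then x ⟨(i, j), h⟩ else 0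
    have hy0 : ∀ i j, lam i ≠ lam j → y i j = 0 := fun i j h => dif_neg fun h' => h h'.2
    have hy1 : ∀ i j, ¬ i < j → y i j = 0 := fun i j h => dif_neg fun h' => h h'.1
    let A : Mat n := of fun i j => ((y i j - y j i : ℝ) : ℂ)
    have hA : A ∈ S.driftCentralizer := by
      refine (mem_driftCentralizer_iff_of_so hk hd).2 ⟨mem_soSet_iff.2 ⟨fun i j => ?_, fun i j => ?_⟩,
        fun i j hij => ?_⟩
      · exact Complex.ofReal_im _
      · simp [A]
      · simp [A, hy0 i j hij, hy0 j i hij.symm]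
    refine ⟨⟨A, hA⟩, ?_⟩
    ext ⟨⟨i, j⟩, hij, hl⟩
    change (((y i j - y j i : ℝ) : ℂ)).re = _
    rw [Complex.ofReal_re, hy1 j i hij.not_gt, sub_zero]
    exact dif_pos ⟨hij, hl⟩
  rw [(LinearEquiv.ofBijective f ⟨hinj, hsurj⟩).finrank_eq, Module.finrank_fintype_fun_eq_card,
    degeneratePairs, Nat.card_eq_fintype_card]

end ControlSystem

end QuantumControl

/-! ### Product integrals -/

namespace QuantumControl

open Filter Topology MeasureTheory
open NormedSpace (exp)

section ProductIntegral

variable {E : Type*} [NormedRing E] [NormedAlgebra ℝ E] [CompleteSpace E]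

/-- First-order expansion of the product; the bound is linear in the step size, with a constant as
small as desired, so step errors sum to something small. -/
theorem exists_norm_exp_mul_exp_sub_le {η : ℝ} (hη : 0 < η) :
    ∃ δ > 0, ∀ μ < δ, ∀ X Y : E, ‖X‖ ≤ μ → ‖Y‖ ≤ μ →
      ‖exp X * exp Y - 1 - (X + Y)‖ ≤ η * μ := by
  have h : HasStrictFDerivAt (fun x : E × E => exp x.1 * exp x.2)
      (ContinuousLinearMap.fst ℝ E E + ContinuousLinearMap.snd ℝ E E) 0 := by
    refine ((hasStrictFDerivAt_exp_clm (ContinuousLinearMap.fst ℝ E E)).mul'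
      (hasStrictFDerivAt_exp_clm (ContinuousLinearMap.snd ℝ E E))).congr_fderiv ?_
    ext x <;> simp
  have h1 := (hasFDerivAt_iff_isLittleO.1 h.hasFDerivAt).bound hη
  obtain ⟨δ, hδ, hb⟩ := Metric.eventually_nhds_iff.1 h1
  refine ⟨δ, hδ, fun μ hμ X Y hX hY => ?_⟩
  have hXY : ‖(X, Y)‖ ≤ μ := max_le hX hY
  have h2 := hb (y := (X, Y)) (by rw [dist_zero_right]; exact hXY.trans_lt hμ)
  simp only [sub_zero, Prod.fst_zero, Prod.snd_zero, NormedSpace.exp_zero, mul_one] at h2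
  exact h2.trans (mul_le_mul_of_nonneg_left hXY hη.le)

/-- The increment of a solution of `U' = a U` over a short interval. -/
theorem norm_increment_sub_le {a U : ℝ → E} {b : ℝ → ℝ} {T M : ℝ}
    (ha : IntervalIntegrable a volume 0 T) (hb : IntervalIntegrable b volume 0 T)
    (hab : ∀ r ∈ Set.Icc 0 T, ‖a r‖ ≤ b r) (hUc : ContinuousOn U (Set.Icc 0 T))
    (hU : ∀ s ∈ Set.Icc 0 T, U s = U 0 + ∫ r in (0 : ℝ)..s, a r * U r)
    (hM : ∀ s ∈ Set.Icc 0 T, ‖U s‖ ≤ M) {s t : ℝ} (hs : 0 ≤ s) (hst : s ≤ t) (ht : t ≤ T) :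
    ‖U t - U s - (∫ r in s..t, a r) * U s‖ ≤ M * (∫ r in s..t, b r) ^ 2 := by
  have hT : 0 ≤ T := hs.trans (hst.trans ht)
  have hM0 : 0 ≤ M := (norm_nonneg _).trans (hM 0 ⟨le_rfl, hT⟩)
  have hsub : ∀ {x y : ℝ}, 0 ≤ x → x ≤ y → y ≤ T → Set.uIcc x y ⊆ Set.uIcc 0 T := by
    intro x y hx hxy hy
    rw [Set.uIcc_of_le hxy, Set.uIcc_of_le hT]
    exact Set.Icc_subset_Icc hx hy
  have hUc' : ContinuousOn U (Set.uIcc 0 T) := by rwa [Set.uIcc_of_le hT]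
  have haU : IntervalIntegrable (fun r => a r * U r) volume 0 T := ha.mul_continuousOn hUc'
  have hdiff : ∀ r, s ≤ r → r ≤ T → U r - U s = ∫ x in s..r, a x * U x := by
    intro r hr hrT
    rw [hU r ⟨hs.trans hr, hrT⟩, hU s ⟨hs, hr.trans hrT⟩, add_sub_add_left_eq_sub,
      intervalIntegral.integral_interval_sub_left]
    · exact haU.mono_set (hsub le_rfl (hs.trans hr) hrT)
    · exact haU.mono_set (hsub le_rfl hs (hr.trans hrT))
  have hbst : IntervalIntegrable b volume s t := hb.mono_set (hsub hs hst ht)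
  have hb0 : ∀ r ∈ Set.Icc 0 T, 0 ≤ b r := fun r hr => (norm_nonneg _).trans (hab r hr)
  set μ := ∫ r in s..t, b r
  have hclose : ∀ r ∈ Set.Icc s t, ‖U r - U s‖ ≤ M * μ := by
    intro r hr
    rw [hdiff r hr.1 (hr.2.trans ht)]
    have hbsr : IntervalIntegrable b volume s r := hb.mono_set (hsub hs hr.1 (hr.2.trans ht))
    calc ‖∫ x in s..r, a x * U x‖ ≤ ∫ x in s..r, M * b x := by
          refine intervalIntegral.norm_integral_le_of_norm_le hr.1 ?_ (hbsr.const_mul M)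
          refine Eventually.of_forall fun x hx => ?_
          have hx' : x ∈ Set.Icc 0 T := ⟨hs.trans hx.1.le, hx.2.trans (hr.2.trans ht)⟩
          calc ‖a x * U x‖ ≤ ‖a x‖ * ‖U x‖ := norm_mul_le _ _
            _ ≤ b x * M := mul_le_mul (hab x hx') (hM x hx') (norm_nonneg _) (hb0 x hx')
            _ = M * b x := mul_comm _ _
      _ = M * ∫ x in s..r, b x := intervalIntegral.integral_const_mul _ _
      _ ≤ M * μ := by
          refine mul_le_mul_of_nonneg_left ?_ hM0
          refine intervalIntegral.integral_mono_interval le_rfl hr.1 hr.2 ?_ hbst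
          refine (ae_restrict_iff' measurableSet_Ioc).2 (Eventually.of_forall fun x hx => ?_)
          exact hb0 x ⟨hs.trans hx.1.le, hx.2.trans ht⟩
  have hast : IntervalIntegrable a volume s t := ha.mono_set (hsub hs hst ht)
  have haUst : IntervalIntegrable (fun r => a r * U r) volume s t := haU.mono_set (hsub hs hst ht)
  have hcst : IntervalIntegrable (fun r => a r * U s) volume s t := hast.mul_const (U s)
  have heq : U t - U s - (∫ r in s..t, a r) * U s = ∫ r in s..t, a r * (U r - U s) := by
    have h1 : (∫ r in s..t, a r) * U s = ∫ r in s..t, a r * U s :=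
      (((ContinuousLinearMap.mul ℝ E).flip (U s)).intervalIntegral_comp_comm hast).symm
    rw [hdiff t hst ht, h1,
      ← intervalIntegral.integral_sub haUst hcst]
    simp only [mul_sub]
  rw [heq]
  calc ‖∫ r in s..t, a r * (U r - U s)‖ ≤ ∫ r in s..t, b r * (M * μ) := by
        refine intervalIntegral.norm_integral_le_of_norm_le hst ?_ (hbst.mul_const _)
        refine Eventually.of_forall fun x hx => ?_
        have hx' : x ∈ Set.Icc 0 T := ⟨hs.trans hx.1.le, hx.2.trans ht⟩
        exact (norm_mul_le _ _).trans (mul_le_mul (hab x hx') (hclose x ⟨hx.1.le, hx.2⟩)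
          (norm_nonneg _) (hb0 x hx'))
    _ = M * μ ^ 2 := by rw [intervalIntegral.integral_mul_const]; ring

/-- Solutions of `U' = a U` with integrable `a` are limits of products of exponentials. -/
theorem exists_partition_norm_prod_exp_sub_le {a U : ℝ → E} {b : ℝ → ℝ} {T : ℝ} (hT : 0 ≤ T)
    (ha : IntervalIntegrable a volume 0 T) (hb : IntervalIntegrable b volume 0 T)
    (hab : ∀ r ∈ Set.Icc 0 T, ‖a r‖ ≤ b r) (hUc : ContinuousOn U (Set.Icc 0 T))
    (hU : ∀ s ∈ Set.Icc 0 T, U s = U 0 + ∫ r in (0 : ℝ)..s, a r * U r) {ε : ℝ} (hε : 0 < ε) :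
    ∃ N : ℕ, 0 < N ∧ ∀ X Y W : ℕ → E,
      (∀ i < N, X i + Y i = ∫ r in (T * (i / N))..(T * ((i + 1 : ℕ) / N)), a r) →
      (∀ i < N, ‖X i‖ ≤ ∫ r in (T * (i / N))..(T * ((i + 1 : ℕ) / N)), b r) →
      (∀ i < N, ‖Y i‖ ≤ ∫ r in (T * (i / N))..(T * ((i + 1 : ℕ) / N)), b r) →
      (∀ i < N, ∀ Z, ‖exp (X i) * exp (Y i) * Z‖ ≤ ‖Z‖) →
      W 0 = U 0 → (∀ i < N, W (i + 1) = exp (X i) * exp (Y i) * W i) → ‖W N - U T‖ ≤ ε := by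
  have huIcc : Set.uIcc 0 T = Set.Icc 0 T := Set.uIcc_of_le hT
  obtain ⟨M, hM0, hM⟩ : ∃ M > 0, ∀ s ∈ Set.Icc 0 T, ‖U s‖ ≤ M := by
    obtain ⟨M, hM⟩ := isCompact_Icc.exists_bound_of_continuousOn hUc
    exact ⟨max M 1, by positivity, fun s hs => (hM s hs).trans (le_max_left _ _)⟩
  have hb0 : ∀ r ∈ Set.Icc 0 T, 0 ≤ b r := fun r hr => (norm_nonneg _).trans (hab r hr)
  set g : ℝ → ℝ := fun s => ∫ r in (0 : ℝ)..s, b r with hg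
  have hgc : ContinuousOn g (Set.Icc 0 T) := by
    rw [← huIcc]
    exact intervalIntegral.continuousOn_primitive_interval' hb Set.left_mem_uIcc
  have hR : 0 ≤ g T := intervalIntegral.integral_nonneg hT fun r hr => hb0 r hr
  -- Each step makes two errors of at most `κ μ M`, and the `μ` add up to `g T`; the `+ 1` avoids
  -- division by zero.
  set κ := ε / (2 * M * (g T + 1)) with hκ
  have hκ0 : 0 < κ := by positivity
  obtain ⟨δ₁, hδ₁, hexp⟩ := exists_norm_exp_mul_exp_sub_le (E := E) hκ0
  set δ := min δ₁ κ
  have hδ : 0 < δ := lt_min hδ₁ hκ0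
  obtain ⟨ρ, hρ, huc⟩ := Metric.uniformContinuousOn_iff.1
    (isCompact_Icc.uniformContinuousOn_of_continuous hgc) δ hδ
  obtain ⟨N, hN⟩ := exists_nat_gt (T / ρ)
  have hNR : (0 : ℝ) < N := (div_nonneg hT hρ.le).trans_lt hN
  have hN0 : 0 < N := by exact_mod_cast hNR
  refine ⟨N, hN0, fun X Y W hXY hX hY hcontr hW0 hW => ?_⟩
  set t : ℕ → ℝ := fun i => T * (i / N) with ht
  have htmem : ∀ i ≤ N, t i ∈ Set.Icc 0 T := by
    intro i hi
    have h1 : (i : ℝ) / N ≤ 1 := by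
      rw [div_le_one hNR]; exact_mod_cast hi
    exact ⟨by positivity, mul_le_of_le_one_right hT h1⟩
  have htstep : ∀ i, t (i + 1) - t i = T / N := by
    intro i
    simp only [ht]; push_cast; ring
  have htmono : ∀ i, t i ≤ t (i + 1) := fun i => by
    have := htstep i
    have h2 : 0 ≤ T / N := by positivity
    linarith
  have hgdiff : ∀ i < N, ∫ r in (t i)..(t (i + 1)), b r = g (t (i + 1)) - g (t i) := by
    intro i hi
    have hint : ∀ j ≤ N, IntervalIntegrable b volume 0 (t j) := fun j hj => by
      refine hb.mono_set ?_
      rw [huIcc, Set.uIcc_of_le (htmem j hj).1]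
      exact Set.Icc_subset_Icc le_rfl (htmem j hj).2
    exact (intervalIntegral.integral_interval_sub_left (hint _ hi) (hint _ hi.le)).symm
  have hsmall : ∀ i < N, ∫ r in (t i)..(t (i + 1)), b r < δ := by
    intro i hi
    have h1 := huc (t (i + 1)) (htmem _ hi) (t i) (htmem _ hi.le) (by
      rw [Real.dist_eq, htstep, abs_of_nonneg (by positivity), div_lt_iff₀ hNR, mul_comm,
        ← div_lt_iff₀ hρ]
      exact hN)
    rw [Real.dist_eq, ← hgdiff i hi] at h1
    exact (le_abs_self _).trans_lt h1
  have hmain : ∀ i ≤ N, ‖W i - U (t i)‖ ≤ 2 * κ * M * g (t i) := by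
    intro i
    induction i with
    | zero =>
      intro _
      simp [ht, hW0, hg]
    | succ i ih =>
      intro hi
      have hiN : i < N := hi
      have hi' := ih hiN.le
      set μ := ∫ r in (t i)..(t (i + 1)), b r with hμ
      have hμ0 : 0 ≤ μ := intervalIntegral.integral_nonneg (htmono i) fun r hr =>
        hb0 r ⟨(htmem i hiN.le).1.trans hr.1, hr.2.trans (htmem _ hi).2⟩
      have hμδ : μ < δ := hsmall i hiN
      have h1 := norm_increment_sub_le ha hb hab hUc hU hM (htmem i hiN.le).1 (htmono i)
        (htmem _ hi).2
      have h2 := hexp μ (hμδ.trans_le (min_le_left _ _)) (X i) (Y i) (hX i hiN) (hY i hiN)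
      rw [hXY i hiN] at h2
      set J := ∫ r in (t i)..(t (i + 1)), a r
      -- The factors are contractions, so earlier errors are not amplified.
      have h3 := hcontr i hiN (W i - U (t i))
      set F := exp (X i) * exp (Y i)
      have h2' : ‖(F - 1 - J) * U (t i)‖ ≤ κ * μ * M :=
        (norm_mul_le _ _).trans (mul_le_mul h2 (hM _ (htmem i hiN.le)) (norm_nonneg _)
          (by positivity))
      have h1' : ‖U (t (i + 1)) - U (t i) - J * U (t i)‖ ≤ κ * μ * M := by
        refine h1.trans ?_
        have : μ ^ 2 ≤ κ * μ := by
          rw [sq]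
          exact mul_le_mul_of_nonneg_right (hμδ.le.trans (min_le_right _ _)) hμ0
        calc M * μ ^ 2 ≤ M * (κ * μ) := mul_le_mul_of_nonneg_left this hM0.le
          _ = κ * μ * M := by ring
      have heq : W (i + 1) - U (t (i + 1)) = F * (W i - U (t i)) + (F - 1 - J) * U (t i) -
          (U (t (i + 1)) - U (t i) - J * U (t i)) := by
        rw [hW i hiN]
        simp only [mul_sub, sub_mul, one_mul]
        abel
      rw [heq]
      have h4 := (norm_sub_le (F * (W i - U (t i)) + (F - 1 - J) * U (t i))
        (U (t (i + 1)) - U (t i) - J * U (t i))).trans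
          (add_le_add_left (norm_add_le _ _) _)
      have h5 : g (t (i + 1)) = g (t i) + μ := by
        have := hgdiff i hiN
        linarith
      rw [h5, mul_add]
      linarith
  have htN : t N = T := by simp [ht, hNR.ne']
  have hfin := hmain N le_rfl
  rw [htN] at hfin
  refine hfin.trans ?_
  have : 2 * κ * M * g T = ε * (g T / (g T + 1)) := by
    rw [hκ]; field_simp
  rw [this]
  exact mul_le_of_le_one_right hε.le ((div_le_one (by positivity)).2 (by linarith))

end ProductIntegral

end QuantumControl

/-! ### Linear equations with controls -/

namespace QuantumControl

open Filter Topology MeasureTheory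
open NormedSpace (exp)

theorem intervalIntegrable_sum_smul {E : Type*} [NormedAddCommGroup E] [NormedSpace ℝ E] {m : ℕ}
    {C : Fin m → E} {f : Fin m → ℝ → ℝ} {s t : ℝ}
    (hf : ∀ j, IntervalIntegrable (f j) volume s t) :
    IntervalIntegrable (fun r => ∑ j, f j r • C j) volume s t := by
  refine (IntervalIntegrable.sum Finset.univ (f := fun j r => f j r • C j) fun j _ =>
    (hf j).smul_continuousOn continuousOn_const).congr fun r _ => ?_
  simp

section LinearEquation

variable {E : Type*} [NormedRing E] [NormedAlgebra ℝ E] [CompleteSpace E]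

theorem hasDerivAt_exp_sub_smul_mul (X u : E) (t r : ℝ) :
    HasDerivAt (fun r : ℝ => exp ((r - t) • X) * u) (X * (exp ((r - t) • X) * u)) r := by
  have h1 := hasDerivAt_exp_smul_const' (𝕂 := ℝ) X (r - t)
  have h2 : HasDerivAt (fun r : ℝ => r - t) 1 r := (hasDerivAt_id r).sub_const t
  have h3 := (h1.scomp r h2).mul_const u
  rw [one_smul, mul_assoc] at h3
  exact h3

/-- A solution of `U' = a U` on `[0, t]` followed by a constant generator `X` on `[t, t + τ]`. -/
theorem exists_solution_append {a U : ℝ → E} {t τ : ℝ} (ht : 0 ≤ t) (hτ : 0 ≤ τ)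
    (ha : IntervalIntegrable a volume 0 t) (hUc : ContinuousOn U (Set.Icc 0 t))
    (hU : ∀ s ∈ Set.Icc 0 t, U s = 1 + ∫ r in (0 : ℝ)..s, a r * U r) (X : E) :
    ∃ V : ℝ → E, ContinuousOn V (Set.Icc 0 (t + τ)) ∧
      (∀ s ∈ Set.Icc 0 (t + τ), V s = 1 + ∫ r in (0 : ℝ)..s, (if r ≤ t then a r else X) * V r) ∧
      V (t + τ) = exp (τ • X) * U t := by
  set V : ℝ → E := fun s => if s ≤ t then U s else exp ((s - t) • X) * U t with hV
  have hexpc : Continuous fun s : ℝ => exp ((s - t) • X) * U t :=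
    continuous_iff_continuousAt.2 fun s => (hasDerivAt_exp_sub_smul_mul X (U t) t s).continuousAt
  have hVt : ∀ s, t ≤ s → V s = exp ((s - t) • X) * U t := by
    intro s hs
    rcases hs.eq_or_lt with rfl | hs
    · simp [hV]
    · simp [hV, hs.not_ge]
  have hVU : ∀ s, s ≤ t → V s = U s := fun s hs => by simp [hV, hs]
  have hVc : ContinuousOn V (Set.Icc 0 (t + τ)) := by
    have h1 : ContinuousOn V (Set.Icc 0 t) := hUc.congr fun s hs => hVU s hs.2
    have h2 : ContinuousOn V (Set.Icc t (t + τ)) :=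
      hexpc.continuousOn.congr fun s hs => hVt s hs.1
    rw [← Set.Icc_union_Icc_eq_Icc ht (by linarith : t ≤ t + τ)]
    exact h1.union_of_isClosed h2 isClosed_Icc isClosed_Icc
  have hint1 : ∀ s, s ≤ t → 0 ≤ s → ∫ r in (0 : ℝ)..s, (if r ≤ t then a r else X) * V r =
      ∫ r in (0 : ℝ)..s, a r * U r := by
    intro s hs hs0
    refine intervalIntegral.integral_congr fun r hr => ?_
    rw [Set.uIcc_of_le hs0] at hr
    simp only [if_pos (hr.2.trans hs), hVU r (hr.2.trans hs)]
  have hae : ∀ s, t ≤ s → ∀ᵐ r ∂volume, r ∈ Set.uIoc t s →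
      X * (exp ((r - t) • X) * U t) = (if r ≤ t then a r else X) * V r := by
    intro s hs
    refine Eventually.of_forall fun r hr => ?_
    rw [Set.uIoc_of_le hs] at hr
    rw [if_neg hr.1.not_ge, hVt r hr.1.le]
  have hcI : ∀ s, IntervalIntegrable (fun r : ℝ => X * (exp ((r - t) • X) * U t)) volume t s :=
    fun s => (continuous_const.mul hexpc).intervalIntegrable _ _
  have haU : IntervalIntegrable (fun r => a r * U r) volume 0 t :=
    ha.mul_continuousOn (by rwa [Set.uIcc_of_le ht])
  refine ⟨V, hVc, fun s hs => ?_, ?_⟩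
  · rcases le_total s t with hst | hst
    · rw [hint1 s hst hs.1, hVU s hst, hU s ⟨hs.1, hst⟩]
    · have h1 : IntervalIntegrable (fun r => (if r ≤ t then a r else X) * V r) volume 0 t := by
        refine haU.congr fun r hr => ?_
        rw [Set.uIoc_of_le ht] at hr
        simp only [if_pos hr.2, hVU r hr.2]
      have h2 : IntervalIntegrable (fun r => (if r ≤ t then a r else X) * V r) volume t s := by
        refine (hcI s).congr fun r hr => ?_
        rw [Set.uIoc_of_le hst] at hr
        simp only [if_neg hr.1.not_ge, hVt r hr.1.le]
      have h3 : ∫ r in t..s, (if r ≤ t then a r else X) * V r =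
          exp ((s - t) • X) * U t - U t := by
        rw [← intervalIntegral.integral_congr_ae (hae s hst),
          intervalIntegral.integral_eq_sub_of_hasDerivAt
            (fun r _ => hasDerivAt_exp_sub_smul_mul X (U t) t r) (hcI s)]
        simp
      rw [← intervalIntegral.integral_add_adjacent_intervals h1 h2, hint1 t le_rfl ht, h3, hVt s hst,
        ← add_assoc, ← hU t ⟨ht, le_rfl⟩, add_sub_cancel]
  · rw [hVt _ (by linarith), add_sub_cancel_left]

theorem intervalIntegrable_ite {F : Type*} [NormedAddCommGroup F] {f : ℝ → F} {t τ : ℝ}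
    (ht : 0 ≤ t) (hτ : 0 ≤ τ) (hf : IntervalIntegrable f volume 0 t) (c : F) :
    IntervalIntegrable (fun r => if r ≤ t then f r else c) volume 0 (t + τ) := by
  have hτ' : t ≤ t + τ := by linarith
  have h1 : IntervalIntegrable (fun r => if r ≤ t then f r else c) volume 0 t := by
    refine hf.congr fun r hr => ?_
    rw [Set.uIoc_of_le ht] at hr
    simp only [if_pos hr.2]
  have h2 : IntervalIntegrable (fun r => if r ≤ t then f r else c) volume t (t + τ) := by
    refine (intervalIntegrable_const (c := c)).congr fun r hr => ?_
    rw [Set.uIoc_of_le hτ'] at hr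
    simp only [if_neg hr.1.not_ge]
  exact h1.trans h2

/-- Differentiable curves satisfy the integral equation. -/
theorem eq_add_integral_of_hasDerivWithinAt {a U : ℝ → E} {T : ℝ}
    (ha : ContinuousOn a (Set.Icc 0 T))
    (hd : ∀ t ∈ Set.Icc 0 T, HasDerivWithinAt U (a t * U t) (Set.Icc 0 T) t) {s : ℝ}
    (hs : s ∈ Set.Icc 0 T) : U s = U 0 + ∫ r in (0 : ℝ)..s, a r * U r := by
  have hUc : ContinuousOn U (Set.Icc 0 T) := fun t ht => (hd t ht).continuousWithinAt
  have hsub : Set.Icc 0 s ⊆ Set.Icc 0 T := Set.Icc_subset_Icc le_rfl hs.2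
  rw [intervalIntegral.integral_eq_sub_of_hasDeriv_right (f := U)]
  · abel
  · rw [Set.uIcc_of_le hs.1]; exact hUc.mono hsub
  · intro x hx
    rw [min_eq_left hs.1, max_eq_right hs.1] at hx
    exact ((hd x (hsub ⟨hx.1.le, hx.2.le⟩)).hasDerivAt
      (Icc_mem_nhds hx.1 (hx.2.trans_le hs.2))).hasDerivWithinAt
  · refine ContinuousOn.intervalIntegrable ?_
    rw [Set.uIcc_of_le hs.1]
    exact (ha.mul hUc).mono hsub

variable {m : ℕ}

/-- The generator `-ι (D + ∑ j, f_j C_j)` of a controlled linear equation. -/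
def generator (ι D : E) (C : Fin m → E) (f : Fin m → ℝ → ℝ) (r : ℝ) : E :=
  -(ι * (D + ∑ j, f j r • C j))

theorem intervalIntegral_const_mul' {F : ℝ → E} {s t : ℝ} (hF : IntervalIntegrable F volume s t)
    (c : E) : ∫ r in s..t, c * F r = c * ∫ r in s..t, F r :=
  (ContinuousLinearMap.mul ℝ E c).intervalIntegral_comp_comm hF

theorem intervalIntegrable_generator {E : Type*} [NormedRing E] [NormedAlgebra ℝ E] {ι D : E} {C : Fin m → E} {f : Fin m → ℝ → ℝ} {s t : ℝ}
    (hf : ∀ j, IntervalIntegrable (f j) volume s t) :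
    IntervalIntegrable (generator ι D C f) volume s t :=
  ((intervalIntegrable_const.add (intervalIntegrable_sum_smul hf)).continuousOn_mul
    continuousOn_const).neg

theorem one_sub_integral_eq {ι D : E} {C : Fin m → E} {f : Fin m → ℝ → ℝ} {U : ℝ → E} {s : ℝ}
    (hf : ∀ j, IntervalIntegrable (f j) volume 0 s) (hU : ContinuousOn U (Set.uIcc 0 s)) :
    1 - ι * ∫ r in (0 : ℝ)..s, (D + ∑ j, f j r • C j) * U r =
      1 + ∫ r in (0 : ℝ)..s, generator ι D C f r * U r := by
  have hF : IntervalIntegrable (fun r => (D + ∑ j, f j r • C j) * U r) volume 0 s :=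
    (intervalIntegrable_const.add (intervalIntegrable_sum_smul hf)).mul_continuousOn hU
  have : ∀ r, generator ι D C f r * U r = (-ι) * ((D + ∑ j, f j r • C j) * U r) := by
    intro r
    rw [generator, ← neg_mul, mul_assoc]
  simp only [this]
  rw [intervalIntegral_const_mul' hF, neg_mul, sub_eq_add_neg]

theorem integral_generator {ι D : E} {C : Fin m → E} {f : Fin m → ℝ → ℝ}
    {s t : ℝ} (hf : ∀ j, IntervalIntegrable (f j) volume s t) :
    ∫ r in s..t, generator ι D C f r =
      -((t - s) • (ι * D) + ∑ j, (∫ r in s..t, f j r) • (ι * C j)) := by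
  have h0 : ∀ j ∈ Finset.univ, IntervalIntegrable (fun r => f j r • C j) volume s t :=
    fun j _ => (hf j).smul_continuousOn continuousOn_const
  have h1 := intervalIntegrable_sum_smul (C := C) hf
  simp only [generator]
  rw [intervalIntegral.integral_neg, intervalIntegral_const_mul' (intervalIntegrable_const.add h1),
    intervalIntegral.integral_add intervalIntegrable_const h1, intervalIntegral.integral_const,
    intervalIntegral.integral_finsetSum h0, mul_add, mul_smul_comm, Finset.mul_sum]
  simp only [intervalIntegral.integral_smul_const, mul_smul_comm]

end LinearEquation

end QuantumControl

/-! ### Propagators with piecewise constant controls -/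

namespace QuantumControl

open scoped Matrix.Norms.Frobenius
open Matrix Filter Topology MeasureTheory
open NormedSpace (exp)

variable {n m : ℕ}

namespace ControlSystem

variable (S : ControlSystem n m)

/-- The propagators of total duration `t` with piecewise constant controls. -/
inductive PulseProduct : ℝ → Mat n → Prop
  | one : PulseProduct 0 1
  | step {t τ : ℝ} {u B : Mat n} (h : PulseProduct t u) (hτ : 0 < τ)
      (hB : B ∈ Submodule.span ℝ (Set.range fun j => Complex.I • S.control j)) :
      PulseProduct (t + τ) (exp (-(τ • S.iDrift + B)) * u)

variable {S}

theorem span_control_le_kAlg :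
    Submodule.span ℝ (Set.range fun j => Complex.I • S.control j) ≤ S.kAlg.toSubmodule :=
  Submodule.span_le.2 LieSubalgebra.subset_lieSpan

theorem PulseProduct.nonneg {t : ℝ} {u : Mat n} (h : S.PulseProduct t u) : 0 ≤ t := by
  induction h with
  | one => exact le_rfl
  | step _ hτ _ ih => linarith

theorem PulseProduct.exists_mem_G {t : ℝ} {u : Mat n} (h : S.PulseProduct t u) :
    ∃ g ∈ S.G, (g : Mat n) = u := by
  induction h with
  | one => exact ⟨1, S.G.one_mem, rfl⟩
  | @step t τ u B _ hτ hB ih =>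
    obtain ⟨g, hg, rfl⟩ := ih
    have hX : -(τ • S.iDrift + B) ∈ S.gAlg :=
      S.gAlg.neg_mem (S.gAlg.add_mem (S.gAlg.smul_mem _ S.iDrift_mem_gAlg)
        (S.kAlg_le_gAlg (span_control_le_kAlg hB)))
    exact ⟨suExp _ (S.gAlg_le_su hX) * g, S.G.mul_mem (exp_mem_expGroup hX rfl) hg, rfl⟩

theorem PulseProduct.mul {s t : ℝ} {u v : Mat n} (hu : S.PulseProduct s u)
    (hv : S.PulseProduct t v) : S.PulseProduct (s + t) (v * u) := by
  induction hv with
  | one => simpa using hu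
  | step _ hτ hB ih => rw [← add_assoc, mul_assoc]; exact ih.step hτ hB

/-- Left multiplication by `i`. -/
theorem I_smul_eq_mul (A : Mat n) : Complex.I • A = (Complex.I • (1 : Mat n)) * A := by
  rw [smul_mul_assoc, one_mul]

theorem generator_eq (f : Fin m → ℝ → ℝ) (r : ℝ) :
    generator (Complex.I • (1 : Mat n)) S.drift S.control f r =
      -(Complex.I • (S.drift + ∑ j, f j r • S.control j)) := by
  rw [generator, ← I_smul_eq_mul]

theorem schrodinger_iff {t : ℝ} {f : Fin m → ℝ → ℝ} {U : ℝ → Mat n}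
    (hf : ∀ j, IntervalIntegrable (f j) volume 0 t) (hU : ContinuousOn U (Set.Icc 0 t)) :
    (∀ s ∈ Set.Icc (0 : ℝ) t, U s = 1 - Complex.I •
      ∫ r in (0 : ℝ)..s, (S.drift + ∑ j, f j r • S.control j) * U r) ↔
    ∀ s ∈ Set.Icc (0 : ℝ) t, U s = 1 + ∫ r in (0 : ℝ)..s,
      generator (Complex.I • (1 : Mat n)) S.drift S.control f r * U r := by
  refine forall₂_congr fun s hs => ?_
  have hsub : Set.uIcc 0 s ⊆ Set.uIcc 0 t := by
    rw [Set.uIcc_of_le hs.1, Set.uIcc_of_le (hs.1.trans hs.2)]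
    exact Set.Icc_subset_Icc le_rfl hs.2
  have h := one_sub_integral_eq (ι := Complex.I • (1 : Mat n)) (D := S.drift) (C := S.control)
    (f := f) (U := U) (s := s) (fun j => (hf j).mono_set hsub) (hU.mono (by
      rw [Set.uIcc_of_le hs.1]; exact Set.Icc_subset_Icc le_rfl hs.2))
  rw [I_smul_eq_mul, h]

theorem PulseProduct.exists_solution {t : ℝ} {u : Mat n} (h : S.PulseProduct t u) :
    ∃ (f : Fin m → ℝ → ℝ) (U : ℝ → Mat n),
      (∀ j, IntervalIntegrable (f j) volume 0 t) ∧ ContinuousOn U (Set.Icc 0 t) ∧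
      (∀ s ∈ Set.Icc (0 : ℝ) t, U s = 1 + ∫ r in (0 : ℝ)..s,
        generator (Complex.I • (1 : Mat n)) S.drift S.control f r * U r) ∧ U t = u := by
  induction h with
  | one =>
    refine ⟨fun _ _ => 0, fun _ => 1, fun j => intervalIntegrable_const, continuousOn_const, ?_, rfl⟩
    intro s hs
    have : s = 0 := le_antisymm hs.2 hs.1
    subst this
    simp
  | @step t τ u B h hτ hB ih =>
    obtain ⟨f, U, hf, hUc, hU, rfl⟩ := ih
    obtain ⟨b, rfl⟩ := (Submodule.mem_span_range_iff_exists_fun ℝ).1 hB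
    -- Amplitudes `b j / τ` held for time `τ` integrate to `b j`; this is why pulses have positive
    -- duration.
    let X : Mat n := generator (Complex.I • (1 : Mat n)) S.drift S.control (fun j _ => b j / τ) 0
    obtain ⟨V, hVc, hV, hVt⟩ := exists_solution_append h.nonneg hτ.le
      (intervalIntegrable_generator hf) hUc hU X
    refine ⟨fun j r => if r ≤ t then f j r else b j / τ, V,
      fun j => intervalIntegrable_ite h.nonneg hτ.le (hf j) _, hVc, fun s hs => ?_, ?_⟩
    · rw [hV s hs]
      congr 1
      refine intervalIntegral.integral_congr fun r _ => ?_
      simp only [X, generator]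
      split_ifs <;> rfl
    · rw [hVt]
      congr 2
      simp only [X, generator_eq]
      rw [smul_neg, smul_add, smul_add, smul_comm τ Complex.I]
      congr 2
      · exact smul_comm _ _ _
      rw [Finset.smul_sum, Finset.smul_sum]
      refine Finset.sum_congr rfl fun j _ => ?_
      rw [smul_comm Complex.I (b j / τ), smul_smul, mul_div_cancel₀ _ hτ.ne']

theorem PulseProduct.mem_reachableWithin {t T : ℝ} {u : SU n} (h : S.PulseProduct t (u : Mat n))
    (hT : t ≤ T) : u ∈ S.reachableWithin T := by
  obtain ⟨f, U, hf, hUc, hU, hUt⟩ := h.exists_solution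
  exact ⟨t, ⟨h.nonneg, hT⟩, f, U, hf, hUc, (schrodinger_iff hf hUc).2 hU, hUt⟩

theorem norm_exp_mul_of_mem_su {X : Mat n} (hX : X ∈ su n) (Z : Mat n) : ‖exp X * Z‖ = ‖Z‖ :=
  SU.norm_mul (suExp X hX) Z

/-- Reachable unitaries are limits of piecewise constant propagators. -/
theorem exists_pulseProduct_near {T : ℝ} {u : SU n} (hu : u ∈ S.reachableWithin T) {ε : ℝ}
    (hε : 0 < ε) : ∃ t ≤ T, ∃ v, S.PulseProduct t v ∧ ‖v - (u : Mat n)‖ ≤ ε := by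
  obtain ⟨t, ht, f, U, hf, hUc, hU, hUt⟩ := hu
  rw [schrodinger_iff hf hUc] at hU
  have hU0 : U 0 = 1 := by simpa using hU 0 ⟨le_rfl, ht.1⟩
  rcases ht.1.eq_or_lt with h0 | h0
  · subst h0
    exact ⟨0, ht.2, 1, .one, by rw [← hUt, hU0, sub_self, norm_zero]; exact hε.le⟩
  set a : ℝ → Mat n := generator (Complex.I • (1 : Mat n)) S.drift S.control f with ha_def
  have ha := intervalIntegrable_generator (ι := Complex.I • (1 : Mat n)) (D := S.drift)
    (C := S.control) hf
  rw [← ha_def] at ha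
  obtain ⟨N, hN, hprod⟩ := exists_partition_norm_prod_exp_sub_le ht.1 ha ha.norm
    (fun r _ => le_rfl) hUc (fun s hs => by rw [hU0]; exact hU s hs) hε
  have hNR : (0 : ℝ) < N := by exact_mod_cast hN
  have hmono : ∀ i : ℕ, t * (i / N) ≤ t * ((i + 1 : ℕ) / N) := fun i => by
    push_cast; gcongr; linarith
  let B : ℕ → Mat n := fun i =>
    ∑ j, (∫ r in (t * (i / N))..(t * ((i + 1 : ℕ) / N)), f j r) • (Complex.I • S.control j)
  let X : ℕ → Mat n := fun i => -((t / N) • S.iDrift + B i)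
  have hB : ∀ i, B i ∈ Submodule.span ℝ (Set.range fun j => Complex.I • S.control j) := fun i =>
    Submodule.sum_mem _ fun j _ => Submodule.smul_mem _ _ (Submodule.subset_span ⟨j, rfl⟩)
  have hXint : ∀ i < N, X i = ∫ r in (t * (i / N))..(t * ((i + 1 : ℕ) / N)), a r := by
    intro i hi
    have hi' : ((i + 1 : ℕ) : ℝ) / N ≤ 1 := by
      rw [div_le_one hNR]; exact_mod_cast hi
    have hsub : Set.uIcc (t * (i / N)) (t * ((i + 1 : ℕ) / N)) ⊆ Set.uIcc 0 t := by
      rw [Set.uIcc_of_le (hmono i), Set.uIcc_of_le ht.1]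
      exact Set.Icc_subset_Icc (mul_nonneg ht.1 (by positivity)) (mul_le_of_le_one_right ht.1 hi')
    have h1 := integral_generator (ι := Complex.I • (1 : Mat n)) (D := S.drift) (C := S.control)
      (fun j => (hf j).mono_set hsub)
    rw [ha_def, h1, ← I_smul_eq_mul]
    simp only [← I_smul_eq_mul]
    have h2 : t * ((i + 1 : ℕ) / N) - t * (i / N) = t / N := by push_cast; ring
    rw [h2]
    rfl
  have hXsu : ∀ i, X i ∈ su n := fun i => S.gAlg_le_su (S.gAlg.neg_mem (S.gAlg.add_mem
    (S.gAlg.smul_mem _ S.iDrift_mem_gAlg) (S.kAlg_le_gAlg (span_control_le_kAlg (hB i)))))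
  let W : ℕ → Mat n := fun i => Nat.rec 1 (fun i w => exp (X i) * w) i
  have hW : ∀ i : ℕ, S.PulseProduct (i * (t / N)) (W i) := by
    intro i
    induction i with
    | zero => rw [Nat.cast_zero, zero_mul]; exact PulseProduct.one
    | succ i ih =>
      have := ih.step (div_pos h0 hNR) (hB i)
      push_cast
      rw [add_mul, one_mul]
      exact this
  have hb0 : ∀ i : ℕ, 0 ≤ ∫ r in (t * (i / N))..(t * ((i + 1 : ℕ) / N)), ‖a r‖ := fun i =>
    intervalIntegral.integral_nonneg (hmono i) fun _ _ => norm_nonneg _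
  refine ⟨t, ht.2, W N, ?_, ?_⟩
  · have := hW N
    rwa [mul_div_cancel₀ _ hNR.ne'] at this
  · rw [← hUt]
    -- The two-factor estimate is used with a trivial second factor.
    refine hprod X (fun _ => 0) W (fun i hi => by rw [add_zero]; exact hXint i hi) (fun i hi => ?_)
      (fun i _ => by rw [norm_zero]; exact hb0 i) (fun i _ Z => ?_) hU0.symm (fun i _ => ?_)
    · rw [hXint i hi]
      exact intervalIntegral.norm_integral_le_integral_norm (hmono i)
    · rw [NormedSpace.exp_zero, mul_one]
      exact (norm_exp_mul_of_mem_su (hXsu i) Z).le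
    · rw [NormedSpace.exp_zero, mul_one]
      rfl

end ControlSystem

end QuantumControl

/-! ### Curves in multiplicative families of sets -/

namespace QuantumControl

open Filter Topology MeasureTheory
open NormedSpace (exp)

section MultiplicativeFamily

variable {E : Type*} [NormedRing E] [NormedAlgebra ℝ E] [CompleteSpace E]

/-- A linear projection onto `V` fixes the integrand and commutes with the integral. -/
theorem intervalIntegral_mem [FiniteDimensional ℝ E] {V : Submodule ℝ E} {f : ℝ → E} {s t : ℝ}
    (hf : IntervalIntegrable f volume s t) (hV : ∀ r ∈ Set.uIcc s t, f r ∈ V) :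
    ∫ r in s..t, f r ∈ V := by
  obtain ⟨g, hg⟩ := V.subtype.exists_leftInverse_of_injective V.ker_subtype
  let L : E →L[ℝ] E := LinearMap.toContinuousLinearMap (V.subtype ∘ₗ g)
  have hL : ∀ x ∈ V, L x = x := fun x hx =>
    congrArg Subtype.val (LinearMap.congr_fun hg ⟨x, hx⟩)
  have h1 : ∫ r in s..t, L (f r) = ∫ r in s..t, f r :=
    intervalIntegral.integral_congr fun r hr => hL _ (hV r hr)
  rw [← h1, L.intervalIntegral_comp_comm hf]
  exact (g _).2

/-- A curve with velocity `(Y + Z) U` stays in a multiplicative closed family of sets containing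
the exponentials of the integrals of `Y` and `Z`. -/
theorem mem_of_hasDerivWithinAt_mul {R : ℝ → Set E} {Y Z U : ℝ → E} {κ : ℝ}
    (hR : ∀ t, IsClosed (R t))
    (hmul : ∀ s t u v, u ∈ R s → v ∈ R t → v * u ∈ R (s + t))
    (hY : ContinuousOn Y (Set.Icc 0 1)) (hZ : ContinuousOn Z (Set.Icc 0 1))
    (hd : ∀ t ∈ Set.Icc (0 : ℝ) 1, HasDerivWithinAt U ((Y t + Z t) * U t) (Set.Icc 0 1) t)
    (hYR : ∀ s t, 0 ≤ s → s ≤ t → t ≤ 1 →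
      exp (∫ r in s..t, Y r) ∈ R (κ * ∫ r in s..t, ‖Y r‖))
    (hZR : ∀ s t, 0 ≤ s → s ≤ t → t ≤ 1 → exp (∫ r in s..t, Z r) ∈ R 0)
    (hY1 : ∀ s t, 0 ≤ s → s ≤ t → t ≤ 1 → ∀ V, ‖exp (∫ r in s..t, Y r) * V‖ ≤ ‖V‖)
    (hZ1 : ∀ s t, 0 ≤ s → s ≤ t → t ≤ 1 → ∀ V, ‖exp (∫ r in s..t, Z r) * V‖ ≤ ‖V‖)
    (h0 : U 0 ∈ R 0) : U 1 ∈ R (κ * ∫ r in (0 : ℝ)..1, ‖Y r‖) := by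
  have hUc : ContinuousOn U (Set.Icc 0 1) := fun t ht => (hd t ht).continuousWithinAt
  have hsub : ∀ s t : ℝ, 0 ≤ s → s ≤ t → t ≤ 1 → Set.uIcc s t ⊆ Set.Icc 0 1 := by
    intro s t hs hst ht
    rw [Set.uIcc_of_le hst]
    exact Set.Icc_subset_Icc hs ht
  have hYi : ∀ s t, 0 ≤ s → s ≤ t → t ≤ 1 → IntervalIntegrable Y volume s t :=
    fun s t hs hst ht => (hY.mono (hsub s t hs hst ht)).intervalIntegrable
  have hZi : ∀ s t, 0 ≤ s → s ≤ t → t ≤ 1 → IntervalIntegrable Z volume s t :=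
    fun s t hs hst ht => (hZ.mono (hsub s t hs hst ht)).intervalIntegrable
  have h01 := (zero_le_one : (0 : ℝ) ≤ 1)
  refine (hR _).closure_subset (Metric.mem_closure_iff.2 fun ε hε => ?_)
  have hYZ : IntervalIntegrable (fun r => ‖Y r‖ + ‖Z r‖) volume 0 1 :=
    (hYi 0 1 le_rfl h01 le_rfl).norm.add (hZi 0 1 le_rfl h01 le_rfl).norm
  -- The bound `‖Y‖ + ‖Z‖` dominates both the sum and each summand, so the exponentials of the two
  -- integrals can be taken separately.
  obtain ⟨N, hN, hprod⟩ := exists_partition_norm_prod_exp_sub_le (a := fun r => Y r + Z r)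
    (U := U) h01 ((hYi 0 1 le_rfl h01 le_rfl).add (hZi 0 1 le_rfl h01 le_rfl)) hYZ
    (fun r _ => norm_add_le _ _) hUc
    (fun s hs => eq_add_integral_of_hasDerivWithinAt (hY.add hZ) hd hs) (half_pos hε)
  simp only [one_mul] at hprod
  have hNR : (0 : ℝ) < N := by exact_mod_cast hN
  have ha0 : ∀ i : ℕ, (0 : ℝ) ≤ i / N := fun i => by positivity
  have hab : ∀ i : ℕ, (i : ℝ) / N ≤ (i + 1 : ℕ) / N := fun i => by push_cast; gcongr; linarith
  have hb1 : ∀ i < N, ((i + 1 : ℕ) : ℝ) / N ≤ 1 := fun i hi => by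
    rw [div_le_one hNR]; exact_mod_cast hi
  let X : ℕ → E := fun i => ∫ r in (i / N : ℝ)..((i + 1 : ℕ) / N), Y r
  let X' : ℕ → E := fun i => ∫ r in (i / N : ℝ)..((i + 1 : ℕ) / N), Z r
  let W : ℕ → E := fun i => Nat.rec (U 0) (fun i w => exp (X i) * exp (X' i) * w) i
  have hW : ∀ i ≤ N, W i ∈ R (κ * ∫ r in (0 : ℝ)..(i / N), ‖Y r‖) := by
    intro i
    induction i with
    | zero =>
      intro _
      rw [Nat.cast_zero, zero_div, intervalIntegral.integral_same, mul_zero]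
      exact h0
    | succ i ih =>
      intro hi
      have h1 := ih (Nat.le_of_succ_le hi)
      -- Each step costs `κ ∫ ‖Y‖`; the `Z` factor is free.
      have h2 := hmul _ _ _ _ (hmul _ _ _ _ h1 (hZR _ _ (ha0 i) (hab i) (hb1 i hi)))
        (hYR _ _ (ha0 i) (hab i) (hb1 i hi))
      rw [add_zero, ← mul_add, intervalIntegral.integral_add_adjacent_intervals
        (hYi _ _ le_rfl (ha0 i) ((hab i).trans (hb1 i hi))).norm
        (hYi _ _ (ha0 i) (hab i) (hb1 i hi)).norm, ← mul_assoc] at h2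
      exact h2
  have hsum : ∀ i < N, IntervalIntegrable (fun r => ‖Y r‖ + ‖Z r‖) volume (i / N : ℝ)
      ((i + 1 : ℕ) / N) := fun i hi => (hYi _ _ (ha0 i) (hab i) (hb1 i hi)).norm.add
        (hZi _ _ (ha0 i) (hab i) (hb1 i hi)).norm
  refine ⟨W N, ?_, ?_⟩
  · have := hW N le_rfl
    rwa [div_self hNR.ne'] at this
  · rw [dist_comm, dist_eq_norm]
    refine lt_of_le_of_lt (hprod X X' W (fun i hi => ?_) (fun i hi => ?_) (fun i hi => ?_)
      (fun i hi V => ?_) rfl (fun i _ => rfl)) (half_lt_self hε)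
    · exact (intervalIntegral.integral_add (hYi _ _ (ha0 i) (hab i) (hb1 i hi))
        (hZi _ _ (ha0 i) (hab i) (hb1 i hi))).symm
    · exact (intervalIntegral.norm_integral_le_integral_norm (hab i)).trans
        (intervalIntegral.integral_mono_on (hab i) (hYi _ _ (ha0 i) (hab i) (hb1 i hi)).norm
          (hsum i hi) fun r _ => le_add_of_nonneg_right (norm_nonneg _))
    · exact (intervalIntegral.norm_integral_le_integral_norm (hab i)).trans
        (intervalIntegral.integral_mono_on (hab i) (hZi _ _ (ha0 i) (hab i) (hb1 i hi)).norm
          (hsum i hi) fun r _ => le_add_of_nonneg_left (norm_nonneg _))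
    · rw [mul_assoc]
      exact (hY1 _ _ (ha0 i) (hab i) (hb1 i hi) _).trans (hZ1 _ _ (ha0 i) (hab i) (hb1 i hi) _)

/-- Trotter's formula, for membership in a closed set stable under products. -/
theorem exp_add_mem {R : Set E} (hR : IsClosed R) (h1 : 1 ∈ R)
    (hmul : ∀ u v, u ∈ R → v ∈ R → v * u ∈ R) {A B : E}
    (hA : ∀ t : ℝ, exp (t • A) ∈ R) (hB : ∀ t : ℝ, exp (t • B) ∈ R)
    (hA1 : ∀ t : ℝ, ∀ V, ‖exp (t • A) * V‖ ≤ ‖V‖) (hB1 : ∀ t : ℝ, ∀ V, ‖exp (t • B) * V‖ ≤ ‖V‖) :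
    exp (A + B) ∈ R := by
  have h := mem_of_hasDerivWithinAt_mul (R := fun _ => R) (Y := fun _ => A) (Z := fun _ => B)
    (U := fun s => exp (s • (A + B))) (κ := 0) (fun _ => hR)
    (fun _ _ u v hu hv => hmul u v hu hv) continuousOn_const continuousOn_const
    (fun t _ => (hasDerivAt_exp_smul_const' (𝕂 := ℝ) (A + B) t).hasDerivWithinAt)
    (fun s t _ _ _ => by rw [intervalIntegral.integral_const]; exact hA _)
    (fun s t _ _ _ => by rw [intervalIntegral.integral_const]; exact hB _)
    (fun s t _ _ _ => by rw [intervalIntegral.integral_const]; exact hA1 _)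
    (fun s t _ _ _ => by rw [intervalIntegral.integral_const]; exact hB1 _)
    (by simpa using h1)
  simpa using h

end MultiplicativeFamily

end QuantumControl

/-! ### Closures of the reachable sets -/

namespace QuantumControl

open scoped Matrix.Norms.Frobenius
open Matrix Filter Topology MeasureTheory
open NormedSpace (exp)

variable {n m : ℕ}

theorem mem_of_curve_mul {R : ℝ → Set (Mat n)} {Y Z U : ℝ → Mat n} {κ : ℝ}
    (hR : ∀ t, IsClosed (R t))
    (hmul : ∀ s t u v, u ∈ R s → v ∈ R t → v * u ∈ R (s + t)) {V₁ V₂ : Submodule ℝ (Mat n)}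
    (h₁ : V₁ ≤ (su n).toSubmodule) (h₂ : V₂ ≤ (su n).toSubmodule)
    (hY : ContinuousOn Y (Set.Icc 0 1)) (hZ : ContinuousOn Z (Set.Icc 0 1))
    (hYV : ∀ t ∈ Set.Icc (0 : ℝ) 1, Y t ∈ V₁) (hZV : ∀ t ∈ Set.Icc (0 : ℝ) 1, Z t ∈ V₂)
    (hd : ∀ t ∈ Set.Icc (0 : ℝ) 1, HasDerivWithinAt U ((Y t + Z t) * U t) (Set.Icc 0 1) t)
    (hmono : ∀ s t, s ≤ t → R s ⊆ R t) (hκ : 0 ≤ κ)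
    (hYR : ∀ X ∈ V₁, exp X ∈ R (κ * ‖X‖)) (hZR : ∀ X ∈ V₂, exp X ∈ R 0)
    (h0 : U 0 ∈ R 0) : U 1 ∈ R (κ * ∫ r in (0 : ℝ)..1, ‖Y r‖) := by
  have hsub : ∀ s t : ℝ, 0 ≤ s → s ≤ t → t ≤ 1 → Set.uIcc s t ⊆ Set.Icc 0 1 := by
    intro s t hs hst ht
    rw [Set.uIcc_of_le hst]
    exact Set.Icc_subset_Icc hs ht
  have hYm : ∀ s t : ℝ, 0 ≤ s → s ≤ t → t ≤ 1 → ∫ r in s..t, Y r ∈ V₁ := fun s t hs hst ht =>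
    intervalIntegral_mem (hY.mono (hsub s t hs hst ht)).intervalIntegrable
      fun r hr => hYV r (hsub s t hs hst ht hr)
  have hZm : ∀ s t : ℝ, 0 ≤ s → s ≤ t → t ≤ 1 → ∫ r in s..t, Z r ∈ V₂ := fun s t hs hst ht =>
    intervalIntegral_mem (hZ.mono (hsub s t hs hst ht)).intervalIntegrable
      fun r hr => hZV r (hsub s t hs hst ht hr)
  refine mem_of_hasDerivWithinAt_mul hR hmul hY hZ hd (fun s t hs hst ht => ?_)
    (fun s t hs hst ht => hZR _ (hZm s t hs hst ht))
    (fun s t hs hst ht V => (ControlSystem.norm_exp_mul_of_mem_su (h₁ (hYm s t hs hst ht)) V).le)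
    (fun s t hs hst ht V => (ControlSystem.norm_exp_mul_of_mem_su (h₂ (hZm s t hs hst ht)) V).le) h0
  exact hmono _ _ (mul_le_mul_of_nonneg_left
    (intervalIntegral.norm_integral_le_integral_norm hst) hκ) (hYR _ (hYm s t hs hst ht))

theorem SU.exp_conj (u : SU n) (A : Mat n) :
    exp ((u : Mat n) * A * ((u⁻¹ : SU n) : Mat n)) =
      (u : Mat n) * exp A * ((u⁻¹ : SU n) : Mat n) := by
  have h := exp_unitary_conj ⟨u, (mem_specialUnitaryGroup_iff.1 u.2).1⟩ A
  rw [star_eq_conjTranspose] at h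
  rw [SU.coe_inv]
  exact h

namespace ControlSystem

variable (S : ControlSystem n m)

/-- The limits of propagators of duration essentially at most `t`. -/
def limitReach (t : ℝ) : Set (Mat n) :=
  {u | ∀ ε > 0, u ∈ closure {v | ∃ s ≤ t + ε, S.PulseProduct s v}}

theorem isClosed_limitReach (t : ℝ) : IsClosed (S.limitReach t) := by
  have : S.limitReach t = ⋂ ε > 0, closure {v | ∃ s ≤ t + ε, S.PulseProduct s v} := by
    ext; simp [limitReach]
  rw [this]
  exact isClosed_biInter fun _ _ => isClosed_closure

theorem limitReach_mono {s t : ℝ} (h : s ≤ t) : S.limitReach s ⊆ S.limitReach t :=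
  fun _ hu ε hε => closure_mono
    (Set.ofPred_subset_ofPred.2 fun _ ⟨r, hr, hv⟩ => ⟨r, by linarith, hv⟩) (hu ε hε)

variable {S}

theorem PulseProduct.mem_limitReach {t : ℝ} {u : Mat n} (h : S.PulseProduct t u) :
    u ∈ S.limitReach t :=
  fun ε hε => subset_closure ⟨t, by linarith, h⟩

theorem mul_mem_limitReach {s t : ℝ} {u v : Mat n} (hu : u ∈ S.limitReach s)
    (hv : v ∈ S.limitReach t) : v * u ∈ S.limitReach (s + t) := by
  intro ε hε
  refine map_mem_closure₂ (f := fun v u : Mat n => v * u) (continuous_fst.mul continuous_snd)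
    (hv (ε / 2) (half_pos hε)) (hu (ε / 2) (half_pos hε)) ?_
  rintro v ⟨b, hb, hv⟩ u ⟨a, ha, hu⟩
  exact ⟨a + b, by linarith, hu.mul hv⟩

theorem mul_mem_limitReach_zero {u v : Mat n} (hu : u ∈ S.limitReach 0)
    (hv : v ∈ S.limitReach 0) : v * u ∈ S.limitReach 0 := by
  have := mul_mem_limitReach hu hv
  rwa [add_zero] at this

theorem exp_neg_smul_iDrift_mem_limitReach {τ : ℝ} (hτ : 0 < τ) :
    exp (-(τ • S.iDrift)) ∈ S.limitReach τ := by
  have := (PulseProduct.one.step hτ (Submodule.zero_mem _) : S.PulseProduct _ _).mem_limitReach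
  rwa [zero_add, add_zero, mul_one] at this

/-- A pulse of fixed integrated control and duration tending to `0` makes the drift negligible. -/
theorem exp_mem_limitReach_of_mem_span {B : Mat n}
    (hB : B ∈ Submodule.span ℝ (Set.range fun j => Complex.I • S.control j)) :
    exp B ∈ S.limitReach 0 := by
  intro ε hε
  have hc : Continuous fun τ : ℝ => exp (-(τ • S.iDrift + -B)) :=
    continuous_exp_mat.comp (((continuous_id.smul continuous_const).add continuous_const).neg)
  have ht : Tendsto (fun τ : ℝ => exp (-(τ • S.iDrift + -B))) (𝓝[>] 0) (𝓝 (exp B)) := by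
    have := (hc.tendsto 0).mono_left (nhdsWithin_le_nhds (s := Set.Ioi 0))
    simpa using this
  refine mem_closure_of_tendsto ht ?_
  filter_upwards [Ioo_mem_nhdsGT hε] with τ hτ
  refine ⟨0 + τ, by linarith [hτ.2], ?_⟩
  have := (PulseProduct.one.step hτ.1 (Submodule.neg_mem _ hB) : S.PulseProduct _ _)
  rwa [mul_one] at this

theorem one_mem_limitReach_zero : (1 : Mat n) ∈ S.limitReach 0 :=
  PulseProduct.one.mem_limitReach

variable (S) in
/-- The elements of `𝔰𝔲(n)` whose one-parameter groups can be generated in arbitrarily short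
time. -/
def instantAlg : LieSubalgebra ℝ (Mat n) :=
  let V : Submodule ℝ (Mat n) :=
    { carrier := {A | A ∈ su n ∧ ∀ t : ℝ, exp (t • A) ∈ S.limitReach 0}
      zero_mem' := ⟨(su n).zero_mem, fun t => by
        rw [smul_zero, NormedSpace.exp_zero]; exact one_mem_limitReach_zero⟩
      add_mem' := by
        rintro A B ⟨hA, hA'⟩ ⟨hB, hB'⟩
        refine ⟨(su n).add_mem hA hB, fun t => ?_⟩
        rw [smul_add]
        refine exp_add_mem (S.isClosed_limitReach 0) one_mem_limitReach_zero
          (fun u v => mul_mem_limitReach_zero) (fun s => ?_) (fun s => ?_)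
          (fun s V => (norm_exp_mul_of_mem_su ((su n).smul_mem s ((su n).smul_mem t hA)) V).le)
          (fun s V => (norm_exp_mul_of_mem_su ((su n).smul_mem s ((su n).smul_mem t hB)) V).le)
        · rw [smul_smul]; exact hA' _
        · rw [smul_smul]; exact hB' _
      smul_mem' := by
        rintro c A ⟨hA, hA'⟩
        exact ⟨(su n).smul_mem c hA, fun t => by rw [smul_smul]; exact hA' _⟩ }
  { V with
    lie_mem' := by
      intro A B hA hB
      -- Conjugates of `B` by `exp (s A)` again have instantly reachable one-parameter groups, and
      -- the bracket is their velocity at `s = 0`.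
      refine mem_of_hasDerivAt (V := V) (hasDerivAt_exp_smul_conj B A) fun s => ?_
      have hs : s • A ∈ su n := (su n).smul_mem s hA.1
      have hinv : (((suExp (s • A) hs)⁻¹ : SU n) : Mat n) = exp (s • -A) := by
        rw [smul_neg]; exact coe_inv_of_coe_eq_exp rfl
      refine ⟨?_, fun t => ?_⟩
      · have := exp_conj_mem (V := (su n).toSubmodule) (A := s • A) (B := B)
          (fun C hC => (su n).lie_mem hs hC) hB.1
        rwa [smul_neg]
      · have h1 := SU.exp_conj (suExp (s • A) hs) (t • B)
        rw [hinv] at h1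
        have h2 : t • (exp (s • A) * B * exp (s • -A)) =
            (suExp (s • A) hs : Mat n) * (t • B) * exp (s • -A) := by
          rw [mul_smul_comm, smul_mul_assoc]; rfl
        refine Set.mem_of_eq_of_mem ((congrArg exp h2).trans (h1.trans (mul_assoc _ _ _))) ?_
        refine mul_mem_limitReach_zero (mul_mem_limitReach_zero ?_ (hB.2 t)) (hA.2 s)
        have := hA.2 (-s)
        rwa [neg_smul, ← smul_neg] at this }

/-- The generators `i H_j` belong to a Lie algebra of instantly reachable directions, hence so does
all of `𝔨`. -/
theorem kAlg_le_instantAlg : S.kAlg ≤ S.instantAlg := by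
  refine LieSubalgebra.lieSpan_le.2 ?_
  rintro _ ⟨j, rfl⟩
  refine ⟨S.kAlg_le_su (LieSubalgebra.subset_lieSpan ⟨j, rfl⟩), fun t => ?_⟩
  exact exp_mem_limitReach_of_mem_span (Submodule.smul_mem _ t (Submodule.subset_span ⟨j, rfl⟩))

theorem exp_mem_limitReach_of_mem_kAlg {A : Mat n} (hA : A ∈ S.kAlg) :
    exp A ∈ S.limitReach 0 := by
  have := (kAlg_le_instantAlg hA).2 1
  rwa [one_smul] at this

theorem mem_limitReach_of_mem_K {k : SU n} (hk : k ∈ S.K) : (k : Mat n) ∈ S.limitReach 0 :=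
  expGroup_induction (p := fun k => (k : Mat n) ∈ S.limitReach 0) one_mem_limitReach_zero
    (fun u v A hA hu hv => mul_mem_limitReach_zero hv
      (by rw [hu]; exact exp_mem_limitReach_of_mem_kAlg hA)) hk

/-- Some `k ∈ K` conjugates the drift to the direction of `P`. Then `exp P` is free evolution framed
by `k` and its inverse, which cost no time. -/
theorem exp_mem_limitReach_of_mem_pSpace (h : S.drift ≠ 0)
    (hs : S.driftSphere ⊆ S.adjointOrbit S.iDrift) {P : Mat n} (hP : P ∈ S.pSpace) :
    exp P ∈ S.limitReach (‖S.iDrift‖⁻¹ * ‖P‖) := by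
  have hD : 0 < ‖S.iDrift‖ := norm_pos_iff.2 (S.iDrift_ne_zero h)
  by_cases h0 : P = 0
  · rw [h0, norm_zero, mul_zero, NormedSpace.exp_zero]
    exact one_mem_limitReach_zero
  have hP0 : 0 < ‖P‖ := norm_pos_iff.2 h0
  -- The minus sign matches the drift propagator `exp(-τ iH_d)`.
  have hmem : -(‖S.iDrift‖ / ‖P‖) • P ∈ S.driftSphere := by
    refine S.mem_driftSphere_iff.2 ⟨S.pSpace.smul_mem _ hP, ?_⟩
    rw [norm_smul, norm_neg, norm_div, norm_norm, norm_norm, div_mul_cancel₀ _ hP0.ne']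
  obtain ⟨k, hk, hkP⟩ := hs hmem
  set τ := ‖S.iDrift‖⁻¹ * ‖P‖ with hτ_def
  have hτ : 0 < τ := by positivity
  have hP' : P = ((k⁻¹ : SU n) : Mat n) * -(τ • S.iDrift) * (((k⁻¹)⁻¹ : SU n) : Mat n) := by
    rw [inv_inv, mul_neg, neg_mul, mul_smul_comm, smul_mul_assoc, ← hkP, neg_smul, smul_neg,
      neg_neg, smul_smul, hτ_def]
    have : ‖S.iDrift‖⁻¹ * ‖P‖ * (‖S.iDrift‖ / ‖P‖) = 1 := by field_simp
    rw [this, one_smul]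
  rw [hP', SU.exp_conj, mul_assoc, inv_inv]
  have := mul_mem_limitReach (mul_mem_limitReach (mem_limitReach_of_mem_K hk)
    (exp_neg_smul_iDrift_mem_limitReach hτ)) (mem_limitReach_of_mem_K (S.K.inv_mem hk))
  rwa [zero_add, add_zero] at this

theorem LiftedCurve.mem_limitReach (h : S.drift ≠ 0)
    (hs : S.driftSphere ⊆ S.adjointOrbit S.iDrift) (c : S.LiftedCurve) (h0 : (c.g 0 : SU n) ∈ S.K) :
    (((c.g 1 : SU n) : Mat n)) ∈
      S.limitReach (‖S.iDrift‖⁻¹ * ∫ r in (0 : ℝ)..1, ‖c.Y r‖) :=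
  mem_of_curve_mul (R := S.limitReach) (Y := c.Y) (Z := c.Z)
    (U := fun s => ((c.g s : SU n) : Mat n)) (fun t => S.isClosed_limitReach t)
    (fun _ _ _ _ => mul_mem_limitReach) (V₁ := S.pSpace) (V₂ := S.kAlg.toSubmodule)
    (fun _ hX => S.gAlg_le_su hX.1) S.kAlg_le_su c.Y_continuousOn c.Z_continuousOn c.Y_mem c.Z_mem
    c.hasDeriv (fun _ _ => S.limitReach_mono) (inv_nonneg.2 (norm_nonneg _))
    (fun _ => exp_mem_limitReach_of_mem_pSpace h hs) (fun _ => exp_mem_limitReach_of_mem_kAlg)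
    (mem_limitReach_of_mem_K h0)

end ControlSystem

end QuantumControl

/-! ### The upper bound for the speed limit -/

namespace QuantumControl

open scoped Matrix.Norms.Frobenius
open Matrix Filter Topology MeasureTheory
open NormedSpace (exp)

variable {n m : ℕ}

namespace ControlSystem

variable {S : ControlSystem n m}

theorem driftSpeed_eq : S.driftSpeed = Real.sqrt (2 * n) * ‖S.iDrift‖ := by
  rw [← killingNorm_eq (S.skew_of_mem_gAlg S.iDrift_mem_gAlg), driftSpeed, killingNorm, killing,
    iDrift, smul_mul_smul_comm, Complex.I_mul_I, trace_smul, smul_eq_mul, ← mul_assoc]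
  congr 1
  have : (-2 * (n : ℂ) * -1) * (S.drift * S.drift).trace =
      ((2 * n : ℝ) : ℂ) * (S.drift * S.drift).trace := by push_cast; ring
  rw [this, Complex.re_ofReal_mul]

theorem sqrt_two_mul_pos (h : S.drift ≠ 0) : 0 < Real.sqrt (2 * n) := by
  rcases Nat.eq_zero_or_pos n with rfl | hn
  · exact absurd (Subsingleton.elim S.drift 0) h
  · positivity

theorem driftSpeed_pos (h : S.drift ≠ 0) : 0 < S.driftSpeed := by
  rw [driftSpeed_eq]
  exact mul_pos (sqrt_two_mul_pos h) (norm_pos_iff.2 (S.iDrift_ne_zero h))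

theorem LiftedCurve.length_eq (c : S.LiftedCurve) :
    c.length = Real.sqrt (2 * n) * ∫ t in (0 : ℝ)..1, ‖c.Y t‖ := by
  rw [LiftedCurve.length, ← intervalIntegral.integral_const_mul]
  refine intervalIntegral.integral_congr fun t ht => ?_
  rw [Set.uIcc_of_le zero_le_one] at ht
  exact killingNorm_eq (S.skew_of_mem_gAlg (c.Y_mem t ht).1)

theorem quotient_mk_eq_iff {g h : S.G} :
    (Quotient.mk _ g : S.QuotientSpace) = Quotient.mk _ h ↔ ((h : SU n) * (g : SU n)⁻¹) ∈ S.K := by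
  rw [Quotient.eq, QuotientGroup.rightRel_apply]
  rfl

/-- A curve in `G/K` from the base point to `[g]`, shorter than `T` times the speed, ends at `g` up
to an element of `K`, which is free at both ends. -/
theorem G_subset_closure_reachableWithin (h : S.drift ≠ 0)
    (hs : S.driftSphere ⊆ S.adjointOrbit S.iDrift) {T : ℝ}
    (hT : S.quotientDiam < ENNReal.ofReal (T * S.driftSpeed)) :
    (S.G : Set (SU n)) ⊆ closure (S.reachableWithin T) := by
  intro g hg
  have h1 : S.quotientDist (Quotient.mk _ 1) (Quotient.mk _ ⟨g, hg⟩) <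
      ENNReal.ofReal (T * S.driftSpeed) :=
    (le_iSup₂ (f := fun x y => S.quotientDist x y) _ _).trans_lt hT
  simp only [quotientDist, iInf_lt_iff] at h1
  obtain ⟨c, h0, h1, hc⟩ := h1
  rw [quotient_mk_eq_iff] at h1
  have h0' : (c.g 0 : SU n) ∈ S.K := by
    have := quotient_mk_eq_iff.1 h0.symm
    simpa using this
  have hlen : c.length < T * S.driftSpeed :=
    (ENNReal.ofReal_lt_ofReal_iff_of_nonneg (by
      rw [c.length_eq]
      exact mul_nonneg (Real.sqrt_nonneg _)
        (intervalIntegral.integral_nonneg zero_le_one fun _ _ => norm_nonneg _))).1 hc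
  have hD : 0 < ‖S.iDrift‖ := norm_pos_iff.2 (S.iDrift_ne_zero h)
  set t := ‖S.iDrift‖⁻¹ * ∫ r in (0 : ℝ)..1, ‖c.Y r‖ with ht
  have htT : t < T := by
    rw [c.length_eq, driftSpeed_eq, mul_left_comm] at hlen
    have := lt_of_mul_lt_mul_left hlen (Real.sqrt_nonneg _)
    rw [ht, inv_mul_lt_iff₀ hD, mul_comm]
    exact this
  have hmem := mul_mem_limitReach (c.mem_limitReach h hs h0') (mem_limitReach_of_mem_K h1)
  have hg' : (((g * (c.g 1 : SU n)⁻¹ : SU n) : Mat n)) * ((c.g 1 : SU n) : Mat n) = (g : Mat n) := by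
    rw [Submonoid.coe_mul, mul_assoc, SU.inv_mul, mul_one]
  rw [hg', ← ht, add_zero] at hmem
  rw [closure_subtype]
  -- The slack `T - t` absorbs the extra duration allowed in `limitReach`.
  refine closure_mono ?_ (hmem (T - t) (sub_pos.2 htT))
  rintro v ⟨s, hs, hv⟩
  obtain ⟨u, -, rfl⟩ := hv.exists_mem_G
  exact ⟨u, hv.mem_reachableWithin (by linarith), rfl⟩

theorem speedLimit_le (h : S.drift ≠ 0) (hs : S.driftSphere ⊆ S.adjointOrbit S.iDrift) :
    S.speedLimit ≤ S.quotientDiam / ENNReal.ofReal S.driftSpeed := by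
  refine le_of_forall_gt_imp_ge_of_dense fun b hb => ?_
  induction b with
  | top => exact le_top
  | coe T =>
    refine iInf₂_le T (G_subset_closure_reachableWithin h hs ?_)
    have hs0 := driftSpeed_pos h
    rw [ENNReal.div_lt_iff (Or.inl (by simpa using hs0)) (Or.inl ENNReal.ofReal_ne_top)] at hb
    rwa [ENNReal.ofReal_mul T.coe_nonneg, ENNReal.ofReal_coe_nnreal]

end ControlSystem

end QuantumControl

/-! ### Concatenation of curves -/

namespace QuantumControl

open Filter Topology MeasureTheory
open NormedSpace (exp)

section Concatenation

/-- The concatenation of two curves parametrized by `[0, 1]`, run at double speed. -/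
def concat {α : Type*} (f₁ f₂ : ℝ → α) (s : ℝ) : α :=
  if s ≤ 1 / 2 then f₁ (2 * s) else f₂ (2 * s - 1)

theorem concat_of_le {α : Type*} {f₁ f₂ : ℝ → α} {s : ℝ} (hs : s ≤ 1 / 2) :
    concat f₁ f₂ s = f₁ (2 * s) := if_pos hs

theorem concat_of_ge {α : Type*} {f₁ f₂ : ℝ → α} (h : f₁ 1 = f₂ 0) {s : ℝ} (hs : 1 / 2 ≤ s) :
    concat f₁ f₂ s = f₂ (2 * s - 1) := by
  rcases hs.eq_or_lt with rfl | hs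
  · rw [concat_of_le le_rfl]; norm_num [h]
  · exact if_neg hs.not_ge

theorem concat_zero {α : Type*} {f₁ f₂ : ℝ → α} : concat f₁ f₂ 0 = f₁ 0 := by
  rw [concat_of_le (by norm_num), mul_zero]

theorem concat_one {α : Type*} {f₁ f₂ : ℝ → α} : concat f₁ f₂ 1 = f₂ 1 := by
  norm_num [concat]

theorem comp_concat {α β : Type*} (F : α → β) (f₁ f₂ : ℝ → α) (s : ℝ) :
    F (concat f₁ f₂ s) = concat (fun r => F (f₁ r)) (fun r => F (f₂ r)) s :=
  apply_ite F _ _ _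

theorem concat_mem {α : Type*} {f₁ f₂ : ℝ → α} {V : Set α}
    (h₁ : ∀ t ∈ Set.Icc (0 : ℝ) 1, f₁ t ∈ V) (h₂ : ∀ t ∈ Set.Icc (0 : ℝ) 1, f₂ t ∈ V) :
    ∀ t ∈ Set.Icc (0 : ℝ) 1, concat f₁ f₂ t ∈ V := by
  intro t ht
  rw [concat]
  split_ifs with h
  · exact h₁ _ ⟨by linarith [ht.1], by linarith⟩
  · exact h₂ _ ⟨by linarith, by linarith [ht.2]⟩

theorem mapsTo_left_half :
    Set.MapsTo (fun s : ℝ => 2 * s) (Set.Icc 0 (1 / 2)) (Set.Icc 0 1) :=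
  fun s hs => ⟨by linarith [hs.1], by linarith [hs.2]⟩

theorem mapsTo_right_half :
    Set.MapsTo (fun s : ℝ => 2 * s - 1) (Set.Icc (1 / 2) 1) (Set.Icc 0 1) :=
  fun s hs => ⟨by linarith [hs.1], by linarith [hs.2]⟩

theorem Icc_halves : Set.Icc (0 : ℝ) (1 / 2) ∪ Set.Icc (1 / 2) 1 = Set.Icc 0 1 :=
  Set.Icc_union_Icc_eq_Icc (by norm_num) (by norm_num)

theorem continuousOn_concat {E : Type*} [TopologicalSpace E] {f₁ f₂ : ℝ → E}
    (h₁ : ContinuousOn f₁ (Set.Icc 0 1)) (h₂ : ContinuousOn f₂ (Set.Icc 0 1)) (h : f₁ 1 = f₂ 0) :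
    ContinuousOn (concat f₁ f₂) (Set.Icc 0 1) := by
  rw [← Icc_halves]
  refine ContinuousOn.union_of_isClosed ?_ ?_ isClosed_Icc isClosed_Icc
  · exact (h₁.comp (by fun_prop) mapsTo_left_half).congr fun s hs => concat_of_le hs.2
  · exact (h₂.comp (by fun_prop) mapsTo_right_half).congr fun s hs => concat_of_ge h hs.1

theorem hasDerivWithinAt_concat {E : Type*} [NormedAddCommGroup E] [NormedSpace ℝ E]
    {f₁ f₂ f₁' f₂' : ℝ → E}
    (h₁ : ∀ t ∈ Set.Icc (0 : ℝ) 1, HasDerivWithinAt f₁ (f₁' t) (Set.Icc 0 1) t)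
    (h₂ : ∀ t ∈ Set.Icc (0 : ℝ) 1, HasDerivWithinAt f₂ (f₂' t) (Set.Icc 0 1) t)
    (h : f₁ 1 = f₂ 0) (h' : f₁' 1 = f₂' 0) {t : ℝ} (ht : t ∈ Set.Icc (0 : ℝ) 1) :
    HasDerivWithinAt (concat f₁ f₂) ((2 : ℝ) • concat f₁' f₂' t) (Set.Icc 0 1) t := by
  rw [← Icc_halves]
  refine HasDerivWithinAt.union ?_ ?_
  · by_cases hs : t ≤ 1 / 2
    · have hd : HasDerivWithinAt (fun s : ℝ => 2 * s) 2 (Set.Icc 0 (1 / 2)) t := by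
        simpa using ((hasDerivAt_id t).const_mul 2).hasDerivWithinAt
      have hm : t ∈ Set.Icc (0 : ℝ) (1 / 2) := ⟨ht.1, hs⟩
      have := HasDerivWithinAt.scomp t (h₁ _ (mapsTo_left_half hm)) hd mapsTo_left_half
      rw [concat_of_le hs]
      exact this.congr (fun s hs => concat_of_le hs.2) (concat_of_le hs)
    -- Away from a closed half interval the derivative within it is vacuous.
    · exact HasFDerivWithinAt.of_notMem_closure (by
        rw [isClosed_Icc.closure_eq]; exact fun hm => hs hm.2)
  · by_cases hs : 1 / 2 ≤ t
    · have hd : HasDerivWithinAt (fun s : ℝ => 2 * s - 1) 2 (Set.Icc (1 / 2) 1) t := by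
        simpa using (((hasDerivAt_id t).const_mul 2).sub_const 1).hasDerivWithinAt
      have hm : t ∈ Set.Icc (1 / 2 : ℝ) 1 := ⟨hs, ht.2⟩
      have := HasDerivWithinAt.scomp t (h₂ _ (mapsTo_right_half hm)) hd mapsTo_right_half
      rw [concat_of_ge h' hs]
      exact this.congr (fun s hs => concat_of_ge h hs.1) (concat_of_ge h hs)
    · exact HasFDerivWithinAt.of_notMem_closure (by
        rw [isClosed_Icc.closure_eq]; exact fun hm => hs hm.1)

theorem integral_concat {f₁ f₂ : ℝ → ℝ} (h₁ : ContinuousOn f₁ (Set.Icc 0 1))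
    (h₂ : ContinuousOn f₂ (Set.Icc 0 1)) (h : f₁ 1 = f₂ 0) :
    ∫ s in (0 : ℝ)..1, 2 * concat f₁ f₂ s =
      (∫ s in (0 : ℝ)..1, f₁ s) + ∫ s in (0 : ℝ)..1, f₂ s := by
  have hc := continuousOn_concat h₁ h₂ h
  have hi : ∀ a b : ℝ, 0 ≤ a → a ≤ b → b ≤ 1 →
      IntervalIntegrable (concat f₁ f₂) volume a b := fun a b ha hab hb =>
    (hc.mono (by rw [Set.uIcc_of_le hab]; exact Set.Icc_subset_Icc ha hb)).intervalIntegrable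
  rw [intervalIntegral.integral_const_mul, ← intervalIntegral.integral_add_adjacent_intervals
    (hi 0 (1 / 2) le_rfl (by norm_num) (by norm_num))
    (hi (1 / 2) 1 (by norm_num) (by norm_num) le_rfl), mul_add]
  congr 1
  · rw [intervalIntegral.integral_congr (g := fun s => f₁ (2 * s)) fun s hs => ?_,
      ← smul_eq_mul, intervalIntegral.smul_integral_comp_mul_left]
    · norm_num
    · rw [Set.uIcc_of_le (by norm_num)] at hs
      exact concat_of_le hs.2
  · rw [intervalIntegral.integral_congr (g := fun s => f₂ (2 * s - 1)) fun s hs => ?_,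
      ← smul_eq_mul, intervalIntegral.smul_integral_comp_mul_sub]
    · norm_num
    · rw [Set.uIcc_of_le (by norm_num)] at hs
      exact concat_of_ge h hs.1

end Concatenation

/-- A smooth step from `0` to `1`. -/
def smoothStep (s : ℝ) : ℝ := 3 * s ^ 2 - 2 * s ^ 3

theorem hasDerivAt_smoothStep (s : ℝ) : HasDerivAt smoothStep (6 * s * (1 - s)) s := by
  have := ((hasDerivAt_pow 2 s).const_mul 3).sub ((hasDerivAt_pow 3 s).const_mul 2)
  exact this.congr_deriv (by push_cast; ring)

theorem integral_deriv_smoothStep : ∫ s in (0 : ℝ)..1, 6 * s * (1 - s) = 1 := by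
  rw [intervalIntegral.integral_eq_sub_of_hasDerivAt fun s _ => hasDerivAt_smoothStep s]
  · norm_num [smoothStep]
  · exact (by fun_prop : Continuous fun s : ℝ => 6 * s * (1 - s)).intervalIntegrable _ _

theorem hasDerivWithinAt_exp_smoothStep_smul_mul {E : Type*} [NormedRing E] [NormedAlgebra ℝ E]
    [CompleteSpace E] (X h : E) (I : Set ℝ) (s : ℝ) :
    HasDerivWithinAt (fun s => exp (smoothStep s • X) * h)
      (((6 * s * (1 - s)) • X) * (exp (smoothStep s • X) * h)) I s := by
  have := ((hasDerivAt_exp_smul_const' (𝕂 := ℝ) X (smoothStep s)).scomp s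
    (hasDerivAt_smoothStep s)).mul_const h
  rw [← smul_mul_assoc, mul_assoc] at this
  exact this.hasDerivWithinAt

end QuantumControl

/-! ### The lower bound for the speed limit -/

namespace QuantumControl

open scoped Matrix.Norms.Frobenius
open Matrix Filter Topology MeasureTheory
open NormedSpace (exp)

variable {n m : ℕ}

namespace ControlSystem

variable (S : ControlSystem n m)

/-- The points `g` and `h` are joined by a lifted curve of length `ℓ` which is at rest at both
ends. -/
def FlatJoin (g h : S.G) (ℓ : ℝ) : Prop :=
  ∃ c : S.LiftedCurve, c.g 0 = g ∧ c.g 1 = h ∧ c.length = ℓ ∧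
    (c.Y 0 = 0 ∧ c.Z 0 = 0) ∧ c.Y 1 = 0 ∧ c.Z 1 = 0

variable {S}

theorem FlatJoin.quotientDist_le {g h : S.G} {ℓ : ℝ} (hj : S.FlatJoin g h ℓ) :
    S.quotientDist (Quotient.mk _ g) (Quotient.mk _ h) ≤ ENNReal.ofReal ℓ := by
  obtain ⟨c, h0, h1, rfl, -⟩ := hj
  exact iInf_le_of_le c (iInf₂_le (by rw [h0]) (by rw [h1]))

theorem killingNorm_smul {X : Mat n} (hX : X ∈ su n) (c : ℝ) :
    killingNorm (c • X) = |c| * killingNorm X := by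
  rw [killingNorm_eq hX.1, killingNorm_eq ((su n).smul_mem c hX).1, norm_smul, Real.norm_eq_abs]
  ring

theorem killingNorm_zero : killingNorm (0 : Mat n) = 0 := by
  simp [killingNorm, killing]

theorem continuousOn_killingNorm {Y : ℝ → Mat n} {I : Set ℝ} (hY : ContinuousOn Y I) :
    ContinuousOn (fun t => killingNorm (Y t)) I := by
  have : Continuous fun X : Mat n => killingNorm X := by
    unfold killingNorm killing
    fun_prop
  exact this.comp_continuousOn hY

theorem continuousOn_smul_concat {f₁ f₂ : ℝ → Mat n} (h₁ : ContinuousOn f₁ (Set.Icc 0 1))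
    (h₂ : ContinuousOn f₂ (Set.Icc 0 1)) (h : f₁ 1 = f₂ 0) :
    ContinuousOn (fun s => (2 : ℝ) • concat f₁ f₂ s) (Set.Icc 0 1) :=
  (continuousOn_concat h₁ h₂ h).fun_const_smul 2

theorem hasDerivWithinAt_concat_mul {U₁ U₂ a₁ a₂ : ℝ → Mat n}
    (h₁ : ∀ t ∈ Set.Icc (0 : ℝ) 1, HasDerivWithinAt U₁ (a₁ t * U₁ t) (Set.Icc 0 1) t)
    (h₂ : ∀ t ∈ Set.Icc (0 : ℝ) 1, HasDerivWithinAt U₂ (a₂ t * U₂ t) (Set.Icc 0 1) t)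
    (h : U₁ 1 = U₂ 0) (h' : a₁ 1 = a₂ 0) {t : ℝ} (ht : t ∈ Set.Icc (0 : ℝ) 1) :
    HasDerivWithinAt (concat U₁ U₂) (((2 : ℝ) • concat a₁ a₂ t) * concat U₁ U₂ t)
      (Set.Icc 0 1) t := by
  have h2 : ((2 : ℝ) • concat a₁ a₂ t) * concat U₁ U₂ t =
      (2 : ℝ) • concat (fun r => a₁ r * U₁ r) (fun r => a₂ r * U₂ r) t := by
    rw [smul_mul_assoc]
    unfold concat
    split_ifs <;> rfl
  rw [h2]
  exact hasDerivWithinAt_concat h₁ h₂ h (by rw [h, h']) ht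

/-- Both curves are at rest at the junction, so the velocities match there and the concatenation is
again `C¹`. -/
theorem FlatJoin.trans {g h f : S.G} {ℓ ℓ' : ℝ} (h₁ : S.FlatJoin g h ℓ) (h₂ : S.FlatJoin h f ℓ') :
    S.FlatJoin g f (ℓ + ℓ') := by
  obtain ⟨c, rfl, hc1, rfl, ⟨hY0, hZ0⟩, hY1, hZ1⟩ := h₁
  obtain ⟨d, hd0, rfl, rfl, ⟨hY0', hZ0'⟩, hY1', hZ1'⟩ := h₂
  have hg : c.g 1 = d.g 0 := hc1.trans hd0.symm
  have hY : c.Y 1 = d.Y 0 := hY1.trans hY0'.symm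
  have hZ : c.Z 1 = d.Z 0 := hZ1.trans hZ0'.symm
  have hYm := concat_mem (V := (S.pSpace : Set (Mat n))) c.Y_mem d.Y_mem
  refine ⟨{ g := concat c.g d.g
            Y := fun s => (2 : ℝ) • concat c.Y d.Y s
            Z := fun s => (2 : ℝ) • concat c.Z d.Z s
            Y_continuousOn := continuousOn_smul_concat c.Y_continuousOn d.Y_continuousOn hY
            Z_continuousOn := continuousOn_smul_concat c.Z_continuousOn d.Z_continuousOn hZ
            Y_mem := fun t ht => S.pSpace.smul_mem _ (hYm t ht)
            Z_mem := fun t ht => S.kAlg.smul_mem _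
              (concat_mem (V := (S.kAlg : Set (Mat n))) c.Z_mem d.Z_mem t ht)
            hasDeriv := fun t ht => ?_ }, concat_zero, concat_one, ?_, ⟨?_, ?_⟩, ?_, ?_⟩
  · have h1 := hasDerivWithinAt_concat_mul c.hasDeriv d.hasDeriv (by rw [hg]) (by rw [hY, hZ]) ht
    have h2 : (fun s => (((concat c.g d.g s : S.G) : SU n) : Mat n)) =
        concat (fun s => ((c.g s : SU n) : Mat n)) (fun s => ((d.g s : SU n) : Mat n)) :=
      funext fun s => comp_concat (fun g : S.G => ((g : SU n) : Mat n)) c.g d.g s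
    have h3 : concat (fun s => c.Y s + c.Z s) (fun s => d.Y s + d.Z s) t =
        concat c.Y d.Y t + concat c.Z d.Z t := by
      unfold concat
      split_ifs <;> rfl
    rw [← congrFun h2 t, ← h2, h3, smul_add] at h1
    exact h1
  · rw [LiftedCurve.length, LiftedCurve.length, LiftedCurve.length, ← integral_concat
      (continuousOn_killingNorm c.Y_continuousOn) (continuousOn_killingNorm d.Y_continuousOn)
      (by rw [hY])]
    refine intervalIntegral.integral_congr fun t ht => ?_
    rw [Set.uIcc_of_le zero_le_one] at ht
    simp only
    rw [killingNorm_smul (S.gAlg_le_su (hYm t ht).1), abs_of_pos two_pos, comp_concat killingNorm]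
  · simp only [concat_zero, hY0, smul_zero]
  · simp only [concat_zero, hZ0, smul_zero]
  · simp only [concat_one, hY1', smul_zero]
  · simp only [concat_one, hZ1', smul_zero]

/-- The path is `exp (smoothStep s • (Y + Z)) * g`. The derivative of `smoothStep` vanishes at both
ends, and only `Y` contributes to the length. -/
theorem flatJoin_exp_mul {Y Z : Mat n} (hY : Y ∈ S.pSpace) (hZ : Z ∈ S.kAlg) {g h : S.G}
    (hgh : ((h : SU n) : Mat n) = exp (Y + Z) * ((g : SU n) : Mat n)) :
    S.FlatJoin g h (killingNorm Y) := by
  have hX : Y + Z ∈ S.gAlg := S.gAlg.add_mem hY.1 (S.kAlg_le_gAlg hZ)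
  have hmem : ∀ s : ℝ, suExp (s • (Y + Z)) (S.gAlg_le_su (S.gAlg.smul_mem s hX)) ∈ S.G := fun s =>
    exp_mem_expGroup (S.gAlg.smul_mem s hX) rfl
  have hc : Continuous fun s : ℝ => 6 * s * (1 - s) := by fun_prop
  refine ⟨{ g := fun s => ⟨_, hmem (smoothStep s)⟩ * g
            Y := fun s => (6 * s * (1 - s)) • Y
            Z := fun s => (6 * s * (1 - s)) • Z
            Y_continuousOn := (hc.smul continuous_const).continuousOn
            Z_continuousOn := (hc.smul continuous_const).continuousOn
            Y_mem := fun t _ => S.pSpace.smul_mem _ hY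
            Z_mem := fun t _ => S.kAlg.smul_mem _ hZ
            hasDeriv := fun t _ => ?_ }, ?_, ?_, ?_, ⟨?_, ?_⟩, ?_, ?_⟩
  · rw [← smul_add]
    exact hasDerivWithinAt_exp_smoothStep_smul_mul (Y + Z) ((g : SU n) : Mat n) _ t
  · refine Subtype.ext (Subtype.ext ?_)
    change exp (smoothStep 0 • (Y + Z)) * ((g : SU n) : Mat n) = _
    rw [show smoothStep 0 = 0 by norm_num [smoothStep], zero_smul, NormedSpace.exp_zero, one_mul]
  · refine Subtype.ext (Subtype.ext ?_)
    change exp (smoothStep 1 • (Y + Z)) * ((g : SU n) : Mat n) = _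
    rw [show smoothStep 1 = 1 by norm_num [smoothStep], one_smul, hgh]
  · rw [LiftedCurve.length, intervalIntegral.integral_congr
      (g := fun s => 6 * s * (1 - s) * killingNorm Y) fun s hs => ?_,
      intervalIntegral.integral_mul_const, integral_deriv_smoothStep, one_mul]
    rw [Set.uIcc_of_le zero_le_one] at hs
    simp only
    rw [killingNorm_smul (S.gAlg_le_su hY.1), abs_of_nonneg]
    exact mul_nonneg (by linarith [hs.1]) (by linarith [hs.2])
  all_goals norm_num

/-- Since `iH_d ∈ 𝔭`, a pulse of duration `τ` moves in `G/K` by exactly `τ` times the speed; the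
control part lies in `𝔨` and adds no length. -/
theorem PulseProduct.flatJoin (hp : S.iDrift ∈ S.pSpace) {t : ℝ} {u : Mat n}
    (hu : S.PulseProduct t u) {g h : S.G}
    (hgh : ((h : SU n) : Mat n) = u * ((g : SU n) : Mat n)) :
    S.FlatJoin g h (t * S.driftSpeed) := by
  induction hu generalizing h with
  | one =>
    have := flatJoin_exp_mul (S := S) (g := g) (h := h) S.pSpace.zero_mem S.kAlg.zero_mem
      (by rw [add_zero, NormedSpace.exp_zero, hgh])
    rwa [killingNorm_zero, ← zero_mul S.driftSpeed] at this
  | @step t τ u B hu hτ hB ih =>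
    obtain ⟨v, hv, rfl⟩ := hu.exists_mem_G
    have h1 := ih (h := ⟨v, hv⟩ * g) rfl
    have h2 := flatJoin_exp_mul (S := S) (g := ⟨v, hv⟩ * g) (h := h)
      (S.pSpace.smul_mem (-τ) hp) (S.kAlg.neg_mem (span_control_le_kAlg hB))
      (by rw [hgh, neg_add, neg_smul, mul_assoc]; rfl)
    rw [killingNorm_smul (S.gAlg_le_su S.iDrift_mem_gAlg), abs_neg, abs_of_pos hτ,
      killingNorm_eq (S.skew_of_mem_gAlg S.iDrift_mem_gAlg), ← driftSpeed_eq] at h2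
    rw [add_mul]
    exact h1.trans h2

/-- A pulse product approximates `h g⁻¹` in matrix norm. By the local structure of `G` the remaining
factor is `exp Z · exp V` with `Z ∈ 𝔨`, which adds no length, and `V ∈ 𝔭` small. -/
theorem exists_flatJoin (hl : ClosedPair S.kAlg S.gAlg) (hp : S.iDrift ∈ S.pSpace) {T : ℝ}
    (hT : (S.G : Set (SU n)) ⊆ closure (S.reachableWithin T)) (g h : S.G) {ε : ℝ} (hε : 0 < ε) :
    ∃ ℓ ≤ T * S.driftSpeed + ε, S.FlatJoin g h ℓ := by
  set σ := Real.sqrt (2 * n) with hσ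
  have hσ0 : 0 ≤ σ := Real.sqrt_nonneg _
  set f : SU n := (h : SU n) * (g : SU n)⁻¹ with hf
  have hfG : f ∈ S.G := S.G.mul_mem h.2 (S.G.inv_mem g.2)
  have hloc := hl.eventually_eq_exp_mul_exp S.kAlg_sup_pSpace
    (show 0 < ε / (σ + 1) by positivity)
  have hcont : Tendsto (fun u : SU n => f * u⁻¹) (𝓝 f) (𝓝 1) := by
    have : Continuous fun u : SU n => f * u⁻¹ := continuous_const.mul continuous_inv
    simpa using this.tendsto f
  have hev := hcont.eventually hloc
  rw [nhds_subtype_eq_comap, Filter.eventually_comap] at hev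
  obtain ⟨δ, hδ, hev⟩ := Metric.eventually_nhds_iff.1 hev
  obtain ⟨r, hr, hr'⟩ : ∃ r ∈ S.reachableWithin T, ‖(r : Mat n) - (f : Mat n)‖ < δ / 2 := by
    have h1 := hT hfG
    rw [closure_subtype] at h1
    obtain ⟨_, ⟨r, hr, rfl⟩, hr'⟩ := Metric.mem_closure_iff.1 h1 (δ / 2) (half_pos hδ)
    rw [dist_comm, dist_eq_norm] at hr'
    exact ⟨r, hr, hr'⟩
  -- The errors `δ / 3` and `δ / 2` add up to less than `δ`.
  obtain ⟨t, htT, v, hv, hvr⟩ := exists_pulseProduct_near hr (show 0 < δ / 3 by positivity)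
  obtain ⟨u, huG, rfl⟩ := hv.exists_mem_G
  have hdist : dist (u : Mat n) (f : Mat n) < δ := by
    rw [dist_eq_norm, ← sub_add_sub_cancel _ (r : Mat n)]
    linarith [norm_add_le ((u : Mat n) - (r : Mat n)) ((r : Mat n) - (f : Mat n))]
  obtain ⟨Z, hZ, V, hV, -, hVε, hZV⟩ := hev hdist u rfl
    (Subgroup.le_topologicalClosure _ (S.G.mul_mem hfG (S.G.inv_mem huG)))
  have h1 : S.FlatJoin g (⟨u, huG⟩ * g) (t * S.driftSpeed) := hv.flatJoin hp rfl
  have hw : suExp V (S.gAlg_le_su hV.1) ∈ S.G := exp_mem_expGroup hV.1 rfl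
  have h2 : S.FlatJoin (⟨u, huG⟩ * g) (⟨_, hw⟩ * (⟨u, huG⟩ * g)) (killingNorm V) :=
    flatJoin_exp_mul hV S.kAlg.zero_mem (by rw [add_zero]; rfl)
  have h3 : S.FlatJoin (⟨_, hw⟩ * (⟨u, huG⟩ * g)) h (killingNorm (0 : Mat n)) := by
    refine flatJoin_exp_mul S.pSpace.zero_mem hZ ?_
    rw [zero_add]
    change _ = exp Z * (exp V * ((u : Mat n) * ((g : SU n) : Mat n)))
    rw [← mul_assoc, ← hZV, ← Submonoid.coe_mul, ← Submonoid.coe_mul]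
    congr 1
    rw [hf]
    group
  refine ⟨_, ?_, h1.trans (h2.trans h3)⟩
  rw [killingNorm_zero, add_zero, killingNorm_eq (S.skew_of_mem_gAlg hV.1)]
  refine add_le_add (mul_le_mul_of_nonneg_right htT (Real.sqrt_nonneg _)) ?_
  calc σ * ‖V‖ ≤ σ * (ε / (σ + 1)) := mul_le_mul_of_nonneg_left hVε.le hσ0
    _ ≤ (σ + 1) * (ε / (σ + 1)) := by gcongr; linarith
    _ = ε := mul_div_cancel₀ _ (by positivity)

theorem quotientDiam_le (hl : ClosedPair S.kAlg S.gAlg) (hp : S.iDrift ∈ S.pSpace) {T : ℝ}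
    (hT : (S.G : Set (SU n)) ⊆ closure (S.reachableWithin T)) :
    S.quotientDiam ≤ ENNReal.ofReal (T * S.driftSpeed) := by
  refine iSup₂_le fun x y => ?_
  induction x using Quotient.inductionOn with | _ g
  induction y using Quotient.inductionOn with | _ f
  refine ENNReal.le_of_forall_pos_le_add fun ε hε _ => ?_
  obtain ⟨ℓ, hℓ, hj⟩ := exists_flatJoin hl hp hT g f (ε := ε) hε
  refine hj.quotientDist_le.trans ((ENNReal.ofReal_le_ofReal hℓ).trans
    (ENNReal.ofReal_add_le.trans ?_))
  rw [ENNReal.ofReal_coe_nnreal]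

theorem le_speedLimit (hl : ClosedPair S.kAlg S.gAlg) (hp : S.iDrift ∈ S.pSpace) :
    S.quotientDiam / ENNReal.ofReal S.driftSpeed ≤ S.speedLimit := by
  refine le_iInf₂ fun T hT => ENNReal.div_le_of_le_mul ?_
  have := quotientDiam_le hl hp hT
  rwa [ENNReal.ofReal_mul T.coe_nonneg, ENNReal.ofReal_coe_nnreal] at this

/-- The upper bound uses that the orbit is the sphere; the lower bound uses its consequence `𝔤 = 𝔨 +
[𝔤, 𝔤]`. -/
theorem boundIsTight (hK : IsClosed (S.K : Set (SU n))) (hp : S.iDrift ∈ S.pSpace)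
    (h : S.drift ≠ 0) (h2 : 2 ≤ Module.finrank ℝ S.pSpace) (hT : S.orbitTangent = S.driftPerp) :
    S.BoundIsTight :=
  le_antisymm (speedLimit_le h (S.adjointOrbit_eq_driftSphere hK hp h h2 hT).ge)
    (le_speedLimit (S.closedPair_gAlg hK hp h h2 hT) hp)

end ControlSystem

end QuantumControl

end

theorem mainTheorem4 {n m : ℕ} (S : QuantumControl.ControlSystem n m)
    (hK : IsClosed (S.K : Set (QuantumControl.SU n))) :
    -- the dimension of the adjoint orbit
    QuantumControl.HasManifoldDim (S.adjointOrbit S.iDrift)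
      (Module.finrank ℝ S.kAlg - Module.finrank ℝ S.driftCentralizer) ∧
    (S.iDrift ∈ S.pSpace → S.drift ≠ 0 →
      -- the inequality
      (Module.finrank ℝ S.driftCentralizer : ℤ) ≥
        1 + (Module.finrank ℝ S.kAlg : ℤ) - (Module.finrank ℝ S.pSpace : ℤ) ∧
      -- the case of equality
      (S.Controllable ∨ 2 ≤ Module.finrank ℝ S.pSpace →
        ((Module.finrank ℝ S.driftCentralizer : ℤ) =
            1 + (Module.finrank ℝ S.kAlg : ℤ) - (Module.finrank ℝ S.pSpace : ℤ) ↔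
          S.adjointOrbit S.iDrift = S.driftSphere) ∧
        ((Module.finrank ℝ S.driftCentralizer : ℤ) =
            1 + (Module.finrank ℝ S.kAlg : ℤ) - (Module.finrank ℝ S.pSpace : ℤ) →
          S.BoundIsTight))) ∧
    -- the control algebra `𝔰𝔬(n)` with a diagonal drift
    ((S.kAlg : Set (QuantumControl.Mat n)) = QuantumControl.soSet n →
      ∀ lam : Fin n → ℝ, S.drift = Matrix.diagonal (fun i => (lam i : ℂ)) →
        Module.finrank ℝ S.driftCentralizer = QuantumControl.degeneratePairs lam ∧
        QuantumControl.HasManifoldDim (S.adjointOrbit S.iDrift)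
          (Module.finrank ℝ S.kAlg - QuantumControl.degeneratePairs lam)) := by
  refine ⟨S.hasManifoldDim_adjointOrbit hK, fun hp h => ⟨S.finrank_driftCentralizer_ge hp h,
    fun hc => ?_⟩, fun hk lam hd => ?_⟩
  · have h2 : 2 ≤ Module.finrank ℝ S.pSpace := hc.elim (S.two_le_finrank_pSpace hp h) id
    exact ⟨(S.finrank_eq_iff hp h).trans (S.orbitTangent_eq_iff hK hp h h2),
      fun he => QuantumControl.ControlSystem.boundIsTight hK hp h h2
        ((S.finrank_eq_iff hp h).1 he)⟩
  · have hf := S.finrank_driftCentralizer_of_so hk hd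
    exact ⟨hf, hf ▸ S.hasManifoldDim_adjointOrbit hK⟩
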